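/- **Setting.** A (homogeneous) KZ-type equation in the points $x_0,\dots,x_4$ is given by endomorphisms ("residue matrices") $A_{i,j}$ ($0\le i,j\le 4$) of a finite-dimensional complex vector space $V$ with $A_{i,j}=A_{j,i}$, $A_{i,i}=0$, $A_{i,4}=-\sum_{\nu=0}^{3}A_{i,\nu}$ for $i\neq 4$, and, with $A_I:=\sum_{i<j,\ i,j\in I}A_{i,j}$, $[A_I,A_J]=0$ whenever $I\cap J=\emptyset$ or $I\subset J$, and $A_I=0$ whenever $\#I=4$. Normalizing $(x_0,x_1,x_2,x_3,x_4)=(x,y,1,0,\infty)$ it reads $$\frac{\partial u}{\partial x}=\Bigl(\frac{A_{01}}{x-y}+\frac{A_{02}}{x-1}+\frac{A_{03}}{x}\Bigr)u,\qquad \frac{\partial u}{\partial y}=\Bigl(\frac{A_{01}}{y-x}+\frac{A_{12}}{y-1}+\frac{A_{13}}{y}\Bigr)u .$$ *The transformation.* For $\lambda,\tau\in\mathbb C$ let $\tilde A_{i,j}$ be the residue matrices on $V^3$ determined, by the same rules, by $$\tilde A_{01}=\begin{pmatrix}A_{01}-\tau-\lambda&A_{02}&A_{03}+\lambda\\0&0&0\\0&0&0\end{pmatrix},\quad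 \tilde A_{02}=\begin{pmatrix}0&0&0\\A_{01}&A_{02}-\tau-\lambda&A_{03}+\lambda\\0&0&0\end{pmatrix},\quad \tilde A_{03}=\begin{pmatrix}\tau&0&0\\0&\tau&0\\A_{01}&A_{02}&A_{03}\end{pmatrix},$$ $$\tilde A_{12}=\begin{pmatrix}A_{12}+A_{02}&-A_{02}&0\\-A_{01}&A_{12}+A_{01}&0\\0&0&A_{12}\end{pmatrix},\quad \tilde A_{13}=\begin{pmatrix}A_{13}+A_{03}+\lambda&0&-A_{03}-\lambda\\0&A_{13}&0\\-A_{01}&0&A_{01}+A_{13}\end{pmatrix},\quad \tilde A_{23}=\begin{pmatrix}A_{23}&0&0\\0&A_{03}+A_{23}+\lambda&-A_{03}-\lambda\\0&-A_{02}&A_{02}+A_{23}\end{pmatrix},$$ and let $\mathcal L=\bigl(\ker A_{01}\oplus\ker A_{02}\oplus\ker(A_{03}+\lambda)\bigr)+\ker(\tilde A_{04}+\tau)\subset V^3$. The $\tilde A_{i,j}$ induce residue matrices on $V^3/\mathcal L$; denote the resulting equation by $T_x^{\lambda,\tau}(A)$. (It equals $\mathrm{Ad}((x_0-x_3)^\tau)\circ\mathrm{mc}_{-\tau-\lambda}\circ\mathrm{Ad}((x_0-x_3)^\lambda)$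 and corresponds to the integral transformation $x^ky^l\mapsto\frac{(\lambda)_k}{(1-\tau)_k}x^ky^l$.) Let $T_{1-y}^{\lambda,\tau}$ be its conjugate by the permutation $(0\,1)(2\,3)$ of the indices. *The equation.* Let $p,q\ge1$, $\gamma\in\mathbb C$, $\alpha_1,\dots,\alpha_{p-1}$, $\alpha'_1,\dots,\alpha'_{p}$, $\beta_1,\dots,\beta_{q-1}$, $\beta'_1,\dots,\beta'_{q}$ be complex numbers with $\alpha'_p=\beta'_q=0$. Put $$I_{p,q}(x,y)=\sum_{k,l\ge0}\frac{\prod_{i=1}^{p-1}(\alpha_i)_k\prod_{j=1}^{q-1}(\beta_j)_l\,(\gamma)_{k+l}}{\prod_{i=1}^{p}(1-\alpha'_i)_k\prod_{j=1}^{q}(1-\beta'_j)_l}\,x^ky^l ,$$ $$\alpha''=\sum_{i=1}^{p-1}\alpha_i+\sum_{i=1}^{p}\alpha'_i,\quad \beta''=\sum_{j=1}^{q-1}\beta_j+\sum_{j=1}^{q}\beta'_j,\quad a_k=\sum_{k\le i<p}(\alpha_i+\alpha'_i),\quad b_l=\sum_{l\le j<q}(\beta_j+\beta'_j).$$ Let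 $\mathcal M$ be the equation $$\mathcal M=T_x^{\alpha_1,\alpha'_1}\cdots T_x^{\alpha_{p-1},\alpha'_{p-1}}\,T_{1-y}^{\beta_1,\beta'_1}\cdots T_{1-y}^{\beta_{q-1},\beta'_{q-1}}\,\mathcal M_0,$$ where $\mathcal M_0$ is the rank one equation of $(y-x)^{-\gamma}$, that is $V=\mathbb C$, $A_{01}=-\gamma$, $A_{23}=\gamma$, $A_{02}=A_{03}=A_{12}=A_{13}=0$. Let $A_{i,j}$ be the residue matrices of $\mathcal M$. *Genericity.* Assume, for all admissible indices: no $\alpha'_i$ and no $\beta'_j$ is a positive integer; the $\alpha_i$ are pairwise distinct, and so are the $\alpha'_i$, the $\beta_j$ and the $\beta'_j$; $\alpha_i+\alpha'_{i'}\ne0$, $\beta_j+\beta'_{j'}\neq0$, $\alpha'_i+\beta'_j+\gamma\ne0$; $\alpha_i\ne\beta'_j+\gamma$, $\beta_j\neq\alpha'_i+\gamma$, $\alpha_i+\beta_j\ne\gamma$; for all $1\le k\le p$ and $1\le l\le q$: $a_k+\beta''+\gamma\ne0$, $b_l+\gamma\neq0$, $\beta_j\ne a_k+\gamma$, $\beta'_j+a_k+\gamma\ne0$;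 and $\alpha_i\ne\beta''+\gamma$, $\alpha'_i+\beta''+\gamma\neq0$. **Theorem.** Under these assumptions $\mathcal M$ is a homogeneous KZ-type equation of rank $pq$, and in a neighborhood of $(0,1)$ the function $I_{p,q}(x,1-y)$ is a component of a solution of $\mathcal M$. The simultaneous eigenvalues, with multiplicities, of the 15 commuting pairs of residue matrices are as follows. Here $[A:B]=\{[\lambda_1:\lambda'_1]_{m_1},\dots\}$ means that, for all $\lambda,\lambda'\in\mathbb C$, the dimension of the simultaneous eigenspace $\ker(A-\lambda)\cap\ker(B-\lambda')$ is the sum of the $m_\nu$ with $(\lambda_\nu,\lambda'_\nu)=(\lambda,\lambda')$; an omitted multiplicity is $1$; and entries with free indices occur once for each value of the indices ($\alpha_i$: $1\le i\le p-1$; $\alpha'_i$: $1\le i\le p$; $\beta_j$: $1\le j\le q-1$; $\beta'_j$: $1\le j\le q$). \begin{align*} [A_{01}:A_{23}]&=\{[-\alpha''-\beta''-\gamma:\gamma],\,[0:\gamma]_{p+q-2},\,[0:\alpha_i+\beta_j]\},\\ [A_{01}:A_{24}]&=\{[-\alpha''-\beta''-\gamma:-\beta''-\gamma],\,[0:-\beta''-\gamma]_{p-1},\,[0:\alpha'_i]_{q-1}\},\\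 [A_{01}:A_{34}]&=\{[-\alpha''-\beta''-\gamma:-\alpha''-\gamma],\,[0:\beta'_j]_{p-1},\,[0:-\alpha''-\gamma]_{q-1}\},\\ [A_{02}:A_{13}]&=\{[0:\alpha_i-\beta''-\gamma],\,[0:0]_{pq-p-q+2},\,[\beta_j-\alpha''-\gamma:0]\},\\ [A_{02}:A_{14}]&=\{[0:\alpha'_i+\gamma],\,[0:\beta_j]_{p-1},\,[\beta_j-\alpha''-\gamma:\beta_j]\},\\ [A_{02}:A_{34}]&=\{[0:-\alpha''-\gamma],\,[0:\beta'_j]_{p-1},\,[\beta_j-\alpha''-\gamma:-\alpha''-\gamma]\},\\ [A_{03}:A_{12}]&=\{[\alpha'_i:\beta'_j]\},\\ [A_{03}:A_{14}]&=\{[\alpha'_i:\alpha'_i+\gamma],\,[\alpha'_i:\beta_j]\},\\ [A_{03}:A_{24}]&=\{[\alpha'_i:-\beta''-\gamma],\,[\alpha'_i:\alpha'_i]_{q-1}\},\\ [A_{04}:A_{12}]&=\{[\alpha_i:\beta'_j],\,[\beta'_j+\gamma:\beta'_j]\},\\ [A_{04}:A_{13}]&=\{[\alpha_i:\alpha_i-\beta''-\gamma],\,[\alpha_i:0]_{q-1},\,[\beta'_j+\gamma:0]\},\\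 [A_{04}:A_{23}]&=\{[\alpha_i:\gamma],\,[\beta'_j+\gamma:\gamma],\,[\alpha_i:\alpha_i+\beta_j]\},\\ [A_{12}:A_{34}]&=\{[\beta'_j:-\alpha''-\gamma],\,[\beta'_j:\beta'_j]_{p-1}\},\\ [A_{13}:A_{24}]&=\{[\alpha_i-\beta''-\gamma:-\beta''-\gamma],\,[0:-\beta''-\gamma],\,[0:\alpha'_i]_{q-1}\},\\ [A_{14}:A_{23}]&=\{[\alpha'_i+\gamma:\gamma],\,[\beta_j:\gamma],\,[\beta_j:\alpha_i+\beta_j]\}. \end{align*} -/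

import Mathlib

open scoped BigOperators

noncomputable section

namespace KZF2

/-- Data of a KZ-type equation in the five points `x₀, …, x₄`, given by its residue matrices
`A i j`, acting on a complex vector space `V`. The laws are in `KZ.IsKZType`. -/
structure KZ where
  V : Type
  [grp : AddCommGroup V]
  [mod : Module ℂ V]
  A : Fin 5 → Fin 5 → Module.End ℂ V

attribute [instance] KZ.grp KZ.mod

/-- `A_I = ∑_{i < j, i, j ∈ I} A_{i,j}`. -/
def KZ.resSum (S : KZ) (I : Finset (Fin 5)) : Module.End ℂ S.V :=
  ∑ i ∈ I, ∑ j ∈ I with i < j, S.A i j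

/-- The laws of a homogeneous KZ-type equation with `n = 3`:
`A_{i,j} = A_{j,i}`, `A_{i,i} = 0`, `A_{i,4} = -(A_{i,0} + A_{i,1} + A_{i,2} + A_{i,3})`,
`[A_I, A_J] = 0` if `I ∩ J = ∅` or `I ⊆ J`, and `A_I = 0` if `#I = 4`. -/
structure KZ.IsKZType (S : KZ) : Prop where
  symm : ∀ i j, S.A i j = S.A j i
  diag : ∀ i, S.A i i = 0
  infty : ∀ i, i ≠ 4 → S.A i 4 = -(S.A i 0 + S.A i 1 + S.A i 2 + S.A i 3)
  compat : ∀ I J : Finset (Fin 5), Disjoint I J ∨ I ⊆ J → Commute (S.resSum I) (S.resSum J)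
  homog : ∀ I : Finset (Fin 5), I.card = 4 → S.resSum I = 0

/-- All residue matrices from the six with indices in `{0, 1, 2, 3}`, by the rules
`A_{j,i} = A_{i,j}`, `A_{i,i} = 0` and `A_{i,4} = -∑_{ν ≤ 3} A_{i,ν}`. -/
def residues {V : Type} [AddCommGroup V] [Module ℂ V]
    (a01 a02 a03 a12 a13 a23 : Module.End ℂ V) : Fin 5 → Fin 5 → Module.End ℂ V :=
  ![![0, a01, a02, a03, -(a01 + a02 + a03)],
    ![a01, 0, a12, a13, -(a01 + a12 + a13)],
    ![a02, a12, 0, a23, -(a02 + a12 + a23)],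
    ![a03, a13, a23, 0, -(a03 + a13 + a23)],
    ![-(a01 + a02 + a03), -(a01 + a12 + a13), -(a02 + a12 + a23), -(a03 + a13 + a23), 0]]

/-- The action of a permutation of the indices. -/
def KZ.reindex (S : KZ) (σ : Equiv.Perm (Fin 5)) : KZ where
  V := S.V
  A i j := S.A (σ i) (σ j)

/-- The endomorphism of `V³` given by a `3 × 3` block matrix. -/
def blockEnd {V : Type} [AddCommGroup V] [Module ℂ V]
    (M : Matrix (Fin 3) (Fin 3) (Module.End ℂ V)) : Module.End ℂ (Fin 3 → V) :=
  LinearMap.pi fun i => ∑ j, M i j ∘ₗ LinearMap.proj j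

open Classical in
/-- The endomorphism induced on `W ⧸ L` by `f`, where `f L ⊆ L`
(the value is `0` if `L` is not invariant). -/
def induced {W : Type} [AddCommGroup W] [Module ℂ W] (L : Submodule ℂ W)
    (f : Module.End ℂ W) : Module.End ℂ (W ⧸ L) :=
  if h : L ≤ L.comap f then L.mapQ L f h else 0

section Convolution

variable (S : KZ) (lam tau : ℂ)

/-- The matrices `Ã_{i,j}` on `V³` of the system satisfied by the vector
`(K_x^{μ+1,λ} (x u / (x - y)), K_x^{μ+1,λ} (x u / (x - 1)), K_x^{μ+1,λ} u)`, `μ = -τ-λ`,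
for the solutions `u` of the system `S`. -/
def KZ.convRes : Fin 5 → Fin 5 → Module.End ℂ (Fin 3 → S.V) :=
  let A := S.A
  let c : ℂ → Module.End ℂ S.V := fun z => z • 1
  residues
    (blockEnd !![A 0 1 - c (tau + lam), A 0 2, A 0 3 + c lam; 0, 0, 0; 0, 0, 0])
    (blockEnd !![0, 0, 0; A 0 1, A 0 2 - c (tau + lam), A 0 3 + c lam; 0, 0, 0])
    (blockEnd !![c tau, 0, 0; 0, c tau, 0; A 0 1, A 0 2, A 0 3])
    (blockEnd !![A 1 2 + A 0 2, -A 0 2, 0; -A 0 1, A 1 2 + A 0 1, 0; 0, 0, A 1 2])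
    (blockEnd !![A 1 3 + A 0 3 + c lam, 0, -A 0 3 - c lam; 0, A 1 3, 0;
      -A 0 1, 0, A 0 1 + A 1 3])
    (blockEnd !![A 2 3, 0, 0; 0, A 0 3 + A 2 3 + c lam, -A 0 3 - c lam;
      0, -A 0 2, A 0 2 + A 2 3])

/-- `𝓛 = (ker A₀₁, ker A₀₂, ker (A₀₃ + λ)) + ker (Ã₀₄ + τ)`. -/
def KZ.convKer : Submodule ℂ (Fin 3 → S.V) :=
  Submodule.pi Set.univ
    ![LinearMap.ker (S.A 0 1), LinearMap.ker (S.A 0 2), LinearMap.ker (S.A 0 3 + lam • 1)]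
  ⊔ LinearMap.ker (S.convRes lam tau 0 4 + tau • 1)

/-- The transformation of KZ-type equations corresponding to the integral transformation
`K_x^{1-τ-λ,λ}` with respect to `x = x₀`, with base point `x₃ = 0`: the matrices induced by
`Ã_{i,j}` on `V³ ⧸ 𝓛`. It equals
`Ad((x₀ - x₃)^τ) ∘ mc_{-τ-λ} ∘ Ad((x₀ - x₃)^λ)`. -/
def KZ.stepX : KZ where
  V := (Fin 3 → S.V) ⧸ S.convKer lam tau
  A i j := induced (S.convKer lam tau) (S.convRes lam tau i j)

/-- The permutation `(0 1)(2 3)` of the points `(x, y, 1, 0, ∞)`, which corresponds to the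
coordinate transformation `(x, y) ↦ (1 - y, 1 - x)`. -/
def swapXY : Equiv.Perm (Fin 5) := Equiv.swap 0 1 * Equiv.swap 2 3

/-- The same transformation with respect to the variable `1 - y`, with base point `y = 1`. -/
def KZ.stepY : KZ := ((S.reindex swapXY).stepX lam tau).reindex swapXY

end Convolution

/-- The homogeneous KZ-type equation of rank one satisfied by `(y - x)^(-γ)`. -/
def kzBase (γ : ℂ) : KZ where
  V := ℂ
  A := residues (-γ • 1) 0 0 0 0 (γ • 1)

/-- The KZ-type equation obtained from that of `(y - x)^(-γ)` by applying
`∏_{i<p} K_x^{1-α'_i-α_i,α_i} ∏_{j<q} K_{1-y}^{1-β'_j-β_j,β_j}`, where `p = m + 1`, `q = n + 1`.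
Indices start at `0`; the entries `α'_p` and `β'_q` (both equal to `0` in the theorem) are
not used. -/
def kzI {m n : ℕ} (α : Fin m → ℂ) (α' : Fin (m + 1) → ℂ) (β : Fin n → ℂ)
    (β' : Fin (n + 1) → ℂ) (γ : ℂ) : KZ :=
  (List.ofFn fun i : Fin m => (α i, α' i.castSucc)).foldr (fun c S => S.stepX c.1 c.2)
    ((List.ofFn fun j : Fin n => (β j, β' j.castSucc)).foldr (fun c S => S.stepY c.1 c.2)
      (kzBase γ))

/-- The coefficient of `x^k y^l` in `I_{p,q}(α, β, γ; α', β'; x, y)`: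
`(α)_k (β)_l (γ)_{k+l} / ((1 - α')_k (1 - β')_l)`. -/
def coeffI {m n : ℕ} (α : Fin m → ℂ) (α' : Fin (m + 1) → ℂ) (β : Fin n → ℂ)
    (β' : Fin (n + 1) → ℂ) (γ : ℂ) (k l : ℕ) : ℂ :=
  (∏ i, (ascPochhammer ℂ k).eval (α i)) * (∏ j, (ascPochhammer ℂ l).eval (β j))
      * (ascPochhammer ℂ (k + l)).eval γ
    / ((∏ i, (ascPochhammer ℂ k).eval (1 - α' i)) * ∏ j, (ascPochhammer ℂ l).eval (1 - β' j))

/-- `u` solves, on the points of `U` outside the singular locus, the equation `S` normalized by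
`(x₀, x₁, x₂, x₃, x₄) = (x, y, 1, 0, ∞)`:
`∂u/∂x = (A₀₁/(x-y) + A₀₂/(x-1) + A₀₃/x) u`, `∂u/∂y = (A₀₁/(y-x) + A₁₂/(y-1) + A₁₃/y) u`.
Both equations are read in coordinates, that is, after applying any linear functional. -/
def KZ.IsSolutionOn (S : KZ) (u : ℂ → ℂ → S.V) (U : Set (ℂ × ℂ)) : Prop :=
  ∀ x y : ℂ, (x, y) ∈ U → x ≠ y → x ≠ 0 → x ≠ 1 → y ≠ 0 → y ≠ 1 →
    ∀ ψ : Module.Dual ℂ S.V,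
      HasDerivAt (fun t => ψ (u t y))
        (ψ ((x - y)⁻¹ • S.A 0 1 (u x y) + (x - 1)⁻¹ • S.A 0 2 (u x y)
          + x⁻¹ • S.A 0 3 (u x y))) x ∧
      HasDerivAt (fun t => ψ (u x t))
        (ψ ((y - x)⁻¹ • S.A 0 1 (u x y) + (y - 1)⁻¹ • S.A 1 2 (u x y)
          + y⁻¹ • S.A 1 3 (u x y))) y

/-- Near `(x, y) = (0, 1)`, the function `∑ c k l x^k (1 - y)^l` is a component of a solution
of `S`. -/
def KZ.Realizes (S : KZ) (c : ℕ → ℕ → ℂ) : Prop :=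
  ∃ r : ℝ, 0 < r ∧ ∃ (u : ℂ → ℂ → S.V) (φ : Module.Dual ℂ S.V),
    S.IsSolutionOn u (Metric.ball 0 r ×ˢ Metric.ball 1 r) ∧
    ∀ x ∈ Metric.ball (0 : ℂ) r, ∀ y ∈ Metric.ball (1 : ℂ) r,
      HasSum (fun k : ℕ × ℕ => c k.1 k.2 * x ^ k.1 * (1 - y) ^ k.2) (φ (u x y))

/-- The entry `[a : b]_k` of a list of simultaneous eigenvalues. -/
def ev (a b : ℂ) (k : ℕ := 1) : Multiset (ℂ × ℂ) := Multiset.replicate k (a, b)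

/-- `[A : B] = M`: for all `a` and `b`, the dimension of the simultaneous eigenspace with
eigenvalue `a` of `A` and `b` of `B` is the multiplicity of `(a, b)` in `M`. -/
def SimEig {V : Type} [AddCommGroup V] [Module ℂ V] (A B : Module.End ℂ V)
    (M : Multiset (ℂ × ℂ)) : Prop :=
  ∀ a b : ℂ, Module.finrank ℂ ↥(A.eigenspace a ⊓ B.eigenspace b) = M.count (a, b)

/-- The partial sum `∑_{k ≤ i < p} (α_i + α'_i)` (indices from `0`, `p = m + 1`; the last entry
of `α'` does not enter). -/
def tailSum {m : ℕ} (α : Fin m → ℂ) (α' : Fin (m + 1) → ℂ) (k : ℕ) : ℂ :=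
  ∑ i : Fin m, if k ≤ (i : ℕ) then α i + α' i.castSucc else 0

/-- Generic parameters: the series `I_{p,q}` is defined, the kernels that enter the successive
middle convolutions have their generic dimensions, and the eigenvalues of the residue matrices
that are not identically equal do not collide. -/
structure Generic {m n : ℕ} (α : Fin m → ℂ) (α' : Fin (m + 1) → ℂ) (β : Fin n → ℂ)
    (β' : Fin (n + 1) → ℂ) (γ : ℂ) : Prop where
  series_α : ∀ i, ∀ k : ℕ, α' i ≠ k + 1
  series_β : ∀ j, ∀ k : ℕ, β' j ≠ k + 1
  add_α : ∀ i i', α i + α' i' ≠ 0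
  add_β : ∀ j j', β j + β' j' ≠ 0
  add_γ : ∀ i j, α' i + β' j + γ ≠ 0
  inj_α : Function.Injective α
  inj_α' : Function.Injective α'
  inj_β : Function.Injective β
  inj_β' : Function.Injective β'
  ne_α : ∀ i j, α i ≠ β' j + γ
  ne_β : ∀ i j, β j ≠ α' i + γ
  ne_γ : ∀ i j, α i + β j ≠ γ
  tail_α : ∀ k, tailSum α α' k + tailSum β β' 0 + γ ≠ 0
  tail_β : ∀ l, tailSum β β' l + γ ≠ 0
  tail_αβ : ∀ k j, β j ≠ tailSum α α' k + γ
  tail_αβ' : ∀ k j, β' j + tailSum α α' k + γ ≠ 0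
  sum_α : ∀ i, α i ≠ tailSum β β' 0 + γ
  sum_α' : ∀ i, α' i + tailSum β β' 0 + γ ≠ 0

end KZF2

end

/-! The proof rests on an explicit model of `kzI` on the functions f(i, j) on the p × q grid of
exponents x = α', y = β'. Let ε_i be the residues of ∏(s + α_r) / ∏(s - x_i) at the x_i, let η_j be
those of ∏(s + β_s) / ∏(s - y_j) at the y_j, let P and Q be the averages over i and j with these
weights, and let D be multiplication by x_i + y_j + γ. Then A_03 and A_12 are multiplication by x_i
and y_j, and A_01 = -PQD, A_02 = PQD - PD, A_13 = PQD - QD, A_23 = γ - (1 - P)(1 - Q)D (`gridRes`).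

The model is stable under T_x^{λ,τ}: a step adds the node τ and multiplies the rational function by
(s + λ)/(s - τ). The map `stepMap` sends triples of functions on the old grid onto functions on the
new one, intertwines the Ã_{i,j} with the new matrices and has kernel 𝓛, where generically ker(Ã_04
+ τ) = 0 (`Represents.stepX`). Exchanging the two variables preserves the model
(`Represents.reindex`), which takes care of T_{1-y}. Induction from rank one gives `represents_kzI`.

Spectra: partial fractions give ∑ ε_i/(x_i + α_r) = 0 and ∑ ε_i (x_i + c)/(x_i + α_r) = 1 for every
c. Hence products of delta functions, constants and reciprocals of linear forms such as x + α_r, y +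
β_s, x + y + γ are simultaneous eigenvectors; genericity makes them independent, and there are pq of
them. Nine pairs are computed, six follow by symmetry. The same bases show that the fifteen pairs
commute, which together with homogeneity yields all KZ laws (`KZ.isKZType_of_commute`).

Solution: with X = x, Z = 1 - y and Euler operators ϑ, the vector u_ij = ∏_{k≠i}(ϑ_X - x_k)
∏_{l≠j}(ϑ_Z - y_l) I solves the grid equation by the recurrences of the coefficients
(`hasDerivAt_gridSeries`). The Lagrange polynomials combine to the constant 1, so I is a linear form
in u. -/

noncomputable section

namespace KZF2

/-! ### Partial fractions: nodes, weights and interpolation -/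

/-- The product `∏_{k ≠ i} (s - x k)`. -/
def cofactor {m : ℕ} (x : Fin m → ℂ) (s : ℂ) (i : Fin m) : ℂ :=
  ∏ k, if k = i then 1 else s - x k

theorem sub_mul_cofactor {m : ℕ} (x : Fin m → ℂ) (s : ℂ) (i : Fin m) :
    (s - x i) * cofactor x s i = ∏ k, (s - x k) := by
  unfold cofactor
  rw [← Finset.mul_prod_erase _ _ (Finset.mem_univ i), ← Finset.mul_prod_erase _ (fun k => s - x k)
    (Finset.mem_univ i), if_pos rfl, one_mul]
  congr 1
  exact Finset.prod_congr rfl fun k hk => if_neg (Finset.ne_of_mem_erase hk)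

theorem cofactor_zero {m : ℕ} (x : Fin (m + 1) → ℂ) (s : ℂ) :
    cofactor x s 0 = ∏ k : Fin m, (s - x k.succ) := by
  simp [cofactor, Fin.prod_univ_succ]

theorem cofactor_succ {m : ℕ} (x : Fin (m + 1) → ℂ) (s : ℂ) (i : Fin m) :
    cofactor x s i.succ = (s - x 0) * cofactor (Fin.tail x) s i := by
  simp [cofactor, Fin.prod_univ_succ, Fin.tail, (Fin.succ_ne_zero _).symm]

/-- The residues `ε i` at `x i` of the rational function `∏ (s + α r) / ∏ (s - x i)`. -/
def weights : (m : ℕ) → (Fin m → ℂ) → (Fin (m + 1) → ℂ) → Fin (m + 1) → ℂ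
  | 0, _, _ => fun _ => 1
  | m + 1, α, x => Fin.cons
      ((x 0 + α 0) * ∑ k, weights m (Fin.tail α) (Fin.tail x) k / (x 0 - x k.succ))
      fun k => weights m (Fin.tail α) (Fin.tail x) k * (x k.succ + α 0) / (x k.succ - x 0)

/-- `ε` are the residues at the points `x` of the rational function `∏ (s + α r) / ∏ (s - x i)`,
whose expansion at infinity is `1 / s + a / s ^ 2 + ⋯`. -/
structure IsWeight {m : ℕ} (α : Fin m → ℂ) (x ε : Fin (m + 1) → ℂ) (a : ℂ) : Prop where
  sum : ∑ i, ε i = 1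
  sum_mul : ∑ i, ε i * x i = a
  interp : ∀ s, ∑ i, ε i * cofactor x s i = ∏ r, (s + α r)

/-- Each recursion step multiplies the rational function by (s + α_0)/(s - x_0): old residues are
scaled by the value of this factor at their node, and the new residue is (x_0 + α_0) times the old
function at x_0. All three identities then hold term by term in the old weights. -/
theorem isWeight_weights : ∀ {m : ℕ} (α : Fin m → ℂ) (x : Fin (m + 1) → ℂ),
    Function.Injective x → IsWeight α x (weights m α x) (∑ r, α r + ∑ i, x i)
  | 0, α, x, _ => ⟨by simp [weights], by simp [weights], by simp [weights, cofactor]⟩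
  | m + 1, α, x, hx => by
    have ht : Function.Injective (Fin.tail x) := fun i j h => Fin.succ_injective _ (hx h)
    have ih := isWeight_weights (Fin.tail α) (Fin.tail x) ht
    have hne : ∀ k : Fin (m + 1), x k.succ - x 0 ≠ 0 := fun k =>
      sub_ne_zero.mpr fun h => Fin.succ_ne_zero k (hx h)
    have hne' : ∀ k : Fin (m + 1), x 0 - x k.succ ≠ 0 := fun k =>
      sub_ne_zero.mpr fun h => Fin.succ_ne_zero k (hx h).symm
    set ε := weights m (Fin.tail α) (Fin.tail x) with hε
    have h0 : weights (m + 1) α x 0 = (x 0 + α 0) * ∑ k, ε k / (x 0 - x k.succ) := rfl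
    have hs : ∀ k : Fin (m + 1), weights (m + 1) α x k.succ
      = ε k * (x k.succ + α 0) / (x k.succ - x 0) := fun k => rfl
    refine ⟨?_, ?_, fun s => ?_⟩
    · rw [Fin.sum_univ_succ, h0, ← ih.sum, Finset.mul_sum, ← Finset.sum_add_distrib]
      refine Finset.sum_congr rfl fun k _ => ?_
      rw [hs]
      have := hne k; have := hne' k
      field_simp
      ring
    · have e : ∑ r, α r + ∑ i, x i = ∑ k, ε k * x k.succ + (x 0 + α 0) * ∑ k, ε k := by
        have := ih.sum_mul
        simp only [Fin.tail] at this
        rw [this, ih.sum, Fin.sum_univ_succ, Fin.sum_univ_succ x]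
        ring
      rw [Fin.sum_univ_succ, h0, e, Finset.mul_sum, Finset.mul_sum, Finset.sum_mul,
        ← Finset.sum_add_distrib, ← Finset.sum_add_distrib]
      refine Finset.sum_congr rfl fun k _ => ?_
      rw [hs]
      have := hne k; have := hne' k
      field_simp
      ring
    · have hi := ih.interp s
      rw [Fin.prod_univ_succ, show ∏ i : Fin m, (s + α i.succ) = _ from hi.symm,
        Fin.sum_univ_succ, h0, cofactor_zero, Finset.mul_sum, Finset.mul_sum, Finset.sum_mul,
        ← Finset.sum_add_distrib]
      refine Finset.sum_congr rfl fun k _ => ?_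
      rw [hs, cofactor_succ, show ∏ k : Fin (m + 1), (s - x k.succ) = _ from
        (sub_mul_cofactor (Fin.tail x) s k).symm, Fin.tail]
      have := hne k; have := hne' k
      field_simp
      ring

/-- Lagrange interpolation of the constant 1; the coefficients are the residues of 1/∏(s - x_i). It
later recovers the series I from the components of the vector solution. -/
theorem exists_sum_mul_cofactor : ∀ {m : ℕ} (x : Fin (m + 1) → ℂ), Function.Injective x →
    ∃ w : Fin (m + 1) → ℂ, ∀ s, ∑ i, w i * cofactor x s i = 1
  | 0, x, _ => ⟨fun _ => 1, by simp [cofactor]⟩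
  | m + 1, x, hx => by
    have ht : Function.Injective (Fin.tail x) := fun i j h => Fin.succ_injective _ (hx h)
    obtain ⟨w, hw⟩ := exists_sum_mul_cofactor (Fin.tail x) ht
    have hne : ∀ k : Fin (m + 1), x k.succ - x 0 ≠ 0 := fun k =>
      sub_ne_zero.mpr fun h => Fin.succ_ne_zero k (hx h)
    refine ⟨Fin.cons (-∑ k, w k / (x k.succ - x 0)) fun k => w k / (x k.succ - x 0),
      fun s => ?_⟩
    rw [Fin.sum_univ_succ, ← hw s, cofactor_zero]
    simp only [Fin.cons_zero, Fin.cons_succ]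
    rw [← Finset.sum_neg_distrib, Finset.sum_mul, ← Finset.sum_add_distrib]
    refine Finset.sum_congr rfl fun k _ => ?_
    rw [cofactor_succ, show ∏ k : Fin (m + 1), (s - x k.succ) = _ from
      (sub_mul_cofactor (Fin.tail x) s k).symm, Fin.tail]
    have := hne k
    field_simp
    ring

namespace IsWeight

variable {m : ℕ} {α : Fin m → ℂ} {x ε : Fin (m + 1) → ℂ} {a : ℂ}

/-- The partial fraction expansion at s = -c with the denominator cleared. It locates the zeros in c
of ∑ ε_i/(x_i + c): they are exactly the α_r. -/
theorem sum_div_mul (h : IsWeight α x ε a) (c : ℂ) (hc : ∀ i, x i + c ≠ 0) :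
    (∑ i, ε i / (x i + c)) * ∏ k, (-c - x k) = -∏ r, (α r - c) := by
  have := h.interp (-c)
  rw [show ∏ r, (α r - c) = ∏ r, (-c + α r) from
    Finset.prod_congr rfl fun _ _ => by ring, ← this, Finset.sum_mul, ← Finset.sum_neg_distrib]
  refine Finset.sum_congr rfl fun i _ => ?_
  rw [← sub_mul_cofactor x (-c) i]
  have := hc i
  field_simp
  ring

theorem sum_div_ne_zero (h : IsWeight α x ε a) (c : ℂ) (hc : ∀ i, x i + c ≠ 0)
    (hα : ∀ r, α r ≠ c) : ∑ i, ε i / (x i + c) ≠ 0 := by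
  intro h0
  have := h.sum_div_mul c hc
  rw [h0, zero_mul, eq_comm, neg_eq_zero, Finset.prod_eq_zero_iff] at this
  obtain ⟨r, _, hr⟩ := this
  exact hα r (sub_eq_zero.mp hr)

theorem sum_div_eq_zero (h : IsWeight α x ε a) (r : Fin m) (hc : ∀ i, x i + α r ≠ 0) :
    ∑ i, ε i / (x i + α r) = 0 := by
  have := h.sum_div_mul (α r) hc
  rw [Finset.prod_eq_zero (Finset.mem_univ r) (sub_self _), neg_zero] at this
  refine (mul_eq_zero.mp this).resolve_right (Finset.prod_ne_zero_iff.mpr fun i _ => ?_)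
  intro h0
  exact hc i (by linear_combination -h0)

end IsWeight

/-! ### Simultaneous eigenbases and joint spectra -/

section JointBasis

variable {V : Type} [AddCommGroup V] [Module ℂ V]

/-- `A` and `B` are simultaneously diagonalizable, with joint spectrum `M`. -/
def HasJointBasis (A B : Module.End ℂ V) (M : Multiset (ℂ × ℂ)) : Prop :=
  ∃ (ι : Type) (_ : Fintype ι) (b : Module.Basis ι ℂ V) (l μ : ι → ℂ),
    (∀ i, A (b i) = l i • b i) ∧ (∀ i, B (b i) = μ i • b i) ∧ ∑ i, ev (l i) (μ i) = M

theorem repr_apply_of_eigenbasis {ι : Type} (b : Module.Basis ι ℂ V) {A : Module.End ℂ V}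
    {l : ι → ℂ} (hA : ∀ i, A (b i) = l i • b i) (v : V) (i : ι) :
    b.repr (A v) i = l i * b.repr v i := by
  have : (b.coord i) ∘ₗ A = l i • b.coord i := by
    classical
    refine b.ext fun k => ?_
    simp only [LinearMap.comp_apply, hA, map_smul, LinearMap.smul_apply, Module.Basis.coord_apply,
      Module.Basis.repr_self, smul_eq_mul, Finsupp.single_apply]
    split_ifs with h
    · rw [h]
    · simp
  exact LinearMap.congr_fun this v

theorem mem_eigenspace_iff_of_eigenbasis {ι : Type} (b : Module.Basis ι ℂ V)
    {A : Module.End ℂ V} {l : ι → ℂ} (hA : ∀ i, A (b i) = l i • b i) (c : ℂ) (v : V) :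
    v ∈ A.eigenspace c ↔ ∀ i, b.repr v i ≠ 0 → l i = c := by
  rw [Module.End.mem_eigenspace_iff, ← b.repr.injective.eq_iff, Finsupp.ext_iff]
  refine forall_congr' fun i => ?_
  rw [repr_apply_of_eigenbasis b hA, map_smul, Finsupp.smul_apply, smul_eq_mul,
    mul_eq_mul_right_iff]
  tauto

theorem HasJointBasis.simEig {A B : Module.End ℂ V} {M : Multiset (ℂ × ℂ)}
    (h : HasJointBasis A B M) : SimEig A B M := by
  classical
  obtain ⟨ι, _, b, l, μ, hA, hB, rfl⟩ := h
  intro c c'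
  have key : A.eigenspace c ⊓ B.eigenspace c'
      = Submodule.span ℂ (Set.range fun i : {i // l i = c ∧ μ i = c'} => b i) := by
    ext v
    rw [Submodule.mem_inf, mem_eigenspace_iff_of_eigenbasis b hA,
      mem_eigenspace_iff_of_eigenbasis b hB]
    have : (Set.range fun i : {i // l i = c ∧ μ i = c'} => b i)
        = b '' {i | l i = c ∧ μ i = c'} := by
      ext w; simp
    rw [this, Module.Basis.mem_span_image]
    simp only [Set.subset_def, Finset.mem_coe, Finsupp.mem_support_iff, Set.mem_ofPred_eq]
    exact ⟨fun h i hi => ⟨h.1 i hi, h.2 i hi⟩, fun h => ⟨fun i hi => (h i hi).1, fun i hi =>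
      (h i hi).2⟩⟩
  rw [key, finrank_span_eq_card (b := fun i : {i // l i = c ∧ μ i = c'} => b i)
    (b.linearIndependent.comp _ Subtype.val_injective), Multiset.count_sum', Fintype.card_subtype, Finset.card_filter]
  refine Finset.sum_congr rfl fun i _ => ?_
  simp [ev, Multiset.count_singleton, eq_comm]

/-- The bases that give the spectra thus also supply the commutation relations needed for
`KZ.IsKZType`. -/
theorem HasJointBasis.commute {A B : Module.End ℂ V} {M : Multiset (ℂ × ℂ)}
    (h : HasJointBasis A B M) : Commute A B := by
  obtain ⟨ι, _, b, l, μ, hA, hB, rfl⟩ := h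
  refine b.ext fun i => ?_
  simp only [Module.End.mul_apply, hA, hB, map_smul]
  exact smul_comm _ _ _

theorem HasJointBasis.swap {A B : Module.End ℂ V} {M : Multiset (ℂ × ℂ)}
    (h : HasJointBasis A B M) : HasJointBasis B A (M.map Prod.swap) := by
  obtain ⟨ι, _, b, l, μ, hA, hB, rfl⟩ := h
  refine ⟨ι, inferInstance, b, μ, l, hB, hA, ?_⟩
  rw [← Multiset.coe_mapAddMonoidHom, map_sum]
  simp [ev]

end JointBasis

/-! ### The model of the residue matrices on functions on a grid -/

section Grid

variable {ι κ : Type} [Fintype ι] [Fintype κ]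

/-- The weighted average over the first index. -/
def avgL (ε : ι → ℂ) : Module.End ℂ (ι → κ → ℂ) where
  toFun f _ j := ∑ k, ε k * f k j
  map_add' f g := by ext; simp [mul_add, Finset.sum_add_distrib]
  map_smul' c f := by ext; simp [Finset.mul_sum, mul_left_comm]

/-- The weighted average over the second index. -/
def avgR (η : κ → ℂ) : Module.End ℂ (ι → κ → ℂ) where
  toFun f i _ := ∑ k, η k * f i k
  map_add' f g := by ext; simp [mul_add, Finset.sum_add_distrib]
  map_smul' c f := by ext; simp [Finset.mul_sum, mul_left_comm]

/-- Multiplication by a function on the grid. -/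
def mulFun (d : ι → κ → ℂ) : Module.End ℂ (ι → κ → ℂ) where
  toFun f i j := d i j * f i j
  map_add' f g := by ext; simp [mul_add]
  map_smul' c f := by ext; simp [mul_left_comm]

variable (x ε : ι → ℂ) (y η : κ → ℂ) (γ : ℂ)

/-- The function `x i + y j + γ` on the grid. -/
def gridSum (i : ι) (j : κ) : ℂ := x i + y j + γ

/-- `∑ ε i (x i + y j + γ) f i j` over `i`. -/
def colSum (f : ι → κ → ℂ) (j : κ) : ℂ := ∑ i, ε i * ((x i + y j + γ) * f i j)

/-- `∑ η j (x i + y j + γ) f i j` over `j`. -/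
def rowSum (f : ι → κ → ℂ) (i : ι) : ℂ := ∑ j, η j * ((x i + y j + γ) * f i j)

/-- `∑ ε i η j (x i + y j + γ) f i j` over `i` and `j`. -/
def totSum (f : ι → κ → ℂ) : ℂ := ∑ i, ε i * rowSum x y η γ f i

theorem totSum_eq (f : ι → κ → ℂ) :
    totSum x ε y η γ f = ∑ j, η j * colSum x ε y γ f j := by
  simp only [totSum, rowSum, colSum, Finset.mul_sum]
  rw [Finset.sum_comm]
  exact Finset.sum_congr rfl fun _ _ => Finset.sum_congr rfl fun _ _ => by ring

theorem totSum_swap (f : ι → κ → ℂ) :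
    totSum y η x ε γ (Function.swap f) = totSum x ε y η γ f := by
  rw [totSum_eq x ε y η γ f]
  simp only [totSum, rowSum, colSum, add_comm (y _) (x _), Function.swap]

/-- The residue matrices of the equation `kzI` in suitable coordinates. -/
def gridRes : Fin 5 → Fin 5 → Module.End ℂ (ι → κ → ℂ) :=
  let D := mulFun (gridSum x y γ)
  residues (-(avgL ε * avgR η * D)) (avgL ε * avgR η * D - avgL ε * D) (mulFun fun i _ => x i)
    (mulFun fun _ j => y j) (avgL ε * avgR η * D - avgR η * D)
    (γ • 1 - D + avgL ε * D + avgR η * D - avgL ε * avgR η * D)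

variable (f : ι → κ → ℂ) (i : ι) (j : κ)

theorem gridRes_01 : gridRes x ε y η γ 0 1 f i j = -totSum x ε y η γ f := rfl
theorem gridRes_02 : gridRes x ε y η γ 0 2 f i j
  = totSum x ε y η γ f - colSum x ε y γ f j := rfl
theorem gridRes_03 : gridRes x ε y η γ 0 3 f i j = x i * f i j := rfl
theorem gridRes_12 : gridRes x ε y η γ 1 2 f i j = y j * f i j := rfl
theorem gridRes_13 : gridRes x ε y η γ 1 3 f i j
  = totSum x ε y η γ f - rowSum x y η γ f i := rfl
theorem gridRes_23 : gridRes x ε y η γ 2 3 f i j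
  = γ * f i j - (x i + y j + γ) * f i j + colSum x ε y γ f j + rowSum x y η γ f i
    - totSum x ε y η γ f := rfl
theorem gridRes_04 : gridRes x ε y η γ 0 4 f i j = colSum x ε y γ f j - x i * f i j := by
  trans -(-totSum x ε y η γ f + (totSum x ε y η γ f - colSum x ε y γ f j) + x i * f i j)
  · rfl
  · ring
theorem gridRes_14 : gridRes x ε y η γ 1 4 f i j = rowSum x y η γ f i - y j * f i j := by
  trans -(-totSum x ε y η γ f + y j * f i j + (totSum x ε y η γ f - rowSum x y η γ f i))
  · rfl
  · ring
theorem gridRes_24 : gridRes x ε y η γ 2 4 f i j = x i * f i j - rowSum x y η γ f i := by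
  trans -((totSum x ε y η γ f - colSum x ε y γ f j) + y j * f i j
    + (γ * f i j - (x i + y j + γ) * f i j + colSum x ε y γ f j + rowSum x y η γ f i
    - totSum x ε y η γ f))
  · rfl
  · ring
theorem gridRes_34 : gridRes x ε y η γ 3 4 f i j = y j * f i j - colSum x ε y γ f j := by
  trans -(x i * f i j + (totSum x ε y η γ f - rowSum x y η γ f i)
    + (γ * f i j - (x i + y j + γ) * f i j + colSum x ε y γ f j + rowSum x y η γ f i
    - totSum x ε y η γ f))
  · rfl
  · ring

end Grid

/-! ### Identifying an equation with the grid model; exchange of the two variables -/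

section Residues

variable {V : Type} [AddCommGroup V] [Module ℂ V]

theorem residues_symm (a01 a02 a03 a12 a13 a23 : Module.End ℂ V) (i j : Fin 5) :
    residues a01 a02 a03 a12 a13 a23 i j = residues a01 a02 a03 a12 a13 a23 j i := by
  fin_cases i <;> fin_cases j <;> rfl

/-- A map that intertwines the six residue matrices with indices `≤ 3` intertwines all. -/
theorem residues_intertwine {W : Type} [AddCommGroup W] [Module ℂ W] (φ : V →ₗ[ℂ] W)
    {a01 a02 a03 a12 a13 a23 : Module.End ℂ V} {b01 b02 b03 b12 b13 b23 : Module.End ℂ W}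
    (h01 : ∀ v, φ (a01 v) = b01 (φ v)) (h02 : ∀ v, φ (a02 v) = b02 (φ v))
    (h03 : ∀ v, φ (a03 v) = b03 (φ v)) (h12 : ∀ v, φ (a12 v) = b12 (φ v))
    (h13 : ∀ v, φ (a13 v) = b13 (φ v)) (h23 : ∀ v, φ (a23 v) = b23 (φ v)) (i j : Fin 5) (v : V) :
    φ (residues a01 a02 a03 a12 a13 a23 i j v)
      = residues b01 b02 b03 b12 b13 b23 i j (φ v) := by
  fin_cases i <;> fin_cases j <;>
    simp [residues, h01, h02, h03, h12, h13, h23]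

end Residues

/-- In suitable coordinates the residue matrices of `S` are `gridRes x ε y η γ`. -/
def Represents {ι κ : Type} [Fintype ι] [Fintype κ] (S : KZ) (x ε : ι → ℂ) (y η : κ → ℂ)
    (γ : ℂ) : Prop :=
  ∃ e : S.V ≃ₗ[ℂ] (ι → κ → ℂ), ∀ i j v, e (S.A i j v) = gridRes x ε y η γ i j (e v)

/-- Exchanging the two indices of a function on the grid. -/
def swapGrid (ι κ : Type) : (ι → κ → ℂ) ≃ₗ[ℂ] (κ → ι → ℂ) where
  toFun := Function.swap
  invFun := Function.swap
  map_add' _ _ := rfl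
  map_smul' _ _ := rfl
  left_inv _ := rfl
  right_inv _ := rfl

/-- The permutation fixes A_01 and A_23 and exchanges A_02 with A_13, A_03 with A_12, A_04 with A_14
and A_24 with A_34. Transposing the grid does the same, since it exchanges row sums with column
sums. -/
theorem Represents.reindex {ι κ : Type} [Fintype ι] [Fintype κ] {S : KZ} {x ε : ι → ℂ}
    {y η : κ → ℂ} {γ : ℂ} (h : Represents S x ε y η γ) :
    Represents (S.reindex swapXY) y η x ε γ := by
  obtain ⟨e, he⟩ := h
  refine ⟨e.trans (swapGrid ι κ), fun i j (v : S.V) => ?_⟩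
  change Function.swap (e (S.A (swapXY i) (swapXY j) v))
    = gridRes y η x ε γ i j (Function.swap (e v))
  rw [he]
  generalize e v = f
  have hs : ∀ i, swapXY i = ![1, 0, 3, 2, 4] i := by decide
  rw [hs, hs]
  have ht := totSum_swap x ε y η γ f
  have hr : ∀ k, rowSum y x ε γ (Function.swap f) k = colSum x ε y γ f k := fun k => by
    simp only [rowSum, colSum, add_comm (y _) (x _), Function.swap]
  have hc : ∀ k, colSum y η x γ (Function.swap f) k = rowSum x y η γ f k := fun k => by
    simp only [rowSum, colSum, add_comm (y _) (x _), Function.swap]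
  have sy : ∀ i j, gridRes x ε y η γ i j = gridRes x ε y η γ j i := residues_symm _ _ _ _ _ _
  have sy' : ∀ i j, gridRes y η x ε γ i j = gridRes y η x ε γ j i := residues_symm _ _ _ _ _ _
  have main : ∀ i j : Fin 5, i < j → Function.swap (gridRes x ε y η γ (![1, 0, 3, 2, 4] i)
      (![1, 0, 3, 2, 4] j) f) = gridRes y η x ε γ i j (Function.swap f) := by
    intro i j hij
    ext k l
    fin_cases i <;> fin_cases j <;> first | (exact absurd hij (by decide)) | skip
    · change gridRes x ε y η γ 1 0 f l k = gridRes y η x ε γ 0 1 _ k l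
      rw [sy, gridRes_01, gridRes_01, ht]
    · change gridRes x ε y η γ 1 3 f l k = gridRes y η x ε γ 0 2 _ k l
      rw [gridRes_02, gridRes_13, ht, hc]
    · change gridRes x ε y η γ 1 2 f l k = gridRes y η x ε γ 0 3 _ k l
      rfl
    · change gridRes x ε y η γ 1 4 f l k = gridRes y η x ε γ 0 4 _ k l
      rw [gridRes_14, gridRes_04, hc]
    · change gridRes x ε y η γ 0 3 f l k = gridRes y η x ε γ 1 2 _ k l
      rfl
    · change gridRes x ε y η γ 0 2 f l k = gridRes y η x ε γ 1 3 _ k l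
      rw [gridRes_02, gridRes_13, ht, hr]
    · change gridRes x ε y η γ 0 4 f l k = gridRes y η x ε γ 1 4 _ k l
      rw [gridRes_14, gridRes_04, hr]
    · change gridRes x ε y η γ 3 2 f l k = gridRes y η x ε γ 2 3 _ k l
      rw [sy, gridRes_23, gridRes_23, hr, hc, ht]
      simp only [Function.swap]
      ring
    · change gridRes x ε y η γ 3 4 f l k = gridRes y η x ε γ 2 4 _ k l
      rw [gridRes_34, gridRes_24, hr]
    · change gridRes x ε y η γ 2 4 f l k = gridRes y η x ε γ 3 4 _ k l
      rw [gridRes_34, gridRes_24, hc]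
  rcases lt_trichotomy i j with hij | rfl | hij
  · exact main i j hij
  · fin_cases i <;> rfl
  · rw [sy, sy']
    exact main j i hij

theorem reindex_swapXY_swapXY (S : KZ) : (S.reindex swapXY).reindex swapXY = S := by
  have : ∀ i, swapXY (swapXY i) = i := by decide
  cases S
  simp only [KZ.reindex, this]
  rfl

/-! ### Linear independence of functions on the nodes and on the grid -/

namespace IsWeight

variable {m : ℕ} {α : Fin m → ℂ} {x ε : Fin (m + 1) → ℂ} {a : ℂ}

theorem sum_mul_add (h : IsWeight α x ε a) (c : ℂ) : ∑ i, ε i * (x i + c) = a + c := by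
  simp_rw [mul_add, Finset.sum_add_distrib, ← Finset.sum_mul, h.sum, h.sum_mul, one_mul]

theorem sum_inv (h : IsWeight α x ε a) (hp : ∀ i r, x i + α r ≠ 0) (r : Fin m) :
    ∑ i, ε i * (x i + α r)⁻¹ = 0 := by
  simpa only [div_eq_mul_inv] using h.sum_div_eq_zero r fun i => hp i r

/-- Since (x + c)/(x + α_r) = 1 + (c - α_r)/(x + α_r) and the last term averages to zero, the value
does not depend on c. -/
theorem sum_add_mul_inv (h : IsWeight α x ε a) (hp : ∀ i r, x i + α r ≠ 0) (c : ℂ)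
    (r : Fin m) : ∑ i, ε i * ((x i + c) * (x i + α r)⁻¹) = 1 := by
  have : ∀ i, ε i * ((x i + c) * (x i + α r)⁻¹) = ε i + (c - α r) * (ε i * (x i + α r)⁻¹) :=
    fun i => by
      have := hp i r
      field_simp
      ring
  simp_rw [this, Finset.sum_add_distrib, ← Finset.mul_sum, h.sum, h.sum_inv hp, mul_zero,
    add_zero]

theorem linearIndependent_inv (h : IsWeight α x ε a) (hp : ∀ i r, x i + α r ≠ 0)
    (hα : Function.Injective α) :
    LinearIndependent ℂ fun (r : Fin m) (i : Fin (m + 1)) => (x i + α r)⁻¹ := by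
  -- The functions 1/(x + α_r) are eigenvectors of f ↦ x f - ∑ ε x f with the distinct eigenvalues
  -- -α_r, because ∑ ε_i x_i/(x_i + α_r) = 1.
  let T : Module.End ℂ (Fin (m + 1) → ℂ) :=
    { toFun := fun f i => x i * f i - ∑ k, ε k * (x k * f k)
      map_add' := fun f g => by
        ext i
        simp only [Pi.add_apply, mul_add, Finset.sum_add_distrib]
        ring
      map_smul' := fun c f => by
        ext i
        simp only [Pi.smul_apply, smul_eq_mul, RingHom.id_apply, mul_left_comm _ c,
          ← Finset.mul_sum]
        ring }
  refine Module.End.eigenvectors_linearIndependent' T (fun r => -α r)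
    (fun r s hrs => hα (neg_injective hrs)) _ fun r => ⟨?_, fun h0 => ?_⟩
  · rw [Module.End.mem_eigenspace_iff]
    ext i
    have e := h.sum_add_mul_inv hp 0 r
    simp only [add_zero] at e
    change x i * (x i + α r)⁻¹ - ∑ k, ε k * (x k * (x k + α r)⁻¹) = -α r * (x i + α r)⁻¹
    rw [e]
    have := hp i r
    field_simp
    ring
  · exact inv_ne_zero (hp 0 r) (congrFun h0 0)

/-- The linear form f ↦ ∑ ε_i c_i f_i kills every 1/((x + α_r) c) but not g, so g lies outside their
span. -/
theorem linearIndependent_cons (h : IsWeight α x ε a) (hp : ∀ i r, x i + α r ≠ 0)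
    (hα : Function.Injective α) (c : Fin (m + 1) → ℂ) (g : Fin (m + 1) → ℂ)
    (hc : ∀ i, c i ≠ 0) (hg : ∑ i, ε i * (c i * g i) ≠ 0) :
    LinearIndependent ℂ (Fin.cons g fun (r : Fin m) (i : Fin (m + 1)) =>
      (x i + α r)⁻¹ * (c i)⁻¹ : Fin (m + 1) → Fin (m + 1) → ℂ) := by
  rw [linearIndependent_finCons]
  constructor
  · let T : Module.End ℂ (Fin (m + 1) → ℂ) :=
      LinearMap.pi fun i => c i • LinearMap.proj i
    have e : (fun (r : Fin m) (i : Fin (m + 1)) => (x i + α r)⁻¹)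
        = T ∘ fun r i => (x i + α r)⁻¹ * (c i)⁻¹ := by
      ext r i
      change _ = c i * ((x i + α r)⁻¹ * (c i)⁻¹)
      rw [mul_left_comm, mul_inv_cancel₀ (hc i), mul_one]
    have := h.linearIndependent_inv hp hα
    rw [e] at this
    exact this.of_comp T
  · intro hm
    let T : (Fin (m + 1) → ℂ) →ₗ[ℂ] ℂ := ∑ i, (ε i * c i) • LinearMap.proj i
    have hT : ∀ f, T f = ∑ i, ε i * (c i * f i) := fun f => by
      simp [T, LinearMap.sum_apply, mul_assoc]
    have : Submodule.span ℂ (Set.range fun (r : Fin m) (i : Fin (m + 1)) =>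
        (x i + α r)⁻¹ * (c i)⁻¹) ≤ LinearMap.ker T := by
      rw [Submodule.span_le]
      rintro _ ⟨r, rfl⟩
      rw [SetLike.mem_coe, LinearMap.mem_ker, hT, ← h.sum_inv hp r]
      refine Finset.sum_congr rfl fun i _ => ?_
      rw [mul_left_comm (c i), mul_inv_cancel₀ (hc i), mul_one]
    exact hg ((hT g).symm.trans (LinearMap.mem_ker.mp (this hm)))

/-- The functions `1` and `1 / ((x + α r) (x + c))`. -/
theorem linearIndependent_one (h : IsWeight α x ε a) (hp : ∀ i r, x i + α r ≠ 0)
    (hα : Function.Injective α) (c : ℂ) (hc : ∀ i, x i + c ≠ 0) (hac : a + c ≠ 0) :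
    LinearIndependent ℂ (Fin.cons (fun _ => 1) fun (r : Fin m) (i : Fin (m + 1)) =>
      (x i + α r)⁻¹ * (x i + c)⁻¹ : Fin (m + 1) → Fin (m + 1) → ℂ) :=
  h.linearIndependent_cons hp hα _ _ hc (by simpa only [mul_one, h.sum_mul_add] using hac)

/-- The functions `1 / (x + c)` and `1 / (x + α r)`. -/
theorem linearIndependent_inv_cons (h : IsWeight α x ε a) (hp : ∀ i r, x i + α r ≠ 0)
    (hα : Function.Injective α) (c : ℂ) (hc : ∀ i, x i + c ≠ 0) (hαc : ∀ r, α r ≠ c) :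
    LinearIndependent ℂ (Fin.cons (fun i => (x i + c)⁻¹) fun (r : Fin m) (i : Fin (m + 1)) =>
      (x i + α r)⁻¹ : Fin (m + 1) → Fin (m + 1) → ℂ) := by
  have := h.linearIndependent_cons hp hα (fun _ => 1) (fun i => (x i + c)⁻¹)
    (fun _ => one_ne_zero) (by
      simpa only [one_mul, div_eq_mul_inv] using h.sum_div_ne_zero c hc hαc)
  simpa only [inv_one, mul_one] using this

/-- The functions `1` and `1 / (x + α r)`. -/
theorem linearIndependent_one_inv (h : IsWeight α x ε a) (hp : ∀ i r, x i + α r ≠ 0)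
    (hα : Function.Injective α) :
    LinearIndependent ℂ (Fin.cons (fun _ => 1) fun (r : Fin m) (i : Fin (m + 1)) =>
      (x i + α r)⁻¹ : Fin (m + 1) → Fin (m + 1) → ℂ) := by
  have := h.linearIndependent_cons hp hα (fun _ => 1) (fun _ => 1)
    (fun _ => one_ne_zero) (by
      simp only [mul_one, h.sum]
      exact one_ne_zero)
  simpa only [inv_one, mul_one] using this

end IsWeight

theorem linearIndependent_single (ι : Type) [Fintype ι] [DecidableEq ι] :
    LinearIndependent ℂ (fun l : ι => (Pi.single l 1 : ι → ℂ)) :=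
  Pi.linearIndependent_single_one ι ℂ

/-- A family of functions on the grid, built from families of functions of one variable. -/
theorem linearIndependent_grid {ι κ ι' κ' : Type} [Fintype ι'] [Fintype κ']
    {w : κ' → ι' → ι → ℂ} {u : ι → κ' → κ → ℂ} (hw : ∀ k, LinearIndependent ℂ (w k))
    (hu : ∀ i, LinearIndependent ℂ (u i)) :
    LinearIndependent ℂ fun (p : ι' × κ') (i : ι) (j : κ) => w p.2 p.1 i * u i p.2 j := by
  rw [Fintype.linearIndependent_iff]
  intro g hg p
  have h1 : ∀ i k, ∑ l, g (l, k) * w k l i = 0 := fun i k =>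
    Fintype.linearIndependent_iff.mp (hu i) (fun k => ∑ l, g (l, k) * w k l i) (by
      ext j
      have := congrFun (congrFun hg i) j
      simp only [Finset.sum_apply, Pi.smul_apply, smul_eq_mul, Pi.zero_apply,
        Fintype.sum_prod_type] at this ⊢
      rw [← this, Finset.sum_comm]
      refine Finset.sum_congr rfl fun k _ => ?_
      rw [Finset.sum_mul]
      exact Finset.sum_congr rfl fun l _ => by ring) k
  refine Fintype.linearIndependent_iff.mp (hw p.2) (fun l => g (l, p.2)) ?_ p.1
  ext i
  simpa using h1 i p.2

/-- Independence of a family `F`, read off from triangularity with respect to a family `b`. -/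
theorem linearIndependent_of_triangular {V ι : Type} [AddCommGroup V] [Module ℂ V] [Fintype ι]
    {b F : ι → V} (hb : LinearIndependent ℂ b) (R D : Module.End ℂ V) (μ : ι → ℂ)
    (hR : ∀ k, R (F k) = μ k • b k) (hD : ∀ k, μ k ≠ 0 ∨ D (F k) = b k) :
    LinearIndependent ℂ F := by
  rw [Fintype.linearIndependent_iff] at hb ⊢
  intro g hg
  -- Applying `R` to the relation removes the coefficients with μ k ≠ 0; on the surviving terms `D`
  -- gives back the independent family `b`.
  have h1 : ∀ k, g k * μ k = 0 := hb _ (by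
    have := congrArg R hg
    simpa only [map_sum, map_smul, hR, smul_smul, map_zero] using this)
  refine hb g ?_
  have := congrArg D hg
  rw [map_zero, map_sum] at this
  rw [← this]
  refine Finset.sum_congr rfl fun k _ => ?_
  rw [map_smul]
  rcases hD k with h | h
  · rw [(mul_eq_zero.mp (h1 k)).resolve_right h, zero_smul, zero_smul]
  · rw [h]

/-! ### Explicit eigenbases of the fifteen pairs -/

/-- Genericity of the parameters of `gridRes`. -/
structure GridGeneric {m n : ℕ} (α : Fin m → ℂ) (x ε : Fin (m + 1) → ℂ) (a : ℂ)
    (β : Fin n → ℂ) (y η : Fin (n + 1) → ℂ) (b γ : ℂ) : Prop where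
  wx : IsWeight α x ε a
  wy : IsWeight β y η b
  px : ∀ i r, x i + α r ≠ 0
  py : ∀ j s, y j + β s ≠ 0
  inj_α : Function.Injective α
  inj_β : Function.Injective β
  add_γ : ∀ i j, x i + y j + γ ≠ 0
  ne_α : ∀ r j, α r ≠ y j + γ
  ne_β : ∀ s i, β s ≠ x i + γ
  ne_γ : ∀ r s, α r + β s ≠ γ
  tot : a + b + γ ≠ 0
  sum_α : ∀ r, α r ≠ b + γ
  sum_β : ∀ s, β s ≠ a + γ
  sum_x : ∀ i, x i + b + γ ≠ 0
  sum_y : ∀ j, y j + a + γ ≠ 0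

theorem GridGeneric.swap {m n : ℕ} {α : Fin m → ℂ} {x ε : Fin (m + 1) → ℂ} {a : ℂ}
    {β : Fin n → ℂ} {y η : Fin (n + 1) → ℂ} {b γ : ℂ} (h : GridGeneric α x ε a β y η b γ) :
    GridGeneric β y η b α x ε a γ where
  wx := h.wy
  wy := h.wx
  px := h.py
  py := h.px
  inj_α := h.inj_β
  inj_β := h.inj_α
  add_γ i j := by rw [add_comm (y i)]; exact h.add_γ j i
  ne_α := h.ne_β
  ne_β := h.ne_α
  ne_γ r s := by rw [add_comm]; exact h.ne_γ s r
  tot := by rw [add_comm b]; exact h.tot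
  sum_α := h.sum_β
  sum_β := h.sum_α
  sum_x := h.sum_y
  sum_y := h.sum_x

theorem Represents.hasJointBasis {m n : ℕ} {S : KZ} {x ε : Fin (m + 1) → ℂ}
    {y η : Fin (n + 1) → ℂ} {γ : ℂ} (h : Represents S x ε y η γ)
    {F : Fin (m + 1) × Fin (n + 1) → Fin (m + 1) → Fin (n + 1) → ℂ}
    (hF : LinearIndependent ℂ F) {i j i' j' : Fin 5} (l μ : Fin (n + 1) → Fin (m + 1) → ℂ)
    (hl : ∀ k p s t, gridRes x ε y η γ i j (F (p, k)) s t = l k p * F (p, k) s t)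
    (hμ : ∀ k p s t, gridRes x ε y η γ i' j' (F (p, k)) s t = μ k p * F (p, k) s t) :
    HasJointBasis (S.A i j) (S.A i' j') (∑ k, ∑ p, ev (l k p) (μ k p)) := by
  obtain ⟨e, he⟩ := h
  let B := basisOfLinearIndependentOfCardEqFinrank hF (by
    simp [Module.finrank_pi_fintype])
  have hB : ∀ p, e ((B.map e.symm) p) = F p := fun p => by simp [B]
  refine ⟨_, inferInstance, B.map e.symm, fun p => l p.2 p.1, fun p => μ p.2 p.1,
    fun p => e.injective ?_, fun p => e.injective ?_, ?_⟩
  · rw [he, map_smul, hB]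
    ext s t
    exact hl p.2 p.1 s t
  · rw [he, map_smul, hB]
    ext s t
    exact hμ p.2 p.1 s t
  · rw [Fintype.sum_prod_type, Finset.sum_comm]

section Sums

variable {m n : ℕ} {x ε : Fin (m + 1) → ℂ} {β : Fin n → ℂ} {y η : Fin (n + 1) → ℂ} {b γ : ℂ}

/-- Four shapes in y occur in the eigenfunctions: 1/(y + x_i + γ), 1/(y + β_s), the constant 1, and
the product of the first two. For a function w(i) times such a shape, the row sums are respectively
w, w, (x + b + γ) w and 0. This is why A_14 is diagonal on the first two shapes and A_24 on the last
two. -/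
theorem rowSum_inv (hy : IsWeight β y η b) (hd : ∀ i j, x i + y j + γ ≠ 0)
    (w : Fin (m + 1) → ℂ) (i : Fin (m + 1)) :
    rowSum x y η γ (fun i j => w i * (y j + (x i + γ))⁻¹) i = w i := by
  unfold rowSum
  rw [show w i = ∑ j, η j * w i by rw [← Finset.sum_mul, hy.sum, one_mul]]
  refine Finset.sum_congr rfl fun j _ => ?_
  have : y j + (x i + γ) ≠ 0 := fun h0 => hd i j (by linear_combination h0)
  field_simp
  ring

theorem colSum_inv (hd : ∀ i j, x i + y j + γ ≠ 0) (w : Fin (m + 1) → ℂ) (j : Fin (n + 1)) :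
    colSum x ε y γ (fun i j => w i * (y j + (x i + γ))⁻¹) j = ∑ i, ε i * w i := by
  unfold colSum
  refine Finset.sum_congr rfl fun i _ => ?_
  have : y j + (x i + γ) ≠ 0 := fun h0 => hd i j (by linear_combination h0)
  field_simp
  ring

theorem rowSum_mul_inv (hy : IsWeight β y η b) (hp : ∀ j s, y j + β s ≠ 0)
    (w : Fin (m + 1) → ℂ) (s : Fin n) (i : Fin (m + 1)) :
    rowSum x y η γ (fun i j => w i * (y j + β s)⁻¹) i = w i := by
  unfold rowSum
  rw [← mul_one (w i), ← hy.sum_add_mul_inv hp (x i + γ) s, Finset.mul_sum]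
  exact Finset.sum_congr rfl fun j _ => by ring

theorem colSum_mul_inv (hp : ∀ j s, y j + β s ≠ 0)
    (w : Fin (m + 1) → ℂ) (s : Fin n) (j : Fin (n + 1)) :
    colSum x ε y γ (fun i j => w i * (y j + β s)⁻¹) j
      = ∑ i, ε i * w i + (∑ i, ε i * ((x i + (γ - β s)) * w i)) * (y j + β s)⁻¹ := by
  unfold colSum
  rw [Finset.sum_mul, ← Finset.sum_add_distrib]
  refine Finset.sum_congr rfl fun i _ => ?_
  have := hp j s
  field_simp
  ring

theorem rowSum_const (hy : IsWeight β y η b) (w : Fin (m + 1) → ℂ) (i : Fin (m + 1)) :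
    rowSum x y η γ (fun i _ => w i * 1) i = (x i + (b + γ)) * w i := by
  unfold rowSum
  rw [show x i + (b + γ) = b + (x i + γ) by ring, ← hy.sum_mul_add, Finset.sum_mul]
  exact Finset.sum_congr rfl fun j _ => by ring

theorem rowSum_mul_inv_inv (hy : IsWeight β y η b) (hp : ∀ j s, y j + β s ≠ 0)
    (hd : ∀ i j, x i + y j + γ ≠ 0) (w : Fin (m + 1) → ℂ) (s : Fin n) (i : Fin (m + 1)) :
    rowSum x y η γ (fun i j => w i * ((y j + β s)⁻¹ * (y j + (x i + γ))⁻¹)) i = 0 := by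
  unfold rowSum
  rw [← mul_zero (w i), ← hy.sum_inv hp s, Finset.mul_sum]
  refine Finset.sum_congr rfl fun j _ => ?_
  have : y j + (x i + γ) ≠ 0 := fun h0 => hd i j (by linear_combination h0)
  have := hp j s
  field_simp
  ring

end Sums

theorem mul_single {ι : Type} [DecidableEq ι] (x : ι → ℂ) (l i : ι) :
    x i * (Pi.single l 1 : ι → ℂ) i = x l * (Pi.single l 1 : ι → ℂ) i := by
  rcases eq_or_ne i l with rfl | h
  · rfl
  · rw [Pi.single_eq_of_ne h, mul_zero, mul_zero]

theorem sum_ev {ι : Type} [Fintype ι] (f g : ι → ℂ) (n : ℕ) :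
    ∑ i, ev (f i) (g i) n = ∑ _ : Fin n, ∑ i, ev (f i) (g i) := by
  simp [ev, ← Multiset.nsmul_singleton, Finset.sum_nsmul]

theorem ev_eq_sum (a b : ℂ) (n : ℕ) : ev a b n = ∑ _ : Fin n, ev a b := by
  simp [ev, ← Multiset.nsmul_singleton]

namespace GridGeneric

variable {m n : ℕ} {α : Fin m → ℂ} {x ε : Fin (m + 1) → ℂ} {a : ℂ}
  {β : Fin n → ℂ} {y η : Fin (n + 1) → ℂ} {b γ : ℂ}

theorem li_inv (h : GridGeneric α x ε a β y η b γ) (i : Fin (m + 1)) :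
    LinearIndependent ℂ (Fin.cons (fun j => (y j + (x i + γ))⁻¹) fun (s : Fin n)
      (j : Fin (n + 1)) => (y j + β s)⁻¹ : Fin (n + 1) → Fin (n + 1) → ℂ) :=
  h.wy.linearIndependent_inv_cons h.py h.inj_β _
    (fun j h0 => h.add_γ i j (by linear_combination h0)) fun s => h.ne_β s i

theorem li_one (h : GridGeneric α x ε a β y η b γ) (i : Fin (m + 1)) :
    LinearIndependent ℂ (Fin.cons (fun _ => 1) fun (s : Fin n)
      (j : Fin (n + 1)) => (y j + β s)⁻¹ * (y j + (x i + γ))⁻¹ :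
        Fin (n + 1) → Fin (n + 1) → ℂ) :=
  h.wy.linearIndependent_one h.py h.inj_β _
    (fun j h0 => h.add_γ i j (by linear_combination h0))
    fun h0 => h.sum_x i (by linear_combination h0)

variable {S : KZ}

theorem gridRes_14_single (h : GridGeneric α x ε a β y η b γ) (p i : Fin (m + 1))
    (j : Fin (n + 1)) :
    gridRes x ε y η γ 1 4
      (fun i j => (Pi.single p 1 : Fin (m + 1) → ℂ) i * (y j + (x i + γ))⁻¹) i j
      = (x p + γ) * ((Pi.single p 1 : Fin (m + 1) → ℂ) i * (y j + (x i + γ))⁻¹) := by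
  rw [gridRes_14, rowSum_inv h.wy h.add_γ]
  have h1 := mul_single x p i
  have h2 := mul_inv_cancel₀ (a := y j + (x i + γ))
    fun h0 => h.add_γ i j (by linear_combination h0)
  linear_combination (-(Pi.single p 1 : Fin (m + 1) → ℂ) i) * h2
    + (y j + (x i + γ))⁻¹ * h1

theorem gridRes_14_mul (h : GridGeneric α x ε a β y η b γ) (w : Fin (m + 1) → ℂ) (s : Fin n)
    (i : Fin (m + 1)) (j : Fin (n + 1)) :
    gridRes x ε y η γ 1 4 (fun i j => w i * (y j + β s)⁻¹) i j
      = β s * (w i * (y j + β s)⁻¹) := by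
  rw [gridRes_14, rowSum_mul_inv h.wy h.py]
  have := h.py j s
  field_simp
  ring

theorem gridRes_24_const (h : GridGeneric α x ε a β y η b γ) (w : Fin (m + 1) → ℂ)
    (i : Fin (m + 1)) (j : Fin (n + 1)) :
    gridRes x ε y η γ 2 4 (fun i _ => w i * 1) i j = (-b - γ) * (w i * 1) := by
  rw [gridRes_24, rowSum_const h.wy]
  ring

theorem gridRes_24_single (h : GridGeneric α x ε a β y η b γ) (p : Fin (m + 1)) (s : Fin n)
    (i : Fin (m + 1)) (j : Fin (n + 1)) :
    gridRes x ε y η γ 2 4 (fun i j => (Pi.single p 1 : Fin (m + 1) → ℂ) i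
        * ((y j + β s)⁻¹ * (y j + (x i + γ))⁻¹)) i j
      = x p * ((Pi.single p 1 : Fin (m + 1) → ℂ) i
        * ((y j + β s)⁻¹ * (y j + (x i + γ))⁻¹)) := by
  rw [gridRes_24, rowSum_mul_inv_inv h.wy h.py h.add_γ, ← mul_assoc, mul_single]
  ring

theorem jointBasis_03_12 (hS : Represents S x ε y η γ) :
    HasJointBasis (S.A 0 3) (S.A 1 2) (∑ i, ∑ j, ev (x i) (y j)) := by
  rw [Finset.sum_comm]
  refine hS.hasJointBasis (linearIndependent_grid (fun _ => linearIndependent_single _)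
    fun _ => linearIndependent_single _) (fun _ p => x p) (fun k _ => y k) ?_ ?_
  · intro k p s t
    rw [gridRes_03, ← mul_assoc, mul_single, mul_assoc]
  · intro k p s t
    rw [gridRes_12, mul_left_comm, mul_single, mul_left_comm]

theorem jointBasis_03_14 (h : GridGeneric α x ε a β y η b γ) (hS : Represents S x ε y η γ) :
    HasJointBasis (S.A 0 3) (S.A 1 4)
      (∑ i, ev (x i) (x i + γ) + ∑ i, ∑ j, ev (x i) (β j)) := by
  rw [Finset.sum_comm (f := fun i j => ev (x i) (β j))]
  convert hS.hasJointBasis (i := 0) (j := 3) (i' := 1) (j' := 4)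
    (linearIndependent_grid (fun _ => linearIndependent_single _) h.li_inv)
    (fun _ p => x p) (Fin.cons (fun p => x p + γ) fun s _ => β s) ?_ ?_ using 1
  · rw [Fin.sum_univ_succ (n := n)]; rfl
  · intro k p s t
    rw [gridRes_03, ← mul_assoc, mul_single, mul_assoc]
  · intro k p s t
    exact Fin.cases (h.gridRes_14_single p s t) (fun k => h.gridRes_14_mul _ k s t) k

/-- On w(i)/(y + β_s), an eigenfunction of A_14 for any w, the matrix A_02 acts by the rank one map
w ↦ -∑ ε (x + γ - β_s) w. Its image is spanned by w = 1, and its kernel by the functions 1/((x +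
α_r)(x + γ - β_s)). On w(i)/(y + x + γ) it vanishes. -/
theorem jointBasis_02_14 (h : GridGeneric α x ε a β y η b γ) (hS : Represents S x ε y η γ) :
    HasJointBasis (S.A 0 2) (S.A 1 4)
      (∑ i, ev 0 (x i + γ) + ∑ j, ev 0 (β j) m + ∑ j, ev (β j - a - γ) (β j)) := by
  have hc : ∀ s i, x i + (γ - β s) ≠ 0 := fun s i h0 => h.ne_β s i (by linear_combination -h0)
  convert hS.hasJointBasis (i := 0) (j := 2) (i' := 1) (j' := 4)
    (linearIndependent_grid (w := Fin.cons (fun l => Pi.single l 1) fun s => Fin.cons (fun _ => 1)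
      fun r i => (x i + α r)⁻¹ * (x i + (γ - β s))⁻¹) (Fin.cases (linearIndependent_single _)
        fun s => h.wx.linearIndependent_one h.px h.inj_α _ (hc s) fun h0 =>
          h.sum_β s (by linear_combination -h0)) h.li_inv)
    (Fin.cons (fun _ => 0) fun s => Fin.cons (β s - a - γ) fun _ => 0)
    (Fin.cons (fun p => x p + γ) fun s _ => β s) ?_ ?_ using 1
  · simp only [Fin.sum_univ_succ, Fin.cons_zero, Fin.cons_succ, Finset.sum_add_distrib, ev_eq_sum _ _ m]
    abel
  · intro k p s t
    rw [gridRes_02, totSum]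
    refine Fin.cases ?_ (fun k => ?_) k
    · simp only [Fin.cons_zero]
      simp only [rowSum_inv h.wy h.add_γ, colSum_inv h.add_γ]
      ring
    · simp only [Fin.cons_succ]
      simp only [rowSum_mul_inv h.wy h.py, colSum_mul_inv h.py]
      refine Fin.cases ?_ (fun r => ?_) p
      · simp only [Fin.cons_zero, mul_one, h.wx.sum_mul_add]
        ring
      · simp only [Fin.cons_succ]
        have : ∀ i, (x i + (γ - β k)) * ((x i + α r)⁻¹ * (x i + (γ - β k))⁻¹)
            = (x i + α r)⁻¹ := fun i => by
          rw [mul_left_comm, mul_inv_cancel₀ (hc k i), mul_one]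
        simp only [this, h.wx.sum_inv h.px]
        ring
  · intro k p s t
    exact Fin.cases (h.gridRes_14_single p s t) (fun k => h.gridRes_14_mul _ k s t) k

/-- On w(i)/(y + β_s) the matrix A_23 acts by w ↦ (β_s - x) w + ∑ ε (x + γ - β_s) w. The choices w =
1/(x + γ - β_s) and w = 1/(x + α_r) both make the sum equal to 1, with eigenvalues γ and α_r + β_s.
-/
theorem jointBasis_14_23 (h : GridGeneric α x ε a β y η b γ) (hS : Represents S x ε y η γ) :
    HasJointBasis (S.A 1 4) (S.A 2 3)
      (∑ i, ev (x i + γ) γ + ∑ j, ev (β j) γ + ∑ i, ∑ j, ev (β j) (α i + β j)) := by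
  have hc : ∀ s i, x i + (γ - β s) ≠ 0 := fun s i h0 => h.ne_β s i (by linear_combination -h0)
  rw [Finset.sum_comm (f := fun i j => ev (β j) (α i + β j))]
  convert hS.hasJointBasis (i := 1) (j := 4) (i' := 2) (j' := 3)
    (linearIndependent_grid (w := Fin.cons (fun l => Pi.single l 1) fun s =>
      Fin.cons (fun i => (x i + (γ - β s))⁻¹) fun r i => (x i + α r)⁻¹)
        (Fin.cases (linearIndependent_single _)
        fun s => h.wx.linearIndependent_inv_cons h.px h.inj_α _ (hc s) fun r h0 =>
          h.ne_γ r s (by linear_combination h0)) h.li_inv)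
    (Fin.cons (fun p => x p + γ) fun s _ => β s)
    (Fin.cons (fun _ => γ) fun s => Fin.cons γ fun r => α r + β s) ?_ ?_ using 1
  · simp only [Fin.sum_univ_succ, Fin.cons_zero, Fin.cons_succ, Finset.sum_add_distrib]
    abel
  · intro k p s t
    exact Fin.cases (h.gridRes_14_single p s t) (fun k => h.gridRes_14_mul _ k s t) k
  · intro k p s t
    rw [gridRes_23, totSum]
    refine Fin.cases ?_ (fun k => ?_) k
    · simp only [Fin.cons_zero]
      simp only [rowSum_inv h.wy h.add_γ, colSum_inv h.add_γ]
      have : y t + (x s + γ) ≠ 0 := fun h0 => h.add_γ s t (by linear_combination h0)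
      field_simp
      ring
    · simp only [Fin.cons_succ]
      simp only [rowSum_mul_inv h.wy h.py, colSum_mul_inv h.py]
      have h1 := h.py t k
      refine Fin.cases ?_ (fun r => ?_) p
      · simp only [Fin.cons_zero]
        have h2 := hc k s
        have : ∀ i, (x i + (γ - β k)) * (x i + (γ - β k))⁻¹ = 1 := fun i =>
          mul_inv_cancel₀ (hc k i)
        simp only [this, mul_one, h.wx.sum]
        field_simp
        ring
      · simp only [Fin.cons_succ, h.wx.sum_add_mul_inv h.px]
        have h2 := h.px s r
        field_simp
        ring

theorem jointBasis_03_24 (h : GridGeneric α x ε a β y η b γ) (hS : Represents S x ε y η γ) :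
    HasJointBasis (S.A 0 3) (S.A 2 4)
      (∑ i, ev (x i) (-b - γ) + ∑ i, ev (x i) (x i) n) := by
  convert hS.hasJointBasis (i := 0) (j := 3) (i' := 2) (j' := 4)
    (linearIndependent_grid (fun _ => linearIndependent_single _) h.li_one)
    (fun _ p => x p) (Fin.cons (fun p => -b - γ) fun _ p => x p) ?_ ?_ using 1
  · rw [sum_ev _ _ n, Fin.sum_univ_succ (n := n)]; rfl
  · intro k p s t
    rw [gridRes_03, ← mul_assoc, mul_single, mul_assoc]
  · intro k p s t
    exact Fin.cases (h.gridRes_24_const _ s t) (fun k => h.gridRes_24_single p k s t) k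

/-- On functions w(i) constant in y, A_01 is the rank one map w ↦ -∑ ε (x + b + γ) w; on the other
eigenfunctions of A_24 the row sums vanish, and A_01 with them. -/
theorem jointBasis_01_24 (h : GridGeneric α x ε a β y η b γ) (hS : Represents S x ε y η γ) :
    HasJointBasis (S.A 0 1) (S.A 2 4)
      (ev (-a - b - γ) (-b - γ) + ev 0 (-b - γ) m + ∑ i, ev 0 (x i) n) := by
  have hc : ∀ i, x i + (b + γ) ≠ 0 := fun i h0 => h.sum_x i (by linear_combination h0)
  convert hS.hasJointBasis (i := 0) (j := 1) (i' := 2) (j' := 4)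
    (linearIndependent_grid (w := Fin.cons (Fin.cons (fun _ => 1)
      fun r i => (x i + α r)⁻¹ * (x i + (b + γ))⁻¹) fun _ l => Pi.single l 1)
      (Fin.cases (h.wx.linearIndependent_one h.px h.inj_α _ hc fun h0 =>
          h.tot (by linear_combination h0)) fun _ => linearIndependent_single _) h.li_one)
    (Fin.cons (Fin.cons (-a - b - γ) fun _ => 0) fun _ _ => 0)
    (Fin.cons (fun _ => -b - γ) fun _ p => x p) ?_ ?_ using 1
  · rw [sum_ev _ _ n]
    simp only [Fin.sum_univ_succ, Fin.cons_zero, Fin.cons_succ, Finset.sum_add_distrib, ev_eq_sum _ _ m]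
    abel
  · intro k p s t
    rw [gridRes_01, totSum]
    refine Fin.cases ?_ (fun k => ?_) k
    · simp only [Fin.cons_zero]
      simp only [rowSum_const h.wy]
      refine Fin.cases ?_ (fun r => ?_) p
      · simp only [Fin.cons_zero, mul_one, h.wx.sum_mul_add]
        ring
      · simp only [Fin.cons_succ]
        have : ∀ i, (x i + (b + γ)) * ((x i + α r)⁻¹ * (x i + (b + γ))⁻¹)
            = (x i + α r)⁻¹ := fun i => by
          rw [mul_left_comm, mul_inv_cancel₀ (hc i), mul_one]
        simp only [this, h.wx.sum_inv h.px]
        ring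
    · simp only [Fin.cons_succ]
      simp only [rowSum_mul_inv_inv h.wy h.py h.add_γ, mul_zero, Finset.sum_const_zero]
      ring
  · intro k p s t
    exact Fin.cases (h.gridRes_24_const _ s t) (fun k => h.gridRes_24_single p k s t) k

/-- On functions w(i) constant in y, A_13 is w ↦ ∑ ε (x + b + γ) w - (x + b + γ) w, diagonalized by
1/(x + b + γ) and the 1/(x + α_r). -/
theorem jointBasis_13_24 (h : GridGeneric α x ε a β y η b γ) (hS : Represents S x ε y η γ) :
    HasJointBasis (S.A 1 3) (S.A 2 4)
      (∑ i, ev (α i - b - γ) (-b - γ) + ev 0 (-b - γ) + ∑ i, ev 0 (x i) n) := by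
  have hc : ∀ i, x i + (b + γ) ≠ 0 := fun i h0 => h.sum_x i (by linear_combination h0)
  convert hS.hasJointBasis (i := 1) (j := 3) (i' := 2) (j' := 4)
    (linearIndependent_grid (w := Fin.cons (Fin.cons (fun i => (x i + (b + γ))⁻¹)
      fun r i => (x i + α r)⁻¹) fun _ l => Pi.single l 1)
      (Fin.cases (h.wx.linearIndependent_inv_cons h.px h.inj_α _ hc h.sum_α)
        fun _ => linearIndependent_single _) h.li_one)
    (Fin.cons (Fin.cons 0 fun r => α r - b - γ) fun _ _ => 0)
    (Fin.cons (fun _ => -b - γ) fun _ p => x p) ?_ ?_ using 1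
  · rw [sum_ev _ _ n]
    simp only [Fin.sum_univ_succ, Fin.cons_zero, Fin.cons_succ, Finset.sum_add_distrib]
    abel
  · intro k p s t
    rw [gridRes_13, totSum]
    refine Fin.cases ?_ (fun k => ?_) k
    · simp only [Fin.cons_zero]
      simp only [rowSum_const h.wy]
      refine Fin.cases ?_ (fun r => ?_) p
      · simp only [Fin.cons_zero]
        have : ∀ i, (x i + (b + γ)) * (x i + (b + γ))⁻¹ = 1 := fun i =>
          mul_inv_cancel₀ (hc i)
        simp only [this, mul_one, h.wx.sum]
        ring
      · simp only [Fin.cons_succ, h.wx.sum_add_mul_inv h.px]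
        have h2 := h.px s r
        field_simp
        ring
    · simp only [Fin.cons_succ]
      simp only [rowSum_mul_inv_inv h.wy h.py h.add_γ, mul_zero, Finset.sum_const_zero]
      ring
  · intro k p s t
    exact Fin.cases (h.gridRes_24_const _ s t) (fun k => h.gridRes_24_single p k s t) k

end GridGeneric

section Sums

variable {m n : ℕ} {x ε : Fin (m + 1) → ℂ} {β : Fin n → ℂ} {y η : Fin (n + 1) → ℂ} {b γ : ℂ}

theorem colSum_const (w : Fin (m + 1) → ℂ) (j : Fin (n + 1)) :
    colSum x ε y γ (fun i _ => w i * 1) j = ∑ i, ε i * ((x i + (y j + γ)) * w i) :=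
  Finset.sum_congr rfl fun i _ => by ring

theorem colSum_mul_inv_inv (hd : ∀ i j, x i + y j + γ ≠ 0) (w : Fin (m + 1) → ℂ) (s : Fin n)
    (j : Fin (n + 1)) :
    colSum x ε y γ (fun i j => w i * ((y j + β s)⁻¹ * (y j + (x i + γ))⁻¹)) j
      = (∑ i, ε i * w i) * (y j + β s)⁻¹ := by
  unfold colSum
  rw [Finset.sum_mul]
  refine Finset.sum_congr rfl fun i _ => ?_
  have := mul_inv_cancel₀ (a := y j + (x i + γ))
    fun h0 => hd i j (by linear_combination h0)
  linear_combination (ε i * w i * (y j + β s)⁻¹) * this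

end Sums

namespace GridGeneric

variable {m n : ℕ} {α : Fin m → ℂ} {x ε : Fin (m + 1) → ℂ} {a : ℂ}
  {β : Fin n → ℂ} {y η : Fin (n + 1) → ℂ} {b γ : ℂ}

/-- The products of the functions `1`, `1 / (x + α r)` and `1`, `1 / (y + β s)`. -/
theorem li_tensor (h : GridGeneric α x ε a β y η b γ) :
    LinearIndependent ℂ fun (p : Fin (m + 1) × Fin (n + 1)) (i : Fin (m + 1)) (j : Fin (n + 1)) =>
      (Fin.cons (fun _ => 1) fun (r : Fin m) (i : Fin (m + 1)) => (x i + α r)⁻¹ :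
        Fin (m + 1) → Fin (m + 1) → ℂ) p.1 i
      * (Fin.cons (fun _ => 1) fun (s : Fin n) (j : Fin (n + 1)) => (y j + β s)⁻¹ :
        Fin (n + 1) → Fin (n + 1) → ℂ) p.2 j :=
  linearIndependent_grid
    (w := fun _ : Fin (n + 1) => Fin.cons (fun _ => 1) fun (r : Fin m) (i : Fin (m + 1)) =>
      (x i + α r)⁻¹)
    (u := fun _ : Fin (m + 1) => Fin.cons (fun _ => 1) fun (s : Fin n) (j : Fin (n + 1)) =>
      (y j + β s)⁻¹)
    (fun _ => h.wx.linearIndependent_one_inv h.px h.inj_α)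
    fun _ => h.wy.linearIndependent_one_inv h.py h.inj_β

variable {S : KZ}

/-- Here no single shape in y can be kept fixed, so `linearIndependent_grid` does not apply to the
eigenbasis itself. It differs from the product basis of `li_tensor` only by factors 1/(x + y + γ),
and these sit exactly on the vectors killed by γ - A_01 - A_23. -/
theorem jointBasis_01_23 (h : GridGeneric α x ε a β y η b γ) (hS : Represents S x ε y η γ) :
    HasJointBasis (S.A 0 1) (S.A 2 3)
      (ev (-a - b - γ) γ + ev 0 γ (m + n) + ∑ i, ∑ j, ev 0 (α i + β j)) := by
  have hd : ∀ i j, y j + (x i + γ) ≠ 0 := fun i j h0 => h.add_γ i j (by linear_combination h0)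
  let F : Fin (m + 1) × Fin (n + 1) → Fin (m + 1) → Fin (n + 1) → ℂ := fun p =>
    (Fin.cons (Fin.cons (fun i j => 1 * 1) fun r i j => (x i + α r)⁻¹ * (y j + (x i + γ))⁻¹)
      fun s => Fin.cons (fun i j => 1 * ((y j + β s)⁻¹ * (y j + (x i + γ))⁻¹))
        fun r i j => (x i + α r)⁻¹ * (y j + β s)⁻¹ :
      Fin (n + 1) → Fin (m + 1) → Fin (m + 1) → Fin (n + 1) → ℂ) p.2 p.1
  let l : Fin (n + 1) → Fin (m + 1) → ℂ :=
    Fin.cons (Fin.cons (-a - b - γ) fun _ => 0) fun _ _ => 0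
  let μ : Fin (n + 1) → Fin (m + 1) → ℂ :=
    Fin.cons (fun _ => γ) fun s => Fin.cons γ fun r => α r + β s
  have hl : ∀ k p s t, gridRes x ε y η γ 0 1 (F (p, k)) s t = l k p * F (p, k) s t := by
    intro k p s t
    rw [gridRes_01, totSum]
    refine Fin.cases ?_ (fun k => ?_) k <;> refine Fin.cases ?_ (fun r => ?_) p
    · simp only [F, l, Fin.cons_zero]
      simp only [rowSum_const h.wy (fun _ => 1)]
      simp only [mul_one, h.wx.sum_mul_add]
      ring
    · simp only [F, l, Fin.cons_zero, Fin.cons_succ]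
      simp only [rowSum_inv h.wy h.add_γ, h.wx.sum_inv h.px]
      ring
    · simp only [F, l, Fin.cons_zero, Fin.cons_succ]
      simp only [rowSum_mul_inv_inv h.wy h.py h.add_γ (fun _ => 1), mul_zero,
        Finset.sum_const_zero]
      ring
    · simp only [F, l, Fin.cons_succ]
      simp only [rowSum_mul_inv h.wy h.py, h.wx.sum_inv h.px]
      ring
  have hμ : ∀ k p s t, gridRes x ε y η γ 2 3 (F (p, k)) s t = μ k p * F (p, k) s t := by
    intro k p s t
    rw [gridRes_23, totSum]
    refine Fin.cases ?_ (fun k => ?_) k <;> refine Fin.cases ?_ (fun r => ?_) p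
    · simp only [F, μ, Fin.cons_zero]
      simp only [rowSum_const h.wy (fun _ => 1), colSum_const (fun _ => 1)]
      simp only [mul_one, h.wx.sum_mul_add]
      ring
    · simp only [F, μ, Fin.cons_zero, Fin.cons_succ]
      simp only [rowSum_inv h.wy h.add_γ, colSum_inv h.add_γ, h.wx.sum_inv h.px]
      have := mul_inv_cancel₀ (hd s t)
      linear_combination (-(x s + α r)⁻¹) * this
    · simp only [F, μ, Fin.cons_zero, Fin.cons_succ]
      simp only [rowSum_mul_inv_inv h.wy h.py h.add_γ (fun _ => 1),
        colSum_mul_inv_inv h.add_γ (fun _ => 1), mul_zero, mul_one,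
        Finset.sum_const_zero, h.wx.sum]
      have := mul_inv_cancel₀ (hd s t)
      linear_combination (-(y t + β k)⁻¹) * this
    · simp only [F, μ, Fin.cons_succ]
      simp only [rowSum_mul_inv h.wy h.py, colSum_mul_inv h.py, h.wx.sum_inv h.px,
        h.wx.sum_add_mul_inv h.px]
      have h1 := h.px s r
      have h2 := h.py t k
      field_simp
      ring
  have hF : LinearIndependent ℂ F := by
    refine linearIndependent_of_triangular h.li_tensor
      (γ • 1 - gridRes x ε y η γ 0 1 - gridRes x ε y η γ 2 3) (mulFun (gridSum x y γ))
      (fun p => γ - l p.2 p.1 - μ p.2 p.1) ?_ ?_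
    · rintro ⟨p, k⟩
      ext s t
      change γ * F (p, k) s t - gridRes x ε y η γ 0 1 (F (p, k)) s t
        - gridRes x ε y η γ 2 3 (F (p, k)) s t = (γ - l k p - μ k p) * (_ * _)
      rw [hl, hμ]
      refine Fin.cases ?_ (fun k => ?_) k <;> refine Fin.cases ?_ (fun r => ?_) p <;>
        simp only [F, l, μ, Fin.cons_zero, Fin.cons_succ] <;> ring
    · rintro ⟨p, k⟩
      refine Fin.cases ?_ (fun k => ?_) k <;> refine Fin.cases ?_ (fun r => ?_) p
      · left
        simp only [l, μ, Fin.cons_zero]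
        exact fun h0 => h.tot (by linear_combination h0)
      · right
        ext s t
        change (x s + y t + γ) * ((x s + α r)⁻¹ * (y t + (x s + γ))⁻¹) = (x s + α r)⁻¹ * 1
        linear_combination (x s + α r)⁻¹ * mul_inv_cancel₀ (hd s t)
      · right
        ext s t
        change (x s + y t + γ) * (1 * ((y t + β k)⁻¹ * (y t + (x s + γ))⁻¹))
          = 1 * (y t + β k)⁻¹
        linear_combination (y t + β k)⁻¹ * mul_inv_cancel₀ (hd s t)
      · left
        simp only [l, μ, Fin.cons_succ]
        exact fun h0 => h.ne_γ r k (by linear_combination -h0)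
  convert hS.hasJointBasis hF l μ hl hμ using 1
  rw [Finset.sum_comm]
  simp only [l, μ, Fin.sum_univ_succ, Fin.cons_zero, Fin.cons_succ, Finset.sum_add_distrib]
  rw [show ev 0 γ (m + n) = ev 0 γ m + ev 0 γ n from Multiset.replicate_add _ _ _,
    ev_eq_sum _ _ m, ev_eq_sum _ _ n]
  abel

/-- As for the pair A_01, A_23, now with A_02 + A_13: the factor 1/(x + y + γ) sits on the mn + 1
vectors with joint eigenvalue (0, 0). -/
theorem jointBasis_02_13 (h : GridGeneric α x ε a β y η b γ) (hS : Represents S x ε y η γ) :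
    HasJointBasis (S.A 0 2) (S.A 1 3)
      (∑ i, ev 0 (α i - b - γ) + ev 0 0 (m * n + 1) + ∑ j, ev (β j - a - γ) 0) := by
  have hd : ∀ i j, y j + (x i + γ) ≠ 0 := fun i j h0 => h.add_γ i j (by linear_combination h0)
  let F : Fin (m + 1) × Fin (n + 1) → Fin (m + 1) → Fin (n + 1) → ℂ := fun p =>
    (Fin.cons (Fin.cons (fun i j => 1 * (y j + (x i + γ))⁻¹) fun r i j => (x i + α r)⁻¹ * 1)
      fun s => Fin.cons (fun i j => 1 * (y j + β s)⁻¹)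
        fun r i j => (x i + α r)⁻¹ * ((y j + β s)⁻¹ * (y j + (x i + γ))⁻¹) :
      Fin (n + 1) → Fin (m + 1) → Fin (m + 1) → Fin (n + 1) → ℂ) p.2 p.1
  let l : Fin (n + 1) → Fin (m + 1) → ℂ :=
    Fin.cons (fun _ => 0) fun s => Fin.cons (β s - a - γ) fun _ => 0
  let μ : Fin (n + 1) → Fin (m + 1) → ℂ :=
    Fin.cons (Fin.cons 0 fun r => α r - b - γ) fun _ _ => 0
  have hl : ∀ k p s t, gridRes x ε y η γ 0 2 (F (p, k)) s t = l k p * F (p, k) s t := by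
    intro k p s t
    rw [gridRes_02, totSum]
    refine Fin.cases ?_ (fun k => ?_) k <;> refine Fin.cases ?_ (fun r => ?_) p
    · simp only [F, l, Fin.cons_zero]
      simp only [rowSum_inv h.wy h.add_γ (fun _ => 1), colSum_inv h.add_γ (fun _ => 1)]
      ring
    · simp only [F, l, Fin.cons_zero, Fin.cons_succ]
      simp only [rowSum_const h.wy, colSum_const, h.wx.sum_add_mul_inv h.px]
      ring
    · simp only [F, l, Fin.cons_zero, Fin.cons_succ]
      simp only [rowSum_mul_inv h.wy h.py (fun _ => 1), colSum_mul_inv h.py (fun _ => 1),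
        mul_one, h.wx.sum_mul_add, h.wx.sum]
      ring
    · simp only [F, l, Fin.cons_succ]
      simp only [rowSum_mul_inv_inv h.wy h.py h.add_γ, colSum_mul_inv_inv h.add_γ, mul_zero,
        Finset.sum_const_zero, h.wx.sum_inv h.px]
      ring
  have hμ : ∀ k p s t, gridRes x ε y η γ 1 3 (F (p, k)) s t = μ k p * F (p, k) s t := by
    intro k p s t
    rw [gridRes_13, totSum]
    refine Fin.cases ?_ (fun k => ?_) k <;> refine Fin.cases ?_ (fun r => ?_) p
    · simp only [F, μ, Fin.cons_zero]
      simp only [rowSum_inv h.wy h.add_γ (fun _ => 1), mul_one, h.wx.sum]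
      ring
    · simp only [F, μ, Fin.cons_zero, Fin.cons_succ]
      simp only [rowSum_const h.wy, h.wx.sum_add_mul_inv h.px]
      have h1 := h.px s r
      field_simp
      ring
    · simp only [F, μ, Fin.cons_zero, Fin.cons_succ]
      simp only [rowSum_mul_inv h.wy h.py (fun _ => 1), mul_one, h.wx.sum]
      ring
    · simp only [F, μ, Fin.cons_succ]
      simp only [rowSum_mul_inv_inv h.wy h.py h.add_γ, mul_zero, Finset.sum_const_zero]
      ring
  have hF : LinearIndependent ℂ F := by
    refine linearIndependent_of_triangular h.li_tensor
      (gridRes x ε y η γ 0 2 + gridRes x ε y η γ 1 3) (mulFun (gridSum x y γ))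
      (fun p => l p.2 p.1 + μ p.2 p.1) ?_ ?_
    · rintro ⟨p, k⟩
      ext s t
      change gridRes x ε y η γ 0 2 (F (p, k)) s t
        + gridRes x ε y η γ 1 3 (F (p, k)) s t = (l k p + μ k p) * (_ * _)
      rw [hl, hμ]
      refine Fin.cases ?_ (fun k => ?_) k <;> refine Fin.cases ?_ (fun r => ?_) p <;>
        simp only [F, l, μ, Fin.cons_zero, Fin.cons_succ] <;> ring
    · rintro ⟨p, k⟩
      refine Fin.cases ?_ (fun k => ?_) k <;> refine Fin.cases ?_ (fun r => ?_) p
      · right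
        ext s t
        change (x s + y t + γ) * (1 * (y t + (x s + γ))⁻¹) = 1 * 1
        linear_combination mul_inv_cancel₀ (hd s t)
      · left
        simp only [l, μ, Fin.cons_zero, Fin.cons_succ]
        exact fun h0 => h.sum_α r (by linear_combination h0)
      · left
        simp only [l, μ, Fin.cons_zero, Fin.cons_succ]
        exact fun h0 => h.sum_β k (by linear_combination h0)
      · right
        ext s t
        change (x s + y t + γ) * ((x s + α r)⁻¹ * ((y t + β k)⁻¹ * (y t + (x s + γ))⁻¹))
          = (x s + α r)⁻¹ * (y t + β k)⁻¹
        linear_combination ((x s + α r)⁻¹ * (y t + β k)⁻¹) * mul_inv_cancel₀ (hd s t)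
  convert hS.hasJointBasis hF l μ hl hμ using 1
  simp only [l, μ, Fin.sum_univ_succ, Fin.cons_zero, Fin.cons_succ, Finset.sum_add_distrib]
  rw [show ev 0 0 (m * n + 1) = ∑ _ : Fin n, ∑ _ : Fin m, ev 0 0 + ev 0 0 by
    simp [ev, ← Multiset.nsmul_singleton, ← mul_smul, mul_comm, ← Multiset.singleton_add,
      add_comm]]
  abel

/-! The remaining pairs, by exchanging the two variables. -/

theorem jointBasis_01_34 (h : GridGeneric α x ε a β y η b γ) (hS : Represents S x ε y η γ) :
    HasJointBasis (S.A 1 0) (S.A 3 4)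
      (ev (-b - a - γ) (-a - γ) + ev 0 (-a - γ) n + ∑ j, ev 0 (y j) m) :=
  h.swap.jointBasis_01_24 hS.reindex

theorem jointBasis_13_04 (h : GridGeneric α x ε a β y η b γ) (hS : Represents S x ε y η γ) :
    HasJointBasis (S.A 1 3) (S.A 0 4)
      (∑ j, ev 0 (y j + γ) + ∑ i, ev 0 (α i) n + ∑ i, ev (α i - b - γ) (α i)) :=
  h.swap.jointBasis_02_14 hS.reindex

theorem jointBasis_02_34 (h : GridGeneric α x ε a β y η b γ) (hS : Represents S x ε y η γ) :
    HasJointBasis (S.A 0 2) (S.A 3 4)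
      (∑ j, ev (β j - a - γ) (-a - γ) + ev 0 (-a - γ) + ∑ j, ev 0 (y j) m) :=
  h.swap.jointBasis_13_24 hS.reindex

theorem jointBasis_12_04 (h : GridGeneric α x ε a β y η b γ) (hS : Represents S x ε y η γ) :
    HasJointBasis (S.A 1 2) (S.A 0 4)
      (∑ j, ev (y j) (y j + γ) + ∑ j, ∑ i, ev (y j) (α i)) :=
  h.swap.jointBasis_03_14 hS.reindex

theorem jointBasis_12_34 (h : GridGeneric α x ε a β y η b γ) (hS : Represents S x ε y η γ) :
    HasJointBasis (S.A 1 2) (S.A 3 4)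
      (∑ j, ev (y j) (-a - γ) + ∑ j, ev (y j) (y j) m) :=
  h.swap.jointBasis_03_24 hS.reindex

theorem jointBasis_04_32 (h : GridGeneric α x ε a β y η b γ) (hS : Represents S x ε y η γ) :
    HasJointBasis (S.A 0 4) (S.A 3 2)
      (∑ j, ev (y j + γ) γ + ∑ i, ev (α i) γ + ∑ j, ∑ i, ev (α i) (β j + α i)) :=
  h.swap.jointBasis_14_23 hS.reindex

end GridGeneric

/-! ### The KZ laws from fifteen commutators -/

theorem KZ.resSum_eq (S : KZ) (I : Finset (Fin 5)) :
    S.resSum I = ∑ i, ∑ j, if i < j ∧ i ∈ I ∧ j ∈ I then S.A i j else 0 := by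
  unfold KZ.resSum
  symm
  rw [← Finset.sum_subset (Finset.subset_univ I) fun i _ hi => Finset.sum_eq_zero fun j _ =>
    if_neg fun h => hi h.2.1]
  refine Finset.sum_congr rfl fun i hi => ?_
  rw [← Finset.sum_filter]
  refine Finset.sum_congr ?_ fun _ _ => rfl
  ext j
  simp [hi, and_comm]

theorem finset_fin_five (I : Finset (Fin 5)) : I.card ≤ 1 ∨
    (∃ i j, i < j ∧ I = {i, j}) ∨ (∃ i j, i < j ∧ I = {i, j}ᶜ) ∨ (∃ l, I = {l}ᶜ) ∨
      I = Finset.univ := by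
  revert I
  decide

/-- The fifteen pairs of disjoint index pairs. -/
def disjointPairs : List (Fin 5 × Fin 5 × Fin 5 × Fin 5) :=
  [(0, 1, 2, 3), (0, 1, 2, 4), (0, 1, 3, 4), (0, 2, 1, 3), (0, 2, 1, 4), (0, 2, 3, 4),
    (0, 3, 1, 2), (0, 3, 1, 4), (0, 3, 2, 4), (0, 4, 1, 2), (0, 4, 1, 3), (0, 4, 2, 3),
    (1, 2, 3, 4), (1, 3, 2, 4), (1, 4, 2, 3)]

theorem mem_disjointPairs : ∀ i j k l : Fin 5, i < j → k < l →
    Disjoint ({i, j} : Finset (Fin 5)) {k, l} →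
      (i, j, k, l) ∈ disjointPairs ∨ (k, l, i, j) ∈ disjointPairs := by
  decide

theorem pair_eq_of_subset : ∀ i j k l : Fin 5, i < j → k < l →
    ({i, j} : Finset (Fin 5)) ⊆ {k, l} → i = k ∧ j = l := by
  decide

/-- When the six finite residues sum to zero, A_I vanishes unless #I is 2 or 3, and for a triple it
equals the residue of the complementary pair. Every required commutator is then trivial or one
between disjoint pairs. -/
theorem KZ.isKZType_of_commute {S : KZ} (symm : ∀ i j, S.A i j = S.A j i)
    (diag : ∀ i, S.A i i = 0)
    (infty : ∀ i, i ≠ 4 → S.A i 4 = -(S.A i 0 + S.A i 1 + S.A i 2 + S.A i 3))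
    (hsum : S.A 0 1 + S.A 0 2 + S.A 0 3 + S.A 1 2 + S.A 1 3 + S.A 2 3 = 0)
    (comm : ∀ t ∈ disjointPairs, Commute (S.A t.1 t.2.1) (S.A t.2.2.1 t.2.2.2)) :
    S.IsKZType := by
  have h0 := infty 0 (by decide)
  have h1 := infty 1 (by decide)
  have h2 := infty 2 (by decide)
  have h3 := infty 3 (by decide)
  rw [diag, zero_add] at h0
  rw [diag, add_zero, symm 1 0] at h1
  rw [diag, add_zero, symm 2 0, symm 2 1] at h2
  rw [diag, add_zero, symm 3 0, symm 3 1, symm 3 2] at h3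
  have h23 : S.A 2 3 = -(S.A 0 1 + S.A 0 2 + S.A 0 3 + S.A 1 2 + S.A 1 3) :=
    eq_neg_of_add_eq_zero_right hsum
  have hpair : ∀ i j : Fin 5, i < j → S.resSum {i, j} = S.A i j := by
    intro i j hij
    rw [S.resSum_eq]
    fin_cases i <;> fin_cases j <;> first | (exact absurd hij (by decide)) |
      simp [Fin.sum_univ_five]
  have hcompl : ∀ i j : Fin 5, i < j → S.resSum {i, j}ᶜ = S.A i j := by
    intro i j hij
    rw [S.resSum_eq]
    fin_cases i <;> fin_cases j <;> first | (exact absurd hij (by decide)) |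
      (simp [Fin.sum_univ_five, h0, h1, h2, h3, h23] <;> abel)
  have hfour : ∀ l : Fin 5, S.resSum {l}ᶜ = 0 := by
    intro l
    rw [S.resSum_eq]
    fin_cases l <;> simp [Fin.sum_univ_five, h0, h1, h2, h3, h23] <;> abel
  have huniv : S.resSum Finset.univ = 0 := by
    rw [S.resSum_eq]
    simp [Fin.sum_univ_five, h0, h1, h2, h3, h23]
    abel
  have hone : ∀ I : Finset (Fin 5), I.card ≤ 1 → S.resSum I = 0 := by
    intro I hI
    rw [S.resSum_eq]
    refine Finset.sum_eq_zero fun i _ => Finset.sum_eq_zero fun j _ => if_neg fun h => ?_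
    exact h.1.ne (Finset.card_le_one.mp hI i h.2.1 j h.2.2)
  have hI : ∀ I : Finset (Fin 5), S.resSum I = 0 ∨
      ∃ i j, i < j ∧ S.resSum I = S.A i j ∧ (I = {i, j} ∨ I = {i, j}ᶜ) := by
    intro I
    rcases finset_fin_five I with h | ⟨i, j, hij, rfl⟩ | ⟨i, j, hij, rfl⟩ | ⟨l, rfl⟩ | rfl
    · exact Or.inl (hone I h)
    · exact Or.inr ⟨i, j, hij, hpair i j hij, Or.inl rfl⟩
    · exact Or.inr ⟨i, j, hij, hcompl i j hij, Or.inr rfl⟩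
    · exact Or.inl (hfour l)
    · exact Or.inl huniv
  have hcomm : ∀ i j k l : Fin 5, i < j → k < l → Disjoint ({i, j} : Finset (Fin 5)) {k, l} →
      Commute (S.A i j) (S.A k l) := by
    intro i j k l hij hkl hd
    rcases mem_disjointPairs i j k l hij hkl hd with h | h
    · exact comm _ h
    · exact (comm _ h).symm
  have heq : ∀ i j k l : Fin 5, i < j → k < l → ({i, j} : Finset (Fin 5)) ⊆ {k, l} →
      Commute (S.A i j) (S.A k l) := by
    intro i j k l hij hkl hd
    obtain ⟨rfl, rfl⟩ := pair_eq_of_subset i j k l hij hkl hd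
    exact Commute.refl _
  refine ⟨symm, diag, infty, fun I J hIJ => ?_, fun I hI4 => ?_⟩
  · rcases hI I with h | ⟨i, j, hij, h, hi⟩
    · rw [h]; exact Commute.zero_left _
    rcases hI J with h' | ⟨k, l, hkl, h', hj⟩
    · rw [h']; exact Commute.zero_right _
    rw [h, h']
    have c1 : ({i, j} : Finset (Fin 5)).card = 2 := Finset.card_pair hij.ne
    have c2 : ({k, l} : Finset (Fin 5)).card = 2 := Finset.card_pair hkl.ne
    have c3 : ({i, j}ᶜ : Finset (Fin 5)).card = 3 := by rw [Finset.card_compl, c1]; rfl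
    have c4 : ({k, l}ᶜ : Finset (Fin 5)).card = 3 := by rw [Finset.card_compl, c2]; rfl
    rcases hi with rfl | rfl <;> rcases hj with rfl | rfl <;> rcases hIJ with hd | hd
    · exact hcomm i j k l hij hkl hd
    · exact heq i j k l hij hkl hd
    · exact heq i j k l hij hkl (disjoint_compl_right_iff.mp hd)
    · exact hcomm i j k l hij hkl (le_compl_iff_disjoint_right.mp hd)
    · exact (heq k l i j hkl hij (disjoint_compl_left_iff.mp hd)).symm
    · exact absurd (Finset.card_le_card hd) (by omega)
    -- Two triples among five points cannot be disjoint.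
    · have : ({i, j}ᶜ : Finset (Fin 5)) ⊆ {k, l} := disjoint_compl_right_iff.mp hd
      exact absurd (Finset.card_le_card this) (by omega)
    · exact (heq k l i j hkl hij (compl_le_compl_iff_le.mp hd)).symm
  · rcases finset_fin_five I with h | ⟨i, j, hij, rfl⟩ | ⟨i, j, hij, rfl⟩ | ⟨l, rfl⟩ | rfl
    · omega
    · rw [Finset.card_pair hij.ne] at hI4; omega
    · rw [Finset.card_compl, Finset.card_pair hij.ne] at hI4
      exact absurd hI4 (by decide)
    · exact hfour l
    · exact huniv

theorem residues_diag {V : Type} [AddCommGroup V] [Module ℂ V]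
    (a01 a02 a03 a12 a13 a23 : Module.End ℂ V) (i : Fin 5) :
    residues a01 a02 a03 a12 a13 a23 i i = 0 := by
  fin_cases i <;> rfl

theorem residues_infty {V : Type} [AddCommGroup V] [Module ℂ V]
    (a01 a02 a03 a12 a13 a23 : Module.End ℂ V) (i : Fin 5) (hi : i ≠ 4) :
    residues a01 a02 a03 a12 a13 a23 i 4 = -(residues a01 a02 a03 a12 a13 a23 i 0
      + residues a01 a02 a03 a12 a13 a23 i 1 + residues a01 a02 a03 a12 a13 a23 i 2
      + residues a01 a02 a03 a12 a13 a23 i 3) := by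
  fin_cases i <;> first | (exact absurd rfl hi) | simp [residues]

theorem Represents.sum_eq_zero {ι κ : Type} [Fintype ι] [Fintype κ] {S : KZ} {x ε : ι → ℂ}
    {y η : κ → ℂ} {γ : ℂ} (h : Represents S x ε y η γ) :
    S.A 0 1 + S.A 0 2 + S.A 0 3 + S.A 1 2 + S.A 1 3 + S.A 2 3 = 0 := by
  obtain ⟨e, he⟩ := h
  refine LinearMap.ext fun v => e.injective ?_
  ext i j
  simp only [LinearMap.add_apply, LinearMap.zero_apply, map_add, map_zero, he, Pi.add_apply,
    Pi.zero_apply, gridRes_01, gridRes_02, gridRes_03, gridRes_12, gridRes_13, gridRes_23]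
  ring

theorem GridGeneric.isKZType {m n : ℕ} {α : Fin m → ℂ} {x ε : Fin (m + 1) → ℂ} {a : ℂ}
    {β : Fin n → ℂ} {y η : Fin (n + 1) → ℂ} {b γ : ℂ} {S : KZ}
    (h : GridGeneric α x ε a β y η b γ) (hS : Represents S x ε y η γ) : S.IsKZType := by
  have hS' := hS
  obtain ⟨e, he⟩ := hS'
  have symm : ∀ i j, S.A i j = S.A j i := fun i j => LinearMap.ext fun v => e.injective (by
    rw [he, he, show gridRes x ε y η γ i j = gridRes x ε y η γ j i from
      residues_symm _ _ _ _ _ _ i j])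
  refine KZ.isKZType_of_commute symm (fun i => LinearMap.ext fun v => e.injective ?_)
    (fun i hi => LinearMap.ext fun v => e.injective ?_) hS.sum_eq_zero ?_
  · rw [he, show gridRes x ε y η γ i i = 0 from residues_diag _ _ _ _ _ _ i]
    simp
  · rw [he, show gridRes x ε y η γ i 4 = _ from residues_infty _ _ _ _ _ _ i hi]
    simp only [LinearMap.neg_apply, LinearMap.add_apply, map_neg, map_add, he]
    rfl
  · simp only [disjointPairs, List.forall_mem_cons, List.not_mem_nil, false_imp_iff,
      implies_true, and_true]
    refine ⟨(h.jointBasis_01_23 hS).commute, (h.jointBasis_01_24 hS).commute, ?_,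
      (h.jointBasis_02_13 hS).commute, (h.jointBasis_02_14 hS).commute,
      (h.jointBasis_02_34 hS).commute, (jointBasis_03_12 hS).commute,
      (h.jointBasis_03_14 hS).commute, (h.jointBasis_03_24 hS).commute,
      (h.jointBasis_12_04 hS).commute.symm, (h.jointBasis_13_04 hS).commute.symm, ?_,
      (h.jointBasis_12_34 hS).commute, (h.jointBasis_13_24 hS).commute,
      (h.jointBasis_14_23 hS).commute⟩
    · rw [symm 0 1]
      exact (h.jointBasis_01_34 hS).commute
    · rw [symm 2 3]
      exact (h.jointBasis_04_32 hS).commute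

/-! ### Row, column and total sums of the images of the grid matrices -/

section GridCalculus

variable {ι κ : Type} [Fintype ι] (x ε : ι → ℂ) (y η : κ → ℂ) (γ : ℂ)

theorem colSum_add (f g : ι → κ → ℂ) (j : κ) :
    colSum x ε y γ (f + g) j = colSum x ε y γ f j + colSum x ε y γ g j := by
  simp [colSum, mul_add, Finset.sum_add_distrib]

theorem colSum_smul (c : ℂ) (f : ι → κ → ℂ) (j : κ) :
    colSum x ε y γ (c • f) j = c * colSum x ε y γ f j := by
  simp only [colSum, Finset.mul_sum, Pi.smul_apply, smul_eq_mul]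
  exact Finset.sum_congr rfl fun _ _ => by ring

theorem colSum_sub (f g : ι → κ → ℂ) (j : κ) :
    colSum x ε y γ (f - g) j = colSum x ε y γ f j - colSum x ε y γ g j := by
  simp [colSum, mul_sub, Finset.sum_sub_distrib]

theorem colSum_zero (j : κ) : colSum x ε y γ 0 j = 0 := by
  simp [colSum]

variable [Fintype κ]

theorem totSum_sub (f g : ι → κ → ℂ) :
    totSum x ε y η γ (f - g) = totSum x ε y η γ f - totSum x ε y η γ g := by
  simp only [totSum_eq, colSum_sub, mul_sub, Finset.sum_sub_distrib]

theorem totSum_zero : totSum x ε y η γ 0 = 0 := by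
  simp [totSum, rowSum]

theorem totSum_add (f g : ι → κ → ℂ) :
    totSum x ε y η γ (f + g) = totSum x ε y η γ f + totSum x ε y η γ g := by
  simp only [totSum_eq, colSum_add, mul_add, Finset.sum_add_distrib]

theorem totSum_smul (c : ℂ) (f : ι → κ → ℂ) :
    totSum x ε y η γ (c • f) = c * totSum x ε y η γ f := by
  simp only [totSum_eq, colSum_smul, Finset.mul_sum]
  exact Finset.sum_congr rfl fun _ _ => by ring

variable {x ε y η} {a b : ℂ}

theorem sum_mul_add_mul (h1 : ∑ i, ε i = 1) (ha : ∑ i, ε i * x i = a) (c d : ℂ) :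
    ∑ i, ε i * ((x i + c) * d) = (a + c) * d := by
  simp_rw [← mul_assoc, mul_add, ← Finset.sum_mul, Finset.sum_add_distrib, ← Finset.sum_mul,
    h1, ha, one_mul]

/-- These rules reduce both sides of the step identities to the same few sums. The quantities totSum
(A_03 f) and totSum (A_12 f) have no closed form and stay as unknowns. -/
theorem colSum_gridRes_01 (h1 : ∑ i, ε i = 1) (ha : ∑ i, ε i * x i = a) (f : ι → κ → ℂ) (j : κ) :
    colSum x ε y γ (gridRes x ε y η γ 0 1 f) j = -(a + y j + γ) * totSum x ε y η γ f := by
  simp only [colSum, gridRes_01, add_assoc, sum_mul_add_mul h1 ha]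
  ring

theorem colSum_gridRes_02 (h1 : ∑ i, ε i = 1) (ha : ∑ i, ε i * x i = a) (f : ι → κ → ℂ) (j : κ) :
    colSum x ε y γ (gridRes x ε y η γ 0 2 f) j
      = (a + y j + γ) * (totSum x ε y η γ f - colSum x ε y γ f j) := by
  rw [colSum]
  simp only [gridRes_02, add_assoc, sum_mul_add_mul h1 ha]

theorem colSum_gridRes_12 (f : ι → κ → ℂ) (j : κ) :
    colSum x ε y γ (gridRes x ε y η γ 1 2 f) j = y j * colSum x ε y γ f j := by
  simp only [colSum, gridRes_12, Finset.mul_sum]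
  exact Finset.sum_congr rfl fun _ _ => by ring

theorem totSum_gridRes_03 (f : ι → κ → ℂ) :
    totSum x ε y η γ (gridRes x ε y η γ 0 3 f) = ∑ i, ε i * x i * rowSum x y η γ f i := by
  simp only [totSum, rowSum, gridRes_03, Finset.mul_sum]
  exact Finset.sum_congr rfl fun _ _ => Finset.sum_congr rfl fun _ _ => by ring

theorem colSum_gridRes_13 (h1 : ∑ i, ε i = 1) (ha : ∑ i, ε i * x i = a) (f : ι → κ → ℂ) (j : κ) :
    colSum x ε y γ (gridRes x ε y η γ 1 3 f) j
      = a * totSum x ε y η γ f - totSum x ε y η γ (gridRes x ε y η γ 0 3 f) := by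
  rw [colSum, totSum_gridRes_03]
  simp only [gridRes_13]
  have : ∀ i, ε i * ((x i + y j + γ) * (totSum x ε y η γ f - rowSum x y η γ f i))
      = ε i * ((x i + (y j + γ)) * totSum x ε y η γ f) - ε i * x i * rowSum x y η γ f i
        - (y j + γ) * (ε i * rowSum x y η γ f i) := fun i => by ring
  simp_rw [this, Finset.sum_sub_distrib, sum_mul_add_mul h1 ha]
  rw [← Finset.mul_sum, show ∑ i, ε i * rowSum x y η γ f i = totSum x ε y η γ f from rfl]
  ring

theorem totSum_gridRes_01 (h1 : ∑ i, ε i = 1) (ha : ∑ i, ε i * x i = a) (h1' : ∑ j, η j = 1)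
    (hb : ∑ j, η j * y j = b) (f : ι → κ → ℂ) :
    totSum x ε y η γ (gridRes x ε y η γ 0 1 f) = -(a + b + γ) * totSum x ε y η γ f := by
  rw [totSum_eq]
  simp_rw [colSum_gridRes_01 γ h1 ha]
  rw [show -(a + b + γ) * totSum x ε y η γ f = (b + (a + γ)) * -totSum x ε y η γ f by ring,
    ← sum_mul_add_mul h1' hb]
  exact Finset.sum_congr rfl fun _ _ => by ring

theorem totSum_gridRes_02 (h1 : ∑ i, ε i = 1) (ha : ∑ i, ε i * x i = a) (h1' : ∑ j, η j = 1)
    (hb : ∑ j, η j * y j = b) (f : ι → κ → ℂ) :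
    totSum x ε y η γ (gridRes x ε y η γ 0 2 f)
      = b * totSum x ε y η γ f - totSum x ε y η γ (gridRes x ε y η γ 1 2 f) := by
  rw [totSum_eq _ _ _ _ _ (gridRes x ε y η γ 0 2 f), totSum_eq _ _ _ _ _ (gridRes x ε y η γ 1 2 f)]
  simp_rw [colSum_gridRes_02 γ h1 ha, colSum_gridRes_12]
  have : ∀ j, η j * ((a + y j + γ) * (totSum x ε y η γ f - colSum x ε y γ f j))
      = η j * ((y j + (a + γ)) * totSum x ε y η γ f) - η j * (y j * colSum x ε y γ f j)
        - (a + γ) * (η j * colSum x ε y γ f j) := fun i => by ring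
  simp_rw [this, Finset.sum_sub_distrib, sum_mul_add_mul h1' hb, ← Finset.mul_sum]
  rw [← totSum_eq]
  ring

theorem totSum_gridRes_13 (h1 : ∑ i, ε i = 1) (ha : ∑ i, ε i * x i = a) (h1' : ∑ j, η j = 1)
    (f : ι → κ → ℂ) :
    totSum x ε y η γ (gridRes x ε y η γ 1 3 f)
      = a * totSum x ε y η γ f - totSum x ε y η γ (gridRes x ε y η γ 0 3 f) := by
  rw [totSum_eq]
  simp_rw [colSum_gridRes_13 γ h1 ha, ← Finset.sum_mul, h1', one_mul]

end GridCalculus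

/-! ### One middle convolution step on the grid -/

section StepGrid

variable {m n : ℕ} (x ε : Fin (m + 1) → ℂ) (y η : Fin (n + 1) → ℂ) (γ lam tau : ℂ)

/-- The exponents after one step. -/
def stepNodes : Fin (m + 2) → ℂ := Fin.cons tau x

/-- The weights after one step. -/
def stepWeights : Fin (m + 2) → ℂ :=
  Fin.cons ((tau + lam) * ∑ k, ε k / (tau - x k)) fun k => ε k * (x k + lam) / (x k - tau)

/-- The part of `stepMap` that does not depend on the first index. -/
def stepBase (f g : Fin (m + 1) → Fin (n + 1) → ℂ) (j : Fin (n + 1)) : ℂ :=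
  -totSum x ε y η γ f + (totSum x ε y η γ g - colSum x ε y γ g j)

/-- The map from triples of functions on the old grid to functions on the new one whose kernel
is the subspace `𝓛` of the middle convolution. -/
def stepMap (f g h : Fin (m + 1) → Fin (n + 1) → ℂ) : Fin (m + 2) → Fin (n + 1) → ℂ :=
  Fin.cons (stepBase x ε y η γ f g) fun i j => stepBase x ε y η γ f g j + (x i - tau) * h i j

variable {x ε y η γ lam tau} {a b : ℂ}

/-- The factor x_i - τ in `stepMap` cancels the denominator of the new weight and leaves x_i + λ.
The constant part d only sees the mean of the new nodes, which is a + λ + τ. -/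
theorem sum_stepWeights_mul (hτ : ∀ i, x i ≠ tau) (h1 : ∑ i, ε i = 1)
    (ha : ∑ i, ε i * x i = a) (c d : ℂ) (h : Fin (m + 1) → ℂ) :
    stepWeights x ε lam tau 0 * ((tau + c) * d) + ∑ i, stepWeights x ε lam tau i.succ
        * ((x i + c) * (d + (x i - tau) * h i))
      = (a + lam + tau + c) * d + ∑ i, ε i * ((x i + c) * ((x i + lam) * h i)) := by
  rw [show (a + lam + tau + c) * d = (a + (lam + tau + c)) * d by ring,
    ← sum_mul_add_mul h1 ha, ← Finset.sum_add_distrib]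
  simp only [stepWeights, Fin.cons_zero, Fin.cons_succ]
  rw [Finset.mul_sum, Finset.sum_mul, ← Finset.sum_add_distrib]
  refine Finset.sum_congr rfl fun i _ => ?_
  have h1 := sub_ne_zero.mpr (hτ i)
  have h2 := sub_ne_zero.mpr (hτ i).symm
  field_simp
  ring

variable (f g h : Fin (m + 1) → Fin (n + 1) → ℂ)

theorem colSum_stepMap (hτ : ∀ i, x i ≠ tau) (h1 : ∑ i, ε i = 1)
    (ha : ∑ i, ε i * x i = a) (j : Fin (n + 1)) :
    colSum (stepNodes x tau) (stepWeights x ε lam tau) y γ (stepMap x ε y η γ tau f g h) j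
      = (a + lam + tau + y j + γ) * stepBase x ε y η γ f g j
        + colSum x ε y γ (gridRes x ε y η γ 0 3 h) j + lam * colSum x ε y γ h j := by
  have := sum_stepWeights_mul (lam := lam) hτ h1 ha (y j + γ) (stepBase x ε y η γ f g j)
    fun i => h i j
  rw [colSum, Fin.sum_univ_succ]
  simp only [stepMap, stepNodes, Fin.cons_zero, Fin.cons_succ, add_assoc] at this ⊢
  rw [this]
  congr 1
  simp only [colSum, gridRes_03, Finset.mul_sum]
  rw [← Finset.sum_add_distrib]
  exact Finset.sum_congr rfl fun _ _ => by ring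

theorem sum_stepBase (h1' : ∑ j, η j = 1) :
    ∑ j, η j * stepBase x ε y η γ f g j = -totSum x ε y η γ f := by
  simp only [stepBase, mul_add, mul_sub, Finset.sum_add_distrib, Finset.sum_sub_distrib,
    ← totSum_eq, ← Finset.sum_mul, h1']
  ring

theorem sum_mul_stepBase (hb : ∑ j, η j * y j = b) :
    ∑ j, η j * (y j * stepBase x ε y η γ f g j)
      = b * (totSum x ε y η γ g - totSum x ε y η γ f)
        - totSum x ε y η γ (gridRes x ε y η γ 1 2 g) := by
  rw [totSum_eq _ _ _ _ _ (gridRes x ε y η γ 1 2 g)]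
  simp_rw [colSum_gridRes_12, stepBase, ← hb, Finset.sum_mul]
  rw [← Finset.sum_sub_distrib]
  exact Finset.sum_congr rfl fun _ _ => by ring

theorem rowSum_stepMap (h1' : ∑ j, η j = 1) (hb : ∑ j, η j * y j = b) (i : Fin (m + 2)) :
    rowSum (stepNodes x tau) y η γ (stepMap x ε y η γ tau f g h) i
      = -(stepNodes x tau i + γ) * totSum x ε y η γ f
        + (b * (totSum x ε y η γ g - totSum x ε y η γ f)
          - totSum x ε y η γ (gridRes x ε y η γ 1 2 g))
        + (Fin.cons 0 fun i => (x i - tau) * rowSum x y η γ h i : Fin (m + 2) → ℂ) i := by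
  have key : ∀ c, ∑ j, η j * ((c + y j + γ) * stepBase x ε y η γ f g j)
      = -(c + γ) * totSum x ε y η γ f + (b * (totSum x ε y η γ g - totSum x ε y η γ f)
          - totSum x ε y η γ (gridRes x ε y η γ 1 2 g)) := by
    intro c
    rw [← sum_mul_stepBase f g hb, neg_mul, ← mul_neg, ← sum_stepBase f g h1', Finset.mul_sum,
      ← Finset.sum_add_distrib]
    exact Finset.sum_congr rfl fun _ _ => by ring
  refine Fin.cases ?_ (fun i => ?_) i
  · rw [rowSum]
    simp only [stepMap, stepNodes, Fin.cons_zero, key, add_zero]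
  · rw [rowSum]
    simp only [stepMap, stepNodes, Fin.cons_succ]
    have : ∀ j, η j * ((x i + y j + γ) * (stepBase x ε y η γ f g j + (x i - tau) * h i j))
        = η j * ((x i + y j + γ) * stepBase x ε y η γ f g j)
          + (x i - tau) * (η j * ((x i + y j + γ) * h i j)) := fun j => by ring
    simp_rw [this, Finset.sum_add_distrib, key, ← Finset.mul_sum]
    rfl

theorem totSum_stepMap (hτ : ∀ i, x i ≠ tau) (h1 : ∑ i, ε i = 1)
    (ha : ∑ i, ε i * x i = a) (h1' : ∑ j, η j = 1) (hb : ∑ j, η j * y j = b) :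
    totSum (stepNodes x tau) (stepWeights x ε lam tau) y η γ (stepMap x ε y η γ tau f g h)
      = -(a + lam + tau + γ) * totSum x ε y η γ f
        + (b * (totSum x ε y η γ g - totSum x ε y η γ f)
          - totSum x ε y η γ (gridRes x ε y η γ 1 2 g))
        + totSum x ε y η γ (gridRes x ε y η γ 0 3 h) + lam * totSum x ε y η γ h := by
  rw [totSum_eq]
  simp_rw [colSum_stepMap f g h hτ h1 ha]
  rw [← sum_mul_stepBase f g hb, neg_mul, ← mul_neg, ← sum_stepBase f g h1', Finset.mul_sum,
    totSum_eq _ _ _ _ _ h, totSum_eq _ _ _ _ _ (gridRes x ε y η γ 0 3 h), Finset.mul_sum,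
    ← Finset.sum_add_distrib, ← Finset.sum_add_distrib, ← Finset.sum_add_distrib]
  exact Finset.sum_congr rfl fun _ _ => by ring

/-- The arguments on the left are the block rows of Ã_01 applied to (f, g, h), and similarly in the
next four lemmas. Ã_23 needs no computation of its own, as the six matrices sum to zero on both
sides. -/
theorem stepMap_01 (hτ : ∀ i, x i ≠ tau) (h1 : ∑ i, ε i = 1)
    (ha : ∑ i, ε i * x i = a) (h1' : ∑ j, η j = 1) (hb : ∑ j, η j * y j = b) :
    stepMap x ε y η γ tau
      (gridRes x ε y η γ 0 1 f - (tau + lam) • f + gridRes x ε y η γ 0 2 g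
        + (gridRes x ε y η γ 0 3 h + lam • h))
      0 0
      = gridRes (stepNodes x tau) (stepWeights x ε lam tau) y η γ 0 1
        (stepMap x ε y η γ tau f g h) := by
  ext i j
  rw [gridRes_01, totSum_stepMap f g h hτ h1 ha h1' hb]
  refine Fin.cases ?_ (fun i => ?_) i <;>
    simp only [stepMap, Fin.cons_zero, Fin.cons_succ, stepBase, totSum_add, totSum_sub,
      totSum_smul, totSum_zero, colSum_zero, totSum_gridRes_01 γ h1 ha h1' hb,
      totSum_gridRes_02 γ h1 ha h1' hb, Pi.zero_apply] <;>
    ring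

theorem stepMap_02 (hτ : ∀ i, x i ≠ tau) (h1 : ∑ i, ε i = 1)
    (ha : ∑ i, ε i * x i = a) (h1' : ∑ j, η j = 1) (hb : ∑ j, η j * y j = b) :
    stepMap x ε y η γ tau 0
      (gridRes x ε y η γ 0 1 f + (gridRes x ε y η γ 0 2 g - (tau + lam) • g)
        + (gridRes x ε y η γ 0 3 h + lam • h))
      0
      = gridRes (stepNodes x tau) (stepWeights x ε lam tau) y η γ 0 2
        (stepMap x ε y η γ tau f g h) := by
  ext i j
  rw [gridRes_02, totSum_stepMap f g h hτ h1 ha h1' hb, colSum_stepMap f g h hτ h1 ha]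
  refine Fin.cases ?_ (fun i => ?_) i <;>
    simp only [stepMap, Fin.cons_zero, Fin.cons_succ, stepBase, totSum_add, totSum_sub,
      totSum_smul, totSum_zero, colSum_add, colSum_sub, colSum_smul,
      totSum_gridRes_01 γ h1 ha h1' hb, totSum_gridRes_02 γ h1 ha h1' hb,
      colSum_gridRes_01 γ h1 ha, colSum_gridRes_02 γ h1 ha, Pi.zero_apply] <;>
    ring

theorem stepMap_03 :
    stepMap x ε y η γ tau
      (tau • f) (tau • g)
      (gridRes x ε y η γ 0 1 f + gridRes x ε y η γ 0 2 g + gridRes x ε y η γ 0 3 h)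
      = gridRes (stepNodes x tau) (stepWeights x ε lam tau) y η γ 0 3
        (stepMap x ε y η γ tau f g h) := by
  ext i j
  rw [gridRes_03]
  refine Fin.cases ?_ (fun i => ?_) i <;>
    simp only [stepMap, stepNodes, Fin.cons_zero, Fin.cons_succ, stepBase, totSum_smul,
      colSum_smul, Pi.add_apply, gridRes_01, gridRes_02, gridRes_03] <;>
    ring

theorem stepMap_12 (h1 : ∑ i, ε i = 1)
    (ha : ∑ i, ε i * x i = a) (h1' : ∑ j, η j = 1) (hb : ∑ j, η j * y j = b) :
    stepMap x ε y η γ tau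
      (gridRes x ε y η γ 1 2 f + gridRes x ε y η γ 0 2 f - gridRes x ε y η γ 0 2 g)
      (gridRes x ε y η γ 1 2 g + gridRes x ε y η γ 0 1 g - gridRes x ε y η γ 0 1 f)
      (gridRes x ε y η γ 1 2 h)
      = gridRes (stepNodes x tau) (stepWeights x ε lam tau) y η γ 1 2
        (stepMap x ε y η γ tau f g h) := by
  ext i j
  rw [gridRes_12]
  refine Fin.cases ?_ (fun i => ?_) i <;>
    simp only [stepMap, Fin.cons_zero, Fin.cons_succ, stepBase, totSum_add, totSum_sub, colSum_add,
      colSum_sub, totSum_gridRes_01 γ h1 ha h1' hb, totSum_gridRes_02 γ h1 ha h1' hb,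
      colSum_gridRes_01 γ h1 ha, colSum_gridRes_12, gridRes_12] <;>
    ring

theorem stepMap_13 (hτ : ∀ i, x i ≠ tau) (h1 : ∑ i, ε i = 1)
    (ha : ∑ i, ε i * x i = a) (h1' : ∑ j, η j = 1) (hb : ∑ j, η j * y j = b) :
    stepMap x ε y η γ tau
      (gridRes x ε y η γ 1 3 f + gridRes x ε y η γ 0 3 f + lam • f
        - (gridRes x ε y η γ 0 3 h + lam • h))
      (gridRes x ε y η γ 1 3 g)
      (gridRes x ε y η γ 0 1 h + gridRes x ε y η γ 1 3 h - gridRes x ε y η γ 0 1 f)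
      = gridRes (stepNodes x tau) (stepWeights x ε lam tau) y η γ 1 3
        (stepMap x ε y η γ tau f g h) := by
  ext i j
  rw [gridRes_13, totSum_stepMap f g h hτ h1 ha h1' hb, rowSum_stepMap f g h h1' hb]
  refine Fin.cases ?_ (fun i => ?_) i <;>
    simp only [stepMap, stepNodes, Fin.cons_zero, Fin.cons_succ, stepBase, totSum_add, totSum_sub,
      totSum_smul, totSum_gridRes_13 γ h1 ha h1', colSum_gridRes_13 γ h1 ha, Pi.add_apply,
      Pi.sub_apply, gridRes_01, gridRes_13] <;>
    ring

end StepGrid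

/-! ### Passing to the quotient by 𝓛 -/

theorem induced_mk {W : Type} [AddCommGroup W] [Module ℂ W] {L : Submodule ℂ W}
    {f : Module.End ℂ W} (h : L ≤ L.comap f) (w : W) :
    induced L f (Submodule.Quotient.mk w) = Submodule.Quotient.mk (f w) := by
  rw [induced, dif_pos h, Submodule.mapQ_apply]

/-- The first isomorphism theorem. A kernel of an intertwining map is invariant, so `induced` never
takes its default value 0 here. -/
theorem Represents.stepX_of_surjective {ι κ : Type} [Fintype ι] [Fintype κ] {S : KZ}
    {lam tau : ℂ} {x ε : ι → ℂ} {y η : κ → ℂ} {γ : ℂ} (Ψ : (Fin 3 → S.V) →ₗ[ℂ] (ι → κ → ℂ))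
    (hsurj : Function.Surjective Ψ) (hker : LinearMap.ker Ψ = S.convKer lam tau)
    (hint : ∀ i j v, Ψ (S.convRes lam tau i j v) = gridRes x ε y η γ i j (Ψ v)) :
    Represents (S.stepX lam tau) x ε y η γ := by
  refine ⟨(Submodule.quotEquivOfEq _ _ hker.symm).trans (Ψ.quotKerEquivOfSurjective hsurj),
    fun i j v => ?_⟩
  have hinv : S.convKer lam tau ≤ (S.convKer lam tau).comap (S.convRes lam tau i j) := by
    intro w hw
    rw [← hker, LinearMap.mem_ker] at hw
    rw [Submodule.mem_comap, ← hker, LinearMap.mem_ker, hint, hw, map_zero]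
  obtain ⟨w, rfl⟩ := Submodule.Quotient.mk_surjective _ v
  have h1 : (S.stepX lam tau).A i j (Submodule.Quotient.mk w)
      = (Submodule.Quotient.mk (S.convRes lam tau i j w) : _ ⧸ S.convKer lam tau) :=
    induced_mk hinv w
  have h2 : ∀ w, ((Submodule.quotEquivOfEq _ _ hker.symm).trans
      (Ψ.quotKerEquivOfSurjective hsurj)) (Submodule.Quotient.mk w : _ ⧸ S.convKer lam tau)
        = Ψ w := fun w => rfl
  exact (congrArg _ h1).trans ((h2 _).trans (hint i j w))

section Step

variable {m n : ℕ} {x ε : Fin (m + 1) → ℂ} {y η : Fin (n + 1) → ℂ} {γ lam tau : ℂ} {S : KZ}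

/-- `stepMap` as a linear map on triples of elements of `S.V`. -/
def stepLinear (x ε : Fin (m + 1) → ℂ) (y η : Fin (n + 1) → ℂ) (γ tau : ℂ)
    (e : S.V ≃ₗ[ℂ] (Fin (m + 1) → Fin (n + 1) → ℂ)) :
    (Fin 3 → S.V) →ₗ[ℂ] (Fin (m + 2) → Fin (n + 1) → ℂ) where
  toFun v := stepMap x ε y η γ tau (e (v 0)) (e (v 1)) (e (v 2))
  map_add' v w := by
    ext i j
    refine Fin.cases ?_ (fun i => ?_) i <;>
      simp only [stepMap, stepBase, Pi.add_apply, map_add, totSum_add, colSum_add, Fin.cons_zero,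
        Fin.cons_succ] <;> ring
  map_smul' c v := by
    ext i j
    refine Fin.cases ?_ (fun i => ?_) i <;>
      simp only [stepMap, stepBase, Pi.smul_apply, map_smul, totSum_smul, colSum_smul,
        Fin.cons_zero, Fin.cons_succ, RingHom.id_apply, smul_eq_mul] <;> ring

theorem stepMap_surjective (hτ : ∀ i, x i ≠ tau) (h1 : ∑ i, ε i = 1) (h1' : ∑ j, η j = 1)
    (hd : ∀ i j, x i + y j + γ ≠ 0) (t : Fin (m + 2) → Fin (n + 1) → ℂ) :
    ∃ f g h, stepMap x ε y η γ tau f g h = t := by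
  -- Division by x + y + γ prescribes the sums freely: f gets the total sum -∑ η t_0, and g the
  -- column sums -t_0. The two averages cancel in `stepBase`, leaving t_0, and h then corrects the
  -- other rows.
  have hr : rowSum x y η γ (fun i j => -(∑ k, η k * t 0 k) * (x i + y j + γ)⁻¹)
      = fun _ => -∑ k, η k * t 0 k := by
    ext i
    rw [rowSum]
    have : ∀ j, η j * ((x i + y j + γ) * (-(∑ k, η k * t 0 k) * (x i + y j + γ)⁻¹))
        = η j * -∑ k, η k * t 0 k := fun j => by
      linear_combination (-η j * ∑ k, η k * t 0 k) * mul_inv_cancel₀ (hd i j)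
    simp_rw [this, ← Finset.sum_mul, h1', one_mul]
  have hc : colSum x ε y γ (fun i j => -t 0 j * (x i + y j + γ)⁻¹) = fun j => -t 0 j := by
    ext j
    rw [colSum]
    have : ∀ i, ε i * ((x i + y j + γ) * (-t 0 j * (x i + y j + γ)⁻¹)) = ε i * -t 0 j :=
      fun i => by linear_combination (-ε i * t 0 j) * mul_inv_cancel₀ (hd i j)
    simp_rw [this, ← Finset.sum_mul, h1, one_mul]
  have hb : ∀ j, stepBase x ε y η γ (fun i j => -(∑ k, η k * t 0 k) * (x i + y j + γ)⁻¹)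
      (fun i j => -t 0 j * (x i + y j + γ)⁻¹) j = t 0 j := by
    intro j
    rw [stepBase, totSum, hr, totSum_eq, hc, ← Finset.sum_mul, h1]
    simp only [mul_neg, Finset.sum_neg_distrib]
    ring
  refine ⟨fun i j => -(∑ k, η k * t 0 k) * (x i + y j + γ)⁻¹,
    fun i j => -t 0 j * (x i + y j + γ)⁻¹, fun i j => (t i.succ j - t 0 j) * (x i - tau)⁻¹, ?_⟩
  ext i j
  refine Fin.cases ?_ (fun i => ?_) i
  · simp only [stepMap, Fin.cons_zero]
    exact hb j
  · simp only [stepMap, Fin.cons_succ]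
    rw [hb]
    linear_combination (t i.succ j - t 0 j) * mul_inv_cancel₀ (sub_ne_zero.mpr (hτ i))

/-- Averaging `stepBase` over j isolates the total sum of f; once this vanishes, the rest of
`stepBase` is A_02 g. Both h = 0 and (A_03 + λ) h = 0 say the same, because x_i - τ and x_i + λ
never vanish. -/
theorem stepMap_eq_zero_iff (hτ : ∀ i, x i ≠ tau) (hl : ∀ i, x i + lam ≠ 0)
    (h1' : ∑ j, η j = 1) (f g h : Fin (m + 1) → Fin (n + 1) → ℂ) :
    stepMap x ε y η γ tau f g h = 0 ↔ gridRes x ε y η γ 0 1 f = 0 ∧ gridRes x ε y η γ 0 2 g = 0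
      ∧ gridRes x ε y η γ 0 3 h + lam • h = 0 := by
  constructor
  · intro h0
    have hb : ∀ j, stepBase x ε y η γ f g j = 0 := fun j => congrFun (congrFun h0 0) j
    have ht : totSum x ε y η γ f = 0 := by
      have := sum_stepBase (x := x) (ε := ε) (y := y) (η := η) (γ := γ) f g h1'
      simp only [hb, mul_zero, Finset.sum_const_zero] at this
      linear_combination this
    refine ⟨?_, ?_, ?_⟩
    · ext i j
      rw [gridRes_01, ht, neg_zero]; rfl
    · ext i j
      have := hb j
      rw [stepBase, ht, neg_zero, zero_add] at this
      rw [gridRes_02, this]; rfl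
    · have : h = 0 := by
        ext i j
        have := congrFun (congrFun h0 i.succ) j
        simp only [stepMap, Fin.cons_succ, hb, zero_add, Pi.zero_apply] at this
        exact (mul_eq_zero.mp this).resolve_left (sub_ne_zero.mpr (hτ i))
      rw [this, map_zero, smul_zero, add_zero]
  · rintro ⟨hf, hg, hh⟩
    have hb : ∀ j, stepBase x ε y η γ f g j = 0 := fun j => by
      have e1 := congrFun (congrFun hf 0) j
      have e2 := congrFun (congrFun hg 0) j
      rw [gridRes_01, Pi.zero_apply, Pi.zero_apply] at e1
      rw [gridRes_02, Pi.zero_apply, Pi.zero_apply] at e2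
      rw [stepBase, e1, e2, add_zero]
    ext i j
    refine Fin.cases (hb j) (fun i => ?_) i
    have e3 := congrFun (congrFun hh i) j
    simp only [Pi.add_apply, Pi.smul_apply, gridRes_03, smul_eq_mul, Pi.zero_apply,
      ← add_mul] at e3
    simp only [stepMap, Fin.cons_succ, hb, (mul_eq_zero.mp e3).resolve_left (hl i)]
    simp

/-- `-tau` is not an eigenvalue of `A₀₄`. -/
theorem eq_zero_of_gridRes_04 (hτ : ∀ i, x i ≠ tau) (h1 : ∑ i, ε i = 1)
    (hs : ∑ i, ε i / (x i + -tau) ≠ 0) (ht : ∀ j, tau + y j + γ ≠ 0)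
    {f : Fin (m + 1) → Fin (n + 1) → ℂ} (hf : gridRes x ε y η γ 0 4 f + tau • f = 0) : f = 0 := by
  have hτ' : ∀ i, x i + -tau ≠ 0 := fun i h0 => hτ i (by linear_combination h0)
  have h0 : ∀ i j, (x i + -tau) * f i j = colSum x ε y γ f j := fun i j => by
    have := congrFun (congrFun hf i) j
    simp only [Pi.add_apply, gridRes_04, Pi.smul_apply, smul_eq_mul, Pi.zero_apply] at this
    linear_combination -this
  have hc : ∀ j, colSum x ε y γ f j = 0 := by
    intro j
    -- With C the column sum, f = C/(x - τ). Writing x + y + γ = (x - τ) + (τ + y + γ) and summing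
    -- gives C = C + (τ + y + γ) C ∑ ε/(x - τ), hence C = 0.
    have e : ∀ i, ε i * ((x i + y j + γ) * f i j)
        = ε i * colSum x ε y γ f j
          + (tau + y j + γ) * colSum x ε y γ f j * (ε i / (x i + -tau)) := fun i => by
      rw [← h0 i j]
      have := hτ' i
      field_simp
      ring
    have := Finset.sum_congr rfl fun i (_ : i ∈ Finset.univ) => e i
    rw [← colSum, Finset.sum_add_distrib, ← Finset.sum_mul, h1, one_mul, ← Finset.mul_sum,
      left_eq_add] at this
    exact (mul_eq_zero.mp ((mul_eq_zero.mp this).resolve_right hs)).resolve_left (ht j)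
  ext i j
  have := h0 i j
  rw [hc] at this
  exact (mul_eq_zero.mp this).resolve_left (hτ' i)

/-- The second summand of 𝓛 is zero. Each of the three rows of (Ã_04 + τ) v = 0 reads (λ + τ) v_i =
s with the same s, so the components of v coincide and their common value is an eigenvector of A_04
for -τ, hence zero. -/
theorem convKer_eq (e : S.V ≃ₗ[ℂ] (Fin (m + 1) → Fin (n + 1) → ℂ))
    (he : ∀ i j v, e (S.A i j v) = gridRes x ε y η γ i j (e v))
    (hτ : ∀ i, x i ≠ tau) (h1 : ∑ i, ε i = 1) (hlt : lam + tau ≠ 0)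
    (hs : ∑ i, ε i / (x i + -tau) ≠ 0) (ht : ∀ j, tau + y j + γ ≠ 0) :
    S.convKer lam tau = Submodule.pi Set.univ
      ![LinearMap.ker (S.A 0 1), LinearMap.ker (S.A 0 2), LinearMap.ker (S.A 0 3 + lam • 1)] := by
  rw [KZ.convKer, sup_eq_left]
  refine le_of_eq_of_le ?_ bot_le
  rw [LinearMap.ker_eq_bot']
  intro v hv
  set s := S.A 0 1 (v 0) + S.A 0 2 (v 1) + S.A 0 3 (v 2) + lam • v 2 with hsdef
  have h0 : ∀ i, (lam + tau) • v i = s := by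
    intro i
    have := congrFun hv i
    fin_cases i <;>
    · simp [KZ.convRes, residues, blockEnd, Fin.sum_univ_three] at this
      rw [hsdef, ← sub_eq_zero, ← this]
      simp only [Fin.zero_eta, Fin.mk_one, Fin.reduceFinMk, Fin.isValue]
      module
  have h01 : v 0 = v 2 := smul_right_injective _ hlt ((h0 0).trans (h0 2).symm)
  have h12 : v 1 = v 2 := smul_right_injective _ hlt ((h0 1).trans (h0 2).symm)
  have h2 := h0 2
  rw [hsdef, h01, h12] at h2
  have : v 2 = 0 := by
    refine e.injective ?_
    rw [map_zero]
    refine eq_zero_of_gridRes_04 hτ h1 hs ht (η := η) ?_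
    have := congrArg e h2
    simp only [map_add, map_smul, he] at this
    ext i j
    have := congrFun (congrFun this i) j
    simp only [Pi.add_apply, Pi.smul_apply, smul_eq_mul, gridRes_01, gridRes_02, gridRes_03,
      gridRes_04, Pi.zero_apply] at this ⊢
    linear_combination this
  funext i
  fin_cases i
  · exact h01.trans this
  · exact h12.trans this
  · exact this

theorem convRes_23 (hS : S.A 0 1 + S.A 0 2 + S.A 0 3 + S.A 1 2 + S.A 1 3 + S.A 2 3 = 0)
    (v : Fin 3 → S.V) :
    S.convRes lam tau 2 3 v = -(S.convRes lam tau 0 1 v + S.convRes lam tau 0 2 v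
      + S.convRes lam tau 0 3 v + S.convRes lam tau 1 2 v + S.convRes lam tau 1 3 v) := by
  have h23 : S.A 2 3 = -(S.A 0 1 + S.A 0 2 + S.A 0 3 + S.A 1 2 + S.A 1 3) :=
    eq_neg_of_add_eq_zero_right hS
  funext i
  fin_cases i <;>
  · simp [KZ.convRes, residues, blockEnd, Fin.sum_univ_three, h23]
    module

theorem Represents.stepX (hS : Represents S x ε y η γ) (hτ : ∀ i, x i ≠ tau)
    (hl : ∀ i, x i + lam ≠ 0) (hlt : lam + tau ≠ 0) (h1 : ∑ i, ε i = 1) (h1' : ∑ j, η j = 1)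
    (hs : ∑ i, ε i / (x i + -tau) ≠ 0) (ht : ∀ j, tau + y j + γ ≠ 0)
    (hd : ∀ i j, x i + y j + γ ≠ 0) :
    Represents (S.stepX lam tau) (stepNodes x tau) (stepWeights x ε lam tau) y η γ := by
  have hsum := hS.sum_eq_zero
  obtain ⟨e, he⟩ := hS
  refine Represents.stepX_of_surjective (stepLinear x ε y η γ tau e) (fun t => ?_) ?_ ?_
  · obtain ⟨f, g, h, rfl⟩ := stepMap_surjective hτ h1 h1' hd t
    refine ⟨![e.symm f, e.symm g, e.symm h], ?_⟩
    change stepMap x ε y η γ tau (e (e.symm f)) (e (e.symm g)) (e (e.symm h)) = _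
    simp only [LinearEquiv.apply_symm_apply]
  · rw [convKer_eq e he hτ h1 hlt hs ht]
    ext v
    rw [LinearMap.mem_ker]
    change stepMap x ε y η γ tau (e (v 0)) (e (v 1)) (e (v 2)) = 0 ↔ _
    rw [stepMap_eq_zero_iff hτ hl h1', ← he, ← he, ← he, ← map_smul, ← map_add,
      e.map_eq_zero_iff, e.map_eq_zero_iff, e.map_eq_zero_iff, Submodule.mem_pi]
    constructor
    · rintro ⟨h0, h1, h2⟩ i -
      fin_cases i
      · exact h0
      · exact h1
      · exact h2
    · intro h
      exact ⟨h 0 trivial, h 1 trivial, h 2 trivial⟩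
  · have g01 : ∀ v, stepLinear x ε y η γ tau e (S.convRes lam tau 0 1 v)
        = gridRes (stepNodes x tau) (stepWeights x ε lam tau) y η γ 0 1
          (stepLinear x ε y η γ tau e v) := fun v => by
      refine Eq.trans ?_ (stepMap_01 _ _ _ hτ h1 rfl h1' rfl)
      simp [stepLinear, KZ.convRes, residues, blockEnd, Fin.sum_univ_three, he]
    have g02 : ∀ v, stepLinear x ε y η γ tau e (S.convRes lam tau 0 2 v)
        = gridRes (stepNodes x tau) (stepWeights x ε lam tau) y η γ 0 2
          (stepLinear x ε y η γ tau e v) := fun v => by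
      refine Eq.trans ?_ (stepMap_02 _ _ _ hτ h1 rfl h1' rfl)
      simp [stepLinear, KZ.convRes, residues, blockEnd, Fin.sum_univ_three, he]
    have g03 : ∀ v, stepLinear x ε y η γ tau e (S.convRes lam tau 0 3 v)
        = gridRes (stepNodes x tau) (stepWeights x ε lam tau) y η γ 0 3
          (stepLinear x ε y η γ tau e v) := fun v => by
      refine Eq.trans ?_ (stepMap_03 _ _ _)
      simp [stepLinear, KZ.convRes, residues, blockEnd, Fin.sum_univ_three, he]
    have g12 : ∀ v, stepLinear x ε y η γ tau e (S.convRes lam tau 1 2 v)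
        = gridRes (stepNodes x tau) (stepWeights x ε lam tau) y η γ 1 2
          (stepLinear x ε y η γ tau e v) := fun v => by
      refine Eq.trans ?_ (stepMap_12 _ _ _ h1 rfl h1' rfl)
      simp only [stepLinear, LinearMap.coe_mk, AddHom.coe_mk]
      congr 1 <;>
        simp [KZ.convRes, residues, blockEnd, Fin.sum_univ_three, he] <;> abel
    have g13 : ∀ v, stepLinear x ε y η γ tau e (S.convRes lam tau 1 3 v)
        = gridRes (stepNodes x tau) (stepWeights x ε lam tau) y η γ 1 3
          (stepLinear x ε y η γ tau e v) := fun v => by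
      refine Eq.trans ?_ (stepMap_13 _ _ _ hτ h1 rfl h1' rfl)
      simp only [stepLinear, LinearMap.coe_mk, AddHom.coe_mk]
      congr 1 <;>
        simp [KZ.convRes, residues, blockEnd, Fin.sum_univ_three, he] <;> abel
    refine residues_intertwine _ g01 g02 g03 g12 g13 fun v => ?_
    refine Eq.trans (congrArg _ (convRes_23 (tau := tau) hsum v)) ?_
    simp only [map_neg, map_add, g01, g02, g03, g12, g13]
    ext i j
    simp only [Pi.neg_apply, Pi.add_apply, gridRes_01, gridRes_02, gridRes_03, gridRes_12,
      gridRes_13]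
    refine Eq.trans ?_ (gridRes_23 _ _ _ _ _ _ i j).symm
    ring

end Step

/-! ### Iterating the steps from the rank one equation -/

/-- The fold applies the first parameters last, so the induction runs over tails and prepends a node
at each step, in agreement with the recursion of `weights`. It starts from the single node α'_p. -/
theorem represents_foldr_stepX {κ : ℕ} {y η : Fin (κ + 1) → ℂ} {γ : ℂ} (hη : ∑ j, η j = 1) :
    ∀ {m : ℕ} (α : Fin m → ℂ) (α' : Fin (m + 1) → ℂ), Function.Injective α' →
      (∀ i i', α i + α' i' ≠ 0) → (∀ i j, α' i + y j + γ ≠ 0) → ∀ S : KZ,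
      Represents S (fun _ : Fin 1 => α' (Fin.last m)) (fun _ => 1) y η γ →
      Represents ((List.ofFn fun i : Fin m => (α i, α' i.castSucc)).foldr
        (fun c S => S.stepX c.1 c.2) S) α' (weights m α α') y η γ
  | 0, α, α', _, _, _, S, hS => by
    rw [List.ofFn_zero, List.foldr_nil]
    have h0 : α' = fun _ : Fin 1 => α' (Fin.last 0) := funext fun i => by
      rw [Fin.eq_zero i]; rfl
    rw [h0]
    exact hS
  | m + 1, α, α', hα', hadd, hd, S, hS => by
    have ht : Function.Injective (Fin.tail α') := fun i j h => Fin.succ_injective _ (hα' h)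
    have ih := represents_foldr_stepX hη (Fin.tail α) (Fin.tail α') ht
      (fun i i' => hadd i.succ i'.succ) (fun i j => hd i.succ j) S hS
    have hw := isWeight_weights (Fin.tail α) (Fin.tail α') ht
    rw [List.ofFn_succ, List.foldr_cons]
    have hne : ∀ i, Fin.tail α' i ≠ α' 0 := fun i h => Fin.succ_ne_zero i (hα' h)
    have := ih.stepX (lam := α 0) (tau := α' 0) hne
      (fun i => by rw [add_comm]; exact hadd 0 i.succ) (hadd 0 0) hw.sum hη
      (hw.sum_div_ne_zero _ (fun i h => hne i (by linear_combination h)) fun r h =>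
        hadd r.succ 0 (by rw [show α r.succ = _ from h]; ring))
      (fun j => hd 0 j) (fun i j => hd i.succ j)
    rw [stepNodes, Fin.cons_self_tail] at this
    exact this

theorem stepY_reindex (S : KZ) (lam tau : ℂ) :
    (S.stepY lam tau).reindex swapXY = (S.reindex swapXY).stepX lam tau :=
  reindex_swapXY_swapXY _

theorem foldr_stepY_reindex (S : KZ) (l : List (ℂ × ℂ)) :
    (l.foldr (fun c S => S.stepY c.1 c.2) S).reindex swapXY
      = l.foldr (fun c S => S.stepX c.1 c.2) (S.reindex swapXY) := by
  induction l with
  | nil => rfl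
  | cons c l ih => rw [List.foldr_cons, stepY_reindex, ih, List.foldr_cons]

theorem represents_kzBase (γ : ℂ) :
    Represents (kzBase γ) (fun _ : Fin 1 => 0) (fun _ => 1) (fun _ : Fin 1 => 0) (fun _ => 1) γ := by
  let e : ℂ ≃ₗ[ℂ] (Fin 1 → Fin 1 → ℂ) :=
    { toFun := fun v _ _ => v
      invFun := fun f => f 0 0
      map_add' := fun _ _ => rfl
      map_smul' := fun _ _ => rfl
      left_inv := fun _ => rfl
      right_inv := fun f => by
        ext i j
        rw [Fin.eq_zero i, Fin.eq_zero j] }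
  refine ⟨e, residues_intertwine e.toLinearMap (fun v => ?_) (fun v => ?_) (fun v => ?_)
    (fun v => ?_) (fun v => ?_) fun v => ?_⟩ <;> ext i j <;>
  simp [e, avgL, avgR, mulFun, gridSum]

theorem represents_kzI {m n : ℕ} {α : Fin m → ℂ} {α' : Fin (m + 1) → ℂ} {β : Fin n → ℂ}
    {β' : Fin (n + 1) → ℂ} {γ : ℂ} (hα' : α' (Fin.last m) = 0) (hβ' : β' (Fin.last n) = 0)
    (hgen : Generic α α' β β' γ) :
    Represents (kzI α α' β β' γ) α' (weights m α α') β' (weights n β β') γ := by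
  refine represents_foldr_stepX (isWeight_weights β β' hgen.inj_β').sum α α' hgen.inj_α'
    hgen.add_α hgen.add_γ _ ?_
  -- After exchanging the variables the y-steps become x-steps, on a grid whose other side is still
  -- the single node 0.
  rw [hα', ← reindex_swapXY_swapXY (List.foldr _ _ _), foldr_stepY_reindex]
  refine (represents_foldr_stepX (by simp) β β' hgen.inj_β' hgen.add_β (fun j i => ?_) _ ?_).reindex
  · have := hgen.add_γ (Fin.last m) j
    rwa [hα', zero_add, ← add_zero (β' j)] at this
  · rw [hβ']
    exact (represents_kzBase γ).reindex

theorem tailSum_zero {m : ℕ} (α : Fin m → ℂ) (α' : Fin (m + 1) → ℂ)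
    (h : α' (Fin.last m) = 0) : tailSum α α' 0 = ∑ i, α i + ∑ i, α' i := by
  simp [tailSum, Fin.sum_univ_castSucc α', h, Finset.sum_add_distrib]

theorem Generic.gridGeneric {m n : ℕ} {α : Fin m → ℂ} {α' : Fin (m + 1) → ℂ} {β : Fin n → ℂ}
    {β' : Fin (n + 1) → ℂ} {γ : ℂ} (hα' : α' (Fin.last m) = 0) (hβ' : β' (Fin.last n) = 0)
    (h : Generic α α' β β' γ) :
    GridGeneric α α' (weights m α α') (∑ i, α i + ∑ i, α' i) β β' (weights n β β')
      (∑ j, β j + ∑ j, β' j) γ where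
  wx := isWeight_weights α α' h.inj_α'
  wy := isWeight_weights β β' h.inj_β'
  px i r := by rw [add_comm]; exact h.add_α r i
  py j s := by rw [add_comm]; exact h.add_β s j
  inj_α := h.inj_α
  inj_β := h.inj_β
  add_γ := h.add_γ
  ne_α r j := h.ne_α r j
  ne_β s i := h.ne_β i s
  ne_γ := h.ne_γ
  tot := by rw [← tailSum_zero α α' hα', ← tailSum_zero β β' hβ']; exact h.tail_α 0
  sum_α r := by rw [← tailSum_zero β β' hβ']; exact h.sum_α r
  sum_β s := by rw [← tailSum_zero α α' hα']; exact h.tail_αβ 0 s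
  sum_x i := by rw [← tailSum_zero β β' hβ']; exact h.sum_α' i
  sum_y j := by rw [← tailSum_zero α α' hα']; exact h.tail_αβ' 0 j

/-! ### Double power series with coefficients of polynomial growth inserted -/

/-- The functions of `k` and `l` of at most polynomial growth. -/
def polyGrowth : Subalgebra ℂ (ℕ → ℕ → ℂ) where
  carrier := {f | ∃ (C : ℝ) (N : ℕ), 0 ≤ C ∧
    ∀ k l : ℕ, ‖f k l‖ ≤ C * (((k : ℝ) + 1) * ((l : ℝ) + 1)) ^ N}
  mul_mem' := by
    rintro f g ⟨C, N, hC, hf⟩ ⟨D, M, hD, hg⟩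
    refine ⟨C * D, N + M, mul_nonneg hC hD, fun k l => ?_⟩
    rw [pow_add, mul_mul_mul_comm]
    simp only [Pi.mul_apply, norm_mul]
    exact mul_le_mul (hf k l) (hg k l) (norm_nonneg _) (by positivity)
  add_mem' := by
    rintro f g ⟨C, N, hC, hf⟩ ⟨D, M, hD, hg⟩
    refine ⟨C + D, N + M, add_nonneg hC hD, fun k l => ?_⟩
    have h1 : (1 : ℝ) ≤ ((k : ℝ) + 1) * ((l : ℝ) + 1) := by
      have : (0 : ℝ) ≤ k := k.cast_nonneg
      have : (0 : ℝ) ≤ l := l.cast_nonneg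
      nlinarith
    refine (norm_add_le _ _).trans ?_
    rw [add_mul]
    refine add_le_add ((hf k l).trans ?_) ((hg k l).trans ?_)
    · exact mul_le_mul_of_nonneg_left (pow_le_pow_right₀ h1 (Nat.le_add_right _ _)) hC
    · exact mul_le_mul_of_nonneg_left (pow_le_pow_right₀ h1 (Nat.le_add_left _ _)) hD
  algebraMap_mem' c := ⟨‖c‖, 0, norm_nonneg _, fun k l => by
    simp [Pi.algebraMap_apply]⟩

theorem const_mem_polyGrowth (c : ℂ) : (fun _ _ => c) ∈ polyGrowth :=
  polyGrowth.algebraMap_mem c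

theorem fst_mem_polyGrowth : (fun (k : ℕ) (_ : ℕ) => (k : ℂ)) ∈ polyGrowth :=
  ⟨1, 1, zero_le_one, fun k l => by
    have : (0 : ℝ) ≤ k := k.cast_nonneg
    have : (0 : ℝ) ≤ l := l.cast_nonneg
    simp only [Complex.norm_natCast, pow_one, one_mul]
    nlinarith⟩

theorem snd_mem_polyGrowth : (fun (_ : ℕ) (l : ℕ) => (l : ℂ)) ∈ polyGrowth :=
  ⟨1, 1, zero_le_one, fun k l => by
    have : (0 : ℝ) ≤ k := k.cast_nonneg
    have : (0 : ℝ) ≤ l := l.cast_nonneg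
    simp only [Complex.norm_natCast, pow_one, one_mul]
    nlinarith⟩

theorem swap_mem_polyGrowth {f : ℕ → ℕ → ℂ} (hf : f ∈ polyGrowth) :
    (fun k l => f l k) ∈ polyGrowth := by
  obtain ⟨C, N, hC, h⟩ := hf
  exact ⟨C, N, hC, fun k l => by rw [mul_comm ((k : ℝ) + 1)]; exact h l k⟩

theorem prod_mem_polyGrowth {ι : Type} [Fintype ι] {f : ι → ℕ → ℕ → ℂ}
    (hf : ∀ i, f i ∈ polyGrowth) : (fun k l => ∏ i, f i k l) ∈ polyGrowth := by
  have := prod_mem (S := polyGrowth) (t := Finset.univ) fun i _ => hf i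
  convert this using 1
  ext k l
  simp [Finset.prod_apply]

theorem prod_sub_mem_polyGrowth {ι : Type} [Fintype ι] (x : ι → ℂ) :
    (fun (k : ℕ) (_ : ℕ) => ∏ i, ((k : ℂ) - x i)) ∈ polyGrowth :=
  prod_mem_polyGrowth fun i => sub_mem fst_mem_polyGrowth (const_mem_polyGrowth (x i))

theorem prod_add_mem_polyGrowth {ι : Type} [Fintype ι] (x : ι → ℂ) :
    (fun (k : ℕ) (_ : ℕ) => ∏ i, ((k : ℂ) + x i)) ∈ polyGrowth :=
  prod_mem_polyGrowth fun i => add_mem fst_mem_polyGrowth (const_mem_polyGrowth (x i))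

theorem cofactor_mem_polyGrowth {m : ℕ} (x : Fin m → ℂ) (i : Fin m) :
    (fun (k : ℕ) (_ : ℕ) => cofactor x k i) ∈ polyGrowth := by
  refine prod_mem_polyGrowth (f := fun j k _ => if j = i then 1 else (k : ℂ) - x j) fun j => ?_
  by_cases h : j = i
  · simp only [h, if_true]
    exact const_mem_polyGrowth 1
  · simp only [h, if_false]
    exact sub_mem fst_mem_polyGrowth (const_mem_polyGrowth (x j))

/-- The coefficients `c` of a double power series are bounded by a geometric sequence, so that
the series converges where the variables are less than `r` in norm. -/
def GeometricBound (c : ℕ → ℕ → ℂ) (r : ℝ) : Prop :=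
  ∃ (C : ℝ) (q : ℝ), 0 ≤ C ∧ 0 < q ∧ q < 1 ∧ ∀ k l : ℕ, ‖c k l‖ * (r ^ k * r ^ l) ≤ C * (q ^ k * q ^ l)

/-- The double power series `∑ c k l f k l x ^ k z ^ l`. -/
def dsum (c f : ℕ → ℕ → ℂ) (x z : ℂ) : ℂ :=
  ∑' p : ℕ × ℕ, c p.1 p.2 * f p.1 p.2 * (x ^ p.1 * z ^ p.2)

theorem dsum_swap (c f : ℕ → ℕ → ℂ) (x z : ℂ) :
    dsum (fun k l => c l k) (fun k l => f l k) z x = dsum c f x z := by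
  unfold dsum
  rw [← (Equiv.prodComm ℕ ℕ).tsum_eq]
  simp [mul_comm]

theorem dsum_shift {c f g : ℕ → ℕ → ℂ} (h0 : ∀ l, c 0 l * f 0 l = 0)
    (hs : ∀ k l, c (k + 1) l * f (k + 1) l = c k l * g k l) (x z : ℂ) :
    dsum c f x z = x * dsum c g x z := by
  unfold dsum
  have hi : Function.Injective fun p : ℕ × ℕ => (p.1 + 1, p.2) := by
    rintro ⟨a, b⟩ ⟨a', b'⟩ h
    simpa using h
  rw [← hi.tsum_eq, ← tsum_mul_left]
  · refine tsum_congr fun p => ?_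
    rw [hs, pow_succ]
    ring
  · rintro ⟨k, l⟩ hp
    rcases k with _ | k
    · exact absurd (by simp [h0]) hp
    · exact ⟨(k, l), rfl⟩

section Convergence

variable {c : ℕ → ℕ → ℂ} {r : ℝ} {f g : ℕ → ℕ → ℂ}

/-- A summable bound for the terms of `dsum` that is uniform in the variables. -/
theorem exists_summable_bound (hc : GeometricBound c r) (hf : f ∈ polyGrowth) :
    ∃ u : ℕ × ℕ → ℝ, Summable u ∧ ∀ p, ‖c p.1 p.2 * f p.1 p.2‖ * (r ^ p.1 * r ^ p.2) ≤ u p := by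
  obtain ⟨C, q, hC, hq, hq1, h⟩ := hc
  obtain ⟨D, N, hD, hf⟩ := hf
  have hs : Summable fun k : ℕ => ((k : ℝ) + 1) ^ N * q ^ k := by
    have := (summable_nat_add_iff 1).mpr (summable_pow_mul_geometric_of_norm_lt_one N
      (r := q) (by rwa [Real.norm_of_nonneg hq.le]))
    refine (this.mul_left q⁻¹).congr fun k => ?_
    push_cast
    rw [pow_succ]
    field_simp
  refine ⟨fun p => C * D * ((((p.1 : ℝ) + 1) ^ N * q ^ p.1) * (((p.2 : ℝ) + 1) ^ N * q ^ p.2)),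
    (hs.mul_of_nonneg hs (fun _ => by positivity) fun _ => by positivity).mul_left _,
    fun p => ?_⟩
  rw [norm_mul, mul_right_comm]
  refine (mul_le_mul (h p.1 p.2) (hf p.1 p.2) (norm_nonneg _) (by positivity)).trans
    (le_of_eq ?_)
  rw [mul_pow]
  ring

theorem summable_dsum (hc : GeometricBound c r) (hf : f ∈ polyGrowth) {x z : ℂ}
    (hx : ‖x‖ < r) (hz : ‖z‖ < r) :
    Summable fun p : ℕ × ℕ => c p.1 p.2 * f p.1 p.2 * (x ^ p.1 * z ^ p.2) := by
  obtain ⟨u, hu, h⟩ := exists_summable_bound hc hf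
  have hr : 0 ≤ r := (norm_nonneg x).trans hx.le
  refine Summable.of_norm_bounded hu fun p => (le_trans ?_ (h p))
  rw [norm_mul (_ * _) (x ^ _ * z ^ _), norm_mul (x ^ _), norm_pow, norm_pow]
  gcongr

theorem dsum_sub (hc : GeometricBound c r) (hf : f ∈ polyGrowth) (hg : g ∈ polyGrowth) {x z : ℂ}
    (hx : ‖x‖ < r) (hz : ‖z‖ < r) :
    dsum c (fun k l => f k l - g k l) x z = dsum c f x z - dsum c g x z := by
  unfold dsum
  rw [← (summable_dsum hc hf hx hz).tsum_sub (summable_dsum hc hg hx hz)]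
  exact tsum_congr fun p => by ring

theorem dsum_add (hc : GeometricBound c r) (hf : f ∈ polyGrowth) (hg : g ∈ polyGrowth) {x z : ℂ}
    (hx : ‖x‖ < r) (hz : ‖z‖ < r) :
    dsum c (fun k l => f k l + g k l) x z = dsum c f x z + dsum c g x z := by
  unfold dsum
  rw [← (summable_dsum hc hf hx hz).tsum_add (summable_dsum hc hg hx hz)]
  exact tsum_congr fun p => by ring

theorem dsum_mul_left (a : ℂ) (x z : ℂ) :
    dsum c (fun k l => a * f k l) x z = a * dsum c f x z := by
  unfold dsum
  rw [← tsum_mul_left]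
  exact tsum_congr fun p => by ring

theorem dsum_sum {ι : Type} [Fintype ι] {f : ι → ℕ → ℕ → ℂ} (hc : GeometricBound c r)
    (hf : ∀ i, f i ∈ polyGrowth) (a : ι → ℂ) {x z : ℂ} (hx : ‖x‖ < r) (hz : ‖z‖ < r) :
    dsum c (fun k l => ∑ i, a i * f i k l) x z = ∑ i, a i * dsum c (f i) x z := by
  simp_rw [← dsum_mul_left]
  unfold dsum
  rw [← Summable.tsum_finsetSum fun i _ => summable_dsum hc (f := fun k l => a i * f i k l)
    (mul_mem (const_mem_polyGrowth (a i)) (hf i)) hx hz]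
  refine tsum_congr fun p => ?_
  rw [Finset.mul_sum, Finset.sum_mul]

/-- Written as x⁻¹ times the Euler operator, differentiation only multiplies the inserted polynomial
by k, so all derivatives stay within the same class of series. -/
theorem hasDerivAt_dsum (hc : GeometricBound c r) (hf : f ∈ polyGrowth) {x z : ℂ}
    (hx : ‖x‖ < r) (hz : ‖z‖ < r) (hx0 : x ≠ 0) :
    HasDerivAt (fun t => dsum c f t z) (x⁻¹ * dsum c (fun k l => k * f k l) x z) x := by
  have hr : 0 < r := (norm_nonneg _).trans_lt hx
  obtain ⟨u, hu, h⟩ := exists_summable_bound hc (mul_mem fst_mem_polyGrowth hf)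
  have key := hasDerivAt_tsum_of_isPreconnected (𝕜 := ℂ)
    (g := fun (p : ℕ × ℕ) (t : ℂ) => c p.1 p.2 * f p.1 p.2 * (t ^ p.1 * z ^ p.2))
    (g' := fun (p : ℕ × ℕ) (t : ℂ) =>
      c p.1 p.2 * f p.1 p.2 * (((p.1 : ℂ) * t ^ (p.1 - 1)) * z ^ p.2))
    (t := Metric.ball 0 r) (y₀ := x) (y := x) (hu.mul_left r⁻¹) Metric.isOpen_ball
    (convex_ball (0 : ℂ) r).isPreconnected (fun p t _ =>
      ((hasDerivAt_pow p.1 t).mul_const _).const_mul _) (fun p t ht => ?_)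
    (by simpa using hx) (summable_dsum hc hf hx hz) (by simpa using hx)
  · have e : x⁻¹ * dsum c (fun k l => k * f k l) x z
        = ∑' p : ℕ × ℕ, c p.1 p.2 * f p.1 p.2 * (((p.1 : ℂ) * x ^ (p.1 - 1)) * z ^ p.2) := by
      unfold dsum
      rw [← tsum_mul_left]
      refine tsum_congr fun p => ?_
      rcases Nat.eq_zero_or_pos p.1 with h0 | h0
      · simp [h0]
      · obtain ⟨k, hk⟩ := Nat.exists_eq_add_of_lt h0
        rw [hk, zero_add, Nat.add_sub_cancel, pow_succ]
        field_simp
    rw [e]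
    exact key
  -- The exponent `p.1 - 1` is truncated at zero, so the constant terms are treated apart; there the
  -- factor `p.1` is 0.
  · rcases Nat.eq_zero_or_pos p.1 with h0 | h0
    · have := h p
      simp only [Pi.mul_apply, h0, Nat.cast_zero, zero_mul, mul_zero, norm_zero] at this ⊢
      exact mul_nonneg (inv_nonneg.mpr hr.le) this
    · have ht' : ‖t‖ < r := by simpa using ht
      refine le_trans ?_ (mul_le_mul_of_nonneg_left (h p) (inv_nonneg.mpr hr.le))
      have e : r⁻¹ * (‖c p.1 p.2 * ((fun (k : ℕ) (_ : ℕ) => (k : ℂ)) * f) p.1 p.2‖ * (r ^ p.1 * r ^ p.2))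
          = ‖c p.1 p.2 * f p.1 p.2‖ * (((p.1 : ℝ) * r ^ (p.1 - 1)) * r ^ p.2) := by
        simp only [Pi.mul_apply, norm_mul, Complex.norm_natCast]
        obtain ⟨k, hk⟩ := Nat.exists_eq_add_of_lt h0
        rw [hk, zero_add, Nat.add_sub_cancel, pow_succ]
        field_simp
      rw [e, norm_mul, norm_mul (_ * _) (z ^ _), norm_mul (p.1 : ℂ), norm_pow, norm_pow,
        Complex.norm_natCast]
      gcongr

end Convergence

/-! ### The vector solution built from the hypergeometric series -/

section Series

variable {m n : ℕ}

/-- The recurrence relations of the coefficients of a hypergeometric double series whose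
exponents at the origin are `x` and `y`. -/
structure IsHypergeometric (α : Fin m → ℂ) (x : Fin (m + 1) → ℂ) (β : Fin n → ℂ)
    (y : Fin (n + 1) → ℂ) (γ : ℂ) (c : ℕ → ℕ → ℂ) : Prop where
  zero_fst : ∃ i, x i = 0
  zero_snd : ∃ j, y j = 0
  rec_fst : ∀ k l : ℕ, c (k + 1) l * ∏ i, (((k + 1 : ℕ) : ℂ) - x i)
    = c k l * ((∏ r, ((k : ℂ) + α r)) * (k + l + γ))
  rec_snd : ∀ k l : ℕ, c k (l + 1) * ∏ j, (((l + 1 : ℕ) : ℂ) - y j)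
    = c k l * ((∏ r, ((l : ℂ) + β r)) * (k + l + γ))

variable {α : Fin m → ℂ} {x ε : Fin (m + 1) → ℂ} {β : Fin n → ℂ} {y η : Fin (n + 1) → ℂ}
  {γ a b : ℂ} {c : ℕ → ℕ → ℂ} {r : ℝ}

theorem IsHypergeometric.swap (h : IsHypergeometric α x β y γ c) :
    IsHypergeometric β y α x γ (fun k l => c l k) where
  zero_fst := h.zero_snd
  zero_snd := h.zero_fst
  rec_fst k l := by rw [h.rec_snd, add_comm (l : ℂ) k]
  rec_snd k l := by rw [h.rec_fst, add_comm (l : ℂ) k]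

/-- The recurrence in k as a differential equation: ∏(ϑ_X - x_i) equals X ∏(ϑ_X + α_r)(ϑ_X + ϑ_Z +
γ) on the series. The terms with k = 0 drop out on the left because one exponent is 0. -/
theorem IsHypergeometric.dsum_fst (h : IsHypergeometric α x β y γ c) (g : ℕ → ℂ) (X Z : ℂ) :
    dsum c (fun k l => (∏ i, ((k : ℂ) - x i)) * g l) X Z
      = X * dsum c (fun k l => (∏ r, ((k : ℂ) + α r)) * (k + l + γ) * g l) X Z := by
  refine dsum_shift (fun l => ?_) (fun k l => ?_) X Z
  · obtain ⟨i, hi⟩ := h.zero_fst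
    rw [Finset.prod_eq_zero (Finset.mem_univ i) (by simp [hi]), zero_mul, mul_zero]
  · rw [← mul_assoc, h.rec_fst, mul_assoc]

theorem IsHypergeometric.dsum_snd (h : IsHypergeometric α x β y γ c) (g : ℕ → ℂ) (X Z : ℂ) :
    dsum c (fun k l => g k * ∏ j, ((l : ℂ) - y j)) X Z
      = Z * dsum c (fun k l => (∏ r, ((l : ℂ) + β r)) * (k + l + γ) * g k) X Z := by
  have := h.swap.dsum_fst g Z X
  rw [← dsum_swap, ← dsum_swap (f := fun k l => (∏ r, ((l : ℂ) + β r)) * (k + l + γ) * g k)]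
  simpa only [mul_comm (g _), add_comm (Nat.cast _ : ℂ) (Nat.cast _)] using this

/-- The double series with the coefficients `c` multiplied by the Lagrange polynomials of the
grid. -/
def gridSeries (c : ℕ → ℕ → ℂ) (x : Fin (m + 1) → ℂ) (y : Fin (n + 1) → ℂ) (X Z : ℂ) :
    Fin (m + 1) → Fin (n + 1) → ℂ :=
  fun i j => dsum c (fun k l => cofactor x k i * cofactor y l j) X Z

theorem gridSeries_swap (c : ℕ → ℕ → ℂ) (x : Fin (m + 1) → ℂ) (y : Fin (n + 1) → ℂ) (X Z : ℂ) :
    gridSeries (fun k l => c l k) y x Z X = Function.swap (gridSeries c x y X Z) := by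
  ext j i
  simp only [gridSeries, Function.swap]
  rw [← dsum_swap]
  simp only [mul_comm]

theorem cofactor_mul_mem_polyGrowth (x : Fin (m + 1) → ℂ) (y : Fin (n + 1) → ℂ)
    (i : Fin (m + 1)) (j : Fin (n + 1)) :
    (fun k l : ℕ => cofactor x k i * cofactor y l j) ∈ polyGrowth :=
  mul_mem (cofactor_mem_polyGrowth x i) (swap_mem_polyGrowth (cofactor_mem_polyGrowth y j))

theorem linear_mem_polyGrowth (γ : ℂ) : (fun k l : ℕ => (k : ℂ) + l + γ) ∈ polyGrowth :=
  add_mem (add_mem fst_mem_polyGrowth snd_mem_polyGrowth) (const_mem_polyGrowth γ)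

/-- Split x_i + y_j + γ = (k + l + γ) - (k - x_i) - (l - y_j). The weights turn the Lagrange
polynomials into ∏(k + α_r), while the last two terms complete them to ∏(k - x_i) and ∏(l - y_j),
which the recurrences trade for factors X and Z. -/
theorem colSum_gridSeries (hε : IsWeight α x ε a) (h : IsHypergeometric α x β y γ c)
    (hc : GeometricBound c r) {X Z : ℂ} (hX : ‖X‖ < r) (hZ : ‖Z‖ < r) (j : Fin (n + 1)) :
    colSum x ε y γ (gridSeries c x y X Z) j
      = (1 - X) * dsum c (fun k l => (∏ r, ((k : ℂ) + α r)) * (k + l + γ) * cofactor y l j) X Z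
        - Z * dsum c (fun k l => (∏ r, ((l : ℂ) + β r)) * (k + l + γ) * ∏ r, ((k : ℂ) + α r))
          X Z := by
  have hj := swap_mem_polyGrowth (cofactor_mem_polyGrowth y j)
  have h1 : (fun k l : ℕ => (∏ r, ((k : ℂ) + α r)) * (k + l + γ) * cofactor y l j)
      ∈ polyGrowth :=
    mul_mem (mul_mem (prod_add_mem_polyGrowth α) (linear_mem_polyGrowth γ)) hj
  have h2 : (fun k l : ℕ => (∏ i, ((k : ℂ) - x i)) * cofactor y l j) ∈ polyGrowth :=
    mul_mem (prod_sub_mem_polyGrowth x) hj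
  have h3 : (fun k l : ℕ => (∏ r, ((k : ℂ) + α r)) * ∏ j, ((l : ℂ) - y j)) ∈ polyGrowth :=
    mul_mem (prod_add_mem_polyGrowth α) (swap_mem_polyGrowth (prod_sub_mem_polyGrowth y))
  have h4 : (fun k l : ℕ => (∏ r, ((k : ℂ) + α r)) * (k + l + γ) * cofactor y l j
      - (∏ i, ((k : ℂ) - x i)) * cofactor y l j) ∈ polyGrowth := sub_mem h1 h2
  rw [one_sub_mul, ← h.dsum_fst (fun l => cofactor y l j), ← h.dsum_snd (fun k => ∏ r, ((k : ℂ) + α r)),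
    ← dsum_sub hc h1 h2 hX hZ, ← dsum_sub hc h4 h3 hX hZ]
  simp only [colSum, gridSeries, ← mul_assoc]
  rw [← dsum_sum hc (fun i => cofactor_mul_mem_polyGrowth x y i j) _ hX hZ]
  congr 1
  ext k l
  rw [← hε.interp, ← sub_mul_cofactor y _ j]
  have e : ∏ i, ((k : ℂ) - x i) = ∑ i, ε i * ((k - x i) * cofactor x k i) := by
    simp_rw [sub_mul_cofactor, ← Finset.sum_mul, hε.sum, one_mul]
  rw [e]
  simp only [Finset.sum_mul, ← Finset.sum_sub_distrib]
  exact Finset.sum_congr rfl fun i _ => by ring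

theorem totSum_gridSeries (hε : IsWeight α x ε a) (hη : IsWeight β y η b)
    (h : IsHypergeometric α x β y γ c)
    (hc : GeometricBound c r) {X Z : ℂ} (hX : ‖X‖ < r) (hZ : ‖Z‖ < r) :
    totSum x ε y η γ (gridSeries c x y X Z) = (1 - X - Z)
      * dsum c (fun k l => (∏ r, ((l : ℂ) + β r)) * (k + l + γ) * ∏ r, ((k : ℂ) + α r)) X Z := by
  have h1 : ∀ j, (fun k l : ℕ => (∏ r, ((k : ℂ) + α r)) * (k + l + γ) * cofactor y l j)
      ∈ polyGrowth := fun j =>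
    mul_mem (mul_mem (prod_add_mem_polyGrowth α) (linear_mem_polyGrowth γ))
      (swap_mem_polyGrowth (cofactor_mem_polyGrowth y j))
  have e : dsum c (fun k l => (∏ r, ((l : ℂ) + β r)) * (k + l + γ) * ∏ r, ((k : ℂ) + α r)) X Z
      = ∑ j, η j * dsum c
        (fun k l => (∏ r, ((k : ℂ) + α r)) * (k + l + γ) * cofactor y l j) X Z := by
    rw [← dsum_sum hc h1 _ hX hZ]
    congr 1
    ext k l
    rw [← hη.interp, Finset.sum_mul, Finset.sum_mul]
    exact Finset.sum_congr rfl fun i _ => by ring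
  rw [totSum_eq]
  simp_rw [colSum_gridSeries hε h hc hX hZ, mul_sub]
  rw [Finset.sum_sub_distrib, ← Finset.sum_mul, hη.sum, sub_mul, one_mul]
  congr 1
  rw [e, Finset.mul_sum]
  exact Finset.sum_congr rfl fun i _ => by ring

/-- By the first recurrence, ϑ_X u_ij = x_i u_ij + X G_j, where G_j is the first series in
`colSum_gridSeries`. With H the second one, the column sum is (1 - X) G_j - Z H and the total sum is
(1 - X - Z) H. So the poles at X + Z = 1 and X = 1 contribute H and G_j - H. -/
theorem hasDerivAt_gridSeries (hε : IsWeight α x ε a) (hη : IsWeight β y η b)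
    (h : IsHypergeometric α x β y γ c) (hc : GeometricBound c r) {X Z : ℂ} (hX : ‖X‖ < r)
    (hZ : ‖Z‖ < r) (hX0 : X ≠ 0) (hX1 : X - 1 ≠ 0) (hXZ : X + Z - 1 ≠ 0)
    (i : Fin (m + 1)) (j : Fin (n + 1)) :
    HasDerivAt (fun t => gridSeries c x y t Z i j)
      ((X + Z - 1)⁻¹ * -totSum x ε y η γ (gridSeries c x y X Z)
        + (X - 1)⁻¹ * (totSum x ε y η γ (gridSeries c x y X Z)
          - colSum x ε y γ (gridSeries c x y X Z) j)
        + X⁻¹ * (x i * gridSeries c x y X Z i j)) X := by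
  have h1 : (fun k l : ℕ => x i * (cofactor x k i * cofactor y l j)) ∈ polyGrowth :=
    mul_mem (const_mem_polyGrowth _) (cofactor_mul_mem_polyGrowth x y i j)
  have h2 : (fun k l : ℕ => (∏ i, ((k : ℂ) - x i)) * cofactor y l j) ∈ polyGrowth :=
    mul_mem (prod_sub_mem_polyGrowth x) (swap_mem_polyGrowth (cofactor_mem_polyGrowth y j))
  refine (hasDerivAt_dsum hc (cofactor_mul_mem_polyGrowth x y i j) hX hZ hX0).congr_deriv ?_
  have e : dsum c (fun k l => k * (cofactor x k i * cofactor y l j)) X Z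
      = x i * gridSeries c x y X Z i j
        + dsum c (fun k l => (∏ i, ((k : ℂ) - x i)) * cofactor y l j) X Z := by
    rw [gridSeries, ← dsum_mul_left, ← dsum_add hc h1 h2 hX hZ]
    congr 1
    ext k l
    rw [← sub_mul_cofactor x _ i]
    ring
  rw [e, h.dsum_fst (fun l => cofactor y l j), totSum_gridSeries hε hη h hc hX hZ,
    colSum_gridSeries hε h hc hX hZ]
  field_simp
  ring

end Series

/-! ### Growth of Pochhammer symbols and convergence of the series -/

section Bounds

theorem norm_ascPochhammer_le (α : ℂ) (k : ℕ) :
    ‖(ascPochhammer ℂ k).eval α‖ ≤ (‖α‖ + 1) ^ k * k.factorial := by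
  induction k with
  | zero => simp
  | succ k ih =>
    rw [ascPochhammer_succ_eval, norm_mul, pow_succ, Nat.factorial_succ, Nat.cast_mul,
      mul_comm ((k + 1 : ℕ) : ℝ), mul_mul_mul_comm]
    refine mul_le_mul ih ((norm_add_le _ _).trans ?_) (norm_nonneg _) (by positivity)
    rw [Complex.norm_natCast]
    push_cast
    nlinarith [norm_nonneg α, mul_nonneg (norm_nonneg α) (k.cast_nonneg (α := ℝ))]

theorem exists_factorial_le (α : ℂ) (hα : ∀ k : ℕ, α ≠ k + 1) :
    ∃ D : ℝ, 0 < D ∧ ∀ k : ℕ, (k.factorial : ℝ) ≤ D ^ k * ‖(ascPochhammer ℂ k).eval (1 - α)‖ := by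
  obtain ⟨K, hK⟩ := exists_nat_ge (2 * ‖α‖)
  have hpos : ∀ k : ℕ, 0 < ‖1 - α + k‖ := fun k => norm_pos_iff.mpr fun e => hα k <| by
    linear_combination -e
  -- For k ≥ K ≥ 2‖α‖ the constant 2 suffices in k + 1 ≤ D ‖1 - α + k‖; the sum covers the finitely
  -- many smaller k.
  set D : ℝ := 2 + ∑ k ∈ Finset.range K, ((k : ℝ) + 1) / ‖1 - α + k‖ with hD
  have hD2 : 2 ≤ D := le_add_of_nonneg_right (Finset.sum_nonneg fun k _ => by positivity)
  have key : ∀ k : ℕ, (k : ℝ) + 1 ≤ D * ‖1 - α + k‖ := fun k => by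
    rcases lt_or_ge k K with hk | hk
    · rw [← div_le_iff₀ (hpos k)]
      have := Finset.single_le_sum (f := fun k : ℕ => ((k : ℝ) + 1) / ‖1 - α + k‖)
        (fun k _ => by positivity) (Finset.mem_range.mpr hk)
      linarith
    · have h1 : ((k : ℝ) + 1) - ‖α‖ ≤ ‖1 - α + k‖ := by
        have := norm_sub_norm_le ((k : ℂ) + 1) α
        rw [show ((k : ℂ) + 1) = ((k + 1 : ℕ) : ℂ) by push_cast; rfl,
          Complex.norm_natCast] at this
        rw [show 1 - α + k = ((k + 1 : ℕ) : ℂ) - α by push_cast; ring]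
        push_cast at this ⊢
        exact this
      have h2 : (K : ℝ) ≤ k := by exact_mod_cast hk
      nlinarith [norm_nonneg (1 - α + k)]
  refine ⟨D, by linarith, fun k => ?_⟩
  induction k with
  | zero => simp
  | succ k ih =>
    rw [ascPochhammer_succ_eval, norm_mul, pow_succ, Nat.factorial_succ, Nat.cast_mul,
      mul_comm ((k + 1 : ℕ) : ℝ), mul_mul_mul_comm]
    push_cast
    exact mul_le_mul ih (key k) (by positivity) (by positivity)

/-- The denominator has one Pochhammer symbol more than the numerator. The spare factor k! absorbs
its share of (γ)_{k+l}, by `factorial_add_le`. -/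
theorem exists_prod_ascPochhammer_le {m : ℕ} (α : Fin m → ℂ) (α' : Fin (m + 1) → ℂ)
    (hα' : ∀ i, ∀ k : ℕ, α' i ≠ k + 1) :
    ∃ ρ : ℝ, 0 < ρ ∧ ∀ k : ℕ, ‖∏ i, (ascPochhammer ℂ k).eval (α i)‖ * k.factorial
      ≤ ρ ^ k * ‖∏ i, (ascPochhammer ℂ k).eval (1 - α' i)‖ := by
  choose D hD hle using fun i => exists_factorial_le (α' i) (hα' i)
  refine ⟨(∏ i, (‖α i‖ + 1)) * ∏ i, D i,
    mul_pos (Finset.prod_pos fun i _ => by positivity) (Finset.prod_pos fun i _ => hD i),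
    fun k => ?_⟩
  have h1 : ‖∏ i, (ascPochhammer ℂ k).eval (α i)‖
      ≤ (∏ i, (‖α i‖ + 1)) ^ k * (k.factorial : ℝ) ^ m := by
    rw [norm_prod]
    refine (Finset.prod_le_prod (fun i _ => norm_nonneg _)
      fun i _ => norm_ascPochhammer_le (α i) k).trans (le_of_eq ?_)
    rw [Finset.prod_mul_distrib, Finset.prod_pow, Finset.prod_const, Finset.card_univ,
      Fintype.card_fin]
  have h2 : (k.factorial : ℝ) ^ (m + 1)
      ≤ (∏ i, D i) ^ k * ‖∏ i, (ascPochhammer ℂ k).eval (1 - α' i)‖ := by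
    have := Finset.prod_le_prod (s := Finset.univ) (fun i _ => by positivity)
      fun i _ => hle i k
    rwa [Finset.prod_mul_distrib, Finset.prod_pow, Finset.prod_const, Finset.card_univ,
      Fintype.card_fin, ← norm_prod] at this
  calc _ ≤ (∏ i, (‖α i‖ + 1)) ^ k * (k.factorial : ℝ) ^ m * k.factorial :=
        mul_le_mul_of_nonneg_right h1 (by positivity)
    _ = (∏ i, (‖α i‖ + 1)) ^ k * (k.factorial : ℝ) ^ (m + 1) := by rw [pow_succ, mul_assoc]
    _ ≤ _ := by
        rw [mul_pow, mul_assoc]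
        exact mul_le_mul_of_nonneg_left h2
          (pow_nonneg (Finset.prod_nonneg fun i _ => by positivity) _)

theorem factorial_add_le (k l : ℕ) :
    ((k + l).factorial : ℝ) ≤ 2 ^ (k + l) * (k.factorial * l.factorial) := by
  rw [← Nat.add_choose_mul_factorial_mul_factorial]
  push_cast
  rw [mul_assoc]
  exact mul_le_mul_of_nonneg_right (by exact_mod_cast Nat.choose_le_two_pow _ _) (by positivity)

end Bounds

section Coefficients

variable {m n : ℕ} {α : Fin m → ℂ} {α' : Fin (m + 1) → ℂ} {β : Fin n → ℂ}
  {β' : Fin (n + 1) → ℂ} {γ : ℂ}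

theorem prod_ascPochhammer_ne_zero (hα' : ∀ i, ∀ k : ℕ, α' i ≠ k + 1) (k : ℕ) :
    ∏ i, (ascPochhammer ℂ k).eval (1 - α' i) ≠ 0 := by
  refine Finset.prod_ne_zero_iff.mpr fun i _ => ?_
  obtain ⟨D, -, h⟩ := exists_factorial_le (α' i) (hα' i)
  intro e
  have := h k
  rw [e, norm_zero, mul_zero] at this
  exact absurd this (not_le.mpr (by positivity))

theorem coeffI_swap (α : Fin m → ℂ) (α' : Fin (m + 1) → ℂ) (β : Fin n → ℂ)
    (β' : Fin (n + 1) → ℂ) (γ : ℂ) (k l : ℕ) :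
    coeffI β β' α α' γ l k = coeffI α α' β β' γ k l := by
  unfold coeffI
  rw [mul_comm (∏ j, (ascPochhammer ℂ l).eval (β j)), add_comm l k,
    mul_comm (∏ j, (ascPochhammer ℂ l).eval (1 - β' j))]

theorem coeffI_succ (hα' : ∀ i, ∀ k : ℕ, α' i ≠ k + 1) (hβ' : ∀ j, ∀ k : ℕ, β' j ≠ k + 1)
    (k l : ℕ) :
    coeffI α α' β β' γ (k + 1) l * ∏ i, (((k + 1 : ℕ) : ℂ) - α' i)
      = coeffI α α' β β' γ k l * ((∏ r, ((k : ℂ) + α r)) * (k + l + γ)) := by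
  have h1 := prod_ascPochhammer_ne_zero hα' k
  have h2 := prod_ascPochhammer_ne_zero hα' (k + 1)
  have h3 := prod_ascPochhammer_ne_zero hβ' l
  have e : ∏ i, (ascPochhammer ℂ (k + 1)).eval (1 - α' i)
      = (∏ i, (ascPochhammer ℂ k).eval (1 - α' i)) * ∏ i, (((k + 1 : ℕ) : ℂ) - α' i) := by
    rw [← Finset.prod_mul_distrib]
    refine Finset.prod_congr rfl fun i _ => ?_
    rw [ascPochhammer_succ_eval]
    push_cast
    ring
  have e' : ∏ i, (ascPochhammer ℂ (k + 1)).eval (α i)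
      = (∏ i, (ascPochhammer ℂ k).eval (α i)) * ∏ i, ((k : ℂ) + α i) := by
    rw [← Finset.prod_mul_distrib]
    refine Finset.prod_congr rfl fun i _ => ?_
    rw [ascPochhammer_succ_eval, add_comm (k : ℂ)]
  unfold coeffI
  rw [e, e', show k + 1 + l = k + l + 1 by ring, ascPochhammer_succ_eval]
  rw [e] at h2
  have h4 := right_ne_zero_of_mul h2
  push_cast at h4 ⊢
  field_simp
  ring

theorem isHypergeometric_coeffI (hx : ∃ i, α' i = 0) (hy : ∃ j, β' j = 0)
    (hα' : ∀ i, ∀ k : ℕ, α' i ≠ k + 1) (hβ' : ∀ j, ∀ k : ℕ, β' j ≠ k + 1) :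
    IsHypergeometric α α' β β' γ (coeffI α α' β β' γ) where
  zero_fst := hx
  zero_snd := hy
  rec_fst := coeffI_succ hα' hβ'
  rec_snd k l := by
    rw [← coeffI_swap α, ← coeffI_swap α, coeffI_succ hβ' hα', add_comm (l : ℂ)]

theorem exists_geometricBound_coeffI (hα' : ∀ i, ∀ k : ℕ, α' i ≠ k + 1)
    (hβ' : ∀ j, ∀ k : ℕ, β' j ≠ k + 1) :
    ∃ r : ℝ, 0 < r ∧ GeometricBound (coeffI α α' β β' γ) r := by
  obtain ⟨ρ, hρ, h1⟩ := exists_prod_ascPochhammer_le α α' hα'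
  obtain ⟨σ, hσ, h2⟩ := exists_prod_ascPochhammer_le β β' hβ'
  set τ : ℝ := 2 * (‖γ‖ + 1) with hτ
  have hτ0 : 0 < τ := by positivity
  have key : ∀ k l, ‖coeffI α α' β β' γ k l‖ ≤ (ρ * τ) ^ k * (σ * τ) ^ l := fun k l => by
    have h3 : ‖(ascPochhammer ℂ (k + l)).eval γ‖
        ≤ τ ^ (k + l) * (k.factorial * l.factorial) := by
      refine (norm_ascPochhammer_le γ (k + l)).trans ?_
      refine (mul_le_mul_of_nonneg_left (factorial_add_le k l) (by positivity)).trans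
        (le_of_eq ?_)
      rw [hτ, mul_pow]
      ring
    unfold coeffI
    rw [norm_div, norm_mul, norm_mul, norm_mul, div_le_iff₀ (mul_pos
      (norm_pos_iff.mpr (prod_ascPochhammer_ne_zero hα' k))
      (norm_pos_iff.mpr (prod_ascPochhammer_ne_zero hβ' l)))]
    calc _ ≤ ‖∏ i, (ascPochhammer ℂ k).eval (α i)‖ * ‖∏ j, (ascPochhammer ℂ l).eval (β j)‖
          * (τ ^ (k + l) * (k.factorial * l.factorial)) :=
          mul_le_mul_of_nonneg_left h3 (by positivity)
      _ = τ ^ (k + l) * ((‖∏ i, (ascPochhammer ℂ k).eval (α i)‖ * k.factorial)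
          * (‖∏ j, (ascPochhammer ℂ l).eval (β j)‖ * l.factorial)) := by ring
      _ ≤ τ ^ (k + l) * ((ρ ^ k * ‖∏ i, (ascPochhammer ℂ k).eval (1 - α' i)‖)
          * (σ ^ l * ‖∏ j, (ascPochhammer ℂ l).eval (1 - β' j)‖)) :=
          mul_le_mul_of_nonneg_left
            (mul_le_mul (h1 k) (h2 l) (by positivity) (by positivity)) (by positivity)
      _ = (ρ * τ) ^ k * (σ * τ) ^ l * (‖∏ i, (ascPochhammer ℂ k).eval (1 - α' i)‖
          * ‖∏ j, (ascPochhammer ℂ l).eval (1 - β' j)‖) := by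
          rw [mul_pow ρ, mul_pow σ, pow_add]; ring
  -- Chosen so that both ratios ρτr and στr are at most 1/2.
  set r : ℝ := (2 * (ρ * τ + σ * τ))⁻¹ with hr
  have hr0 : 0 < r := by positivity
  have hrr : (ρ * τ + σ * τ) * r = 1 / 2 := by
    rw [hr]
    have : ρ * τ + σ * τ ≠ 0 := by positivity
    field_simp
  have hρr : ρ * τ * r ≤ 1 / 2 := by
    have : 0 ≤ σ * τ * r := by positivity
    linarith
  have hσr : σ * τ * r ≤ 1 / 2 := by
    have : 0 ≤ ρ * τ * r := by positivity
    linarith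
  refine ⟨r, hr0, 1, 1 / 2, zero_le_one, by norm_num, by norm_num, fun k l => ?_⟩
  calc _ ≤ (ρ * τ) ^ k * (σ * τ) ^ l * (r ^ k * r ^ l) :=
        mul_le_mul_of_nonneg_right (key k l) (by positivity)
    _ = (ρ * τ * r) ^ k * (σ * τ * r) ^ l := by rw [mul_pow _ r, mul_pow _ r]; ring
    _ ≤ _ := by
        rw [one_mul]
        exact mul_le_mul (pow_le_pow_left₀ (by positivity) hρr k)
          (pow_le_pow_left₀ (by positivity) hσr l) (by positivity) (by positivity)

end Coefficients

/-! ### The series as a component of a solution -/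

section Realizes

variable {m n : ℕ} {α : Fin m → ℂ} {x ε : Fin (m + 1) → ℂ} {β : Fin n → ℂ}
  {y η : Fin (n + 1) → ℂ} {γ a b : ℂ} {c : ℕ → ℕ → ℂ} {r : ℝ}

theorem Represents.realizes {S : KZ} (hS : Represents S x ε y η γ) (hx : Function.Injective x)
    (hy : Function.Injective y) (hε : IsWeight α x ε a) (hη : IsWeight β y η b)
    (h : IsHypergeometric α x β y γ c) (hr : 0 < r) (hc : GeometricBound c r) :
    S.Realizes c := by
  obtain ⟨e, he⟩ := hS
  obtain ⟨v, hv⟩ := exists_sum_mul_cofactor x hx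
  obtain ⟨w, hw⟩ := exists_sum_mul_cofactor y hy
  set U := gridSeries c x y with hU
  -- The form `L` combines the Lagrange polynomials to the constant 1, so it sends the vector
  -- solution to the original series.
  let L : (Fin (m + 1) → Fin (n + 1) → ℂ) →ₗ[ℂ] ℂ :=
    ∑ i, ∑ j, (v i * w j) • ((LinearMap.proj j : (Fin (n + 1) → ℂ) →ₗ[ℂ] ℂ) ∘ₗ LinearMap.proj i)
  have hL : ∀ f, L f = ∑ i, v i * ∑ j, w j * f i j := fun f => by
    simp [L, Finset.mul_sum, mul_assoc]
  refine ⟨r, hr, fun s t => e.symm (U s (1 - t)), L ∘ₗ e.toLinearMap, ?_, ?_⟩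
  · rintro s t ⟨hs, ht⟩ hst hs0 hs1 ht0 ht1 ψ
    have hX : ‖s‖ < r := by simpa using hs
    have hZ : ‖1 - t‖ < r := by
      rw [norm_sub_rev]
      simpa [dist_eq_norm] using ht
    have hA : ∀ i j f, S.A i j (e.symm f) = e.symm (gridRes x ε y η γ i j f) := fun i j f => by
      rw [e.eq_symm_apply, he, e.apply_symm_apply]
    let χ := LinearMap.toContinuousLinearMap (ψ ∘ₗ e.symm.toLinearMap)
    have hχ : ∀ f, ψ (e.symm f) = χ f := fun _ => rfl
    simp only [hA, ← map_smul, ← map_add]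
    simp only [hχ]
    constructor
    · refine χ.hasFDerivAt.comp_hasDerivAt s ?_
      refine hasDerivAt_pi.mpr fun i => hasDerivAt_pi.mpr fun j => ?_
      refine (hasDerivAt_gridSeries hε hη h hc hX hZ hs0 (sub_ne_zero.mpr hs1)
        (by rwa [show s + (1 - t) - 1 = s - t by ring, sub_ne_zero]) i j).congr_deriv ?_
      simp only [map_smul, Pi.add_apply, Pi.smul_apply, gridRes_01, gridRes_02, gridRes_03, smul_eq_mul]
      rw [show s + (1 - t) - 1 = s - t by ring]
    · refine χ.hasFDerivAt.comp_hasDerivAt t ?_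
      refine hasDerivAt_pi.mpr fun i => hasDerivAt_pi.mpr fun j => ?_
      have hc' : GeometricBound (fun k l => c l k) r := by
        obtain ⟨C, q, hC, hq, hq1, hb⟩ := hc
        exact ⟨C, q, hC, hq, hq1, fun k l => by
          rw [mul_comm (r ^ k), mul_comm (q ^ k)]; exact hb l k⟩
      -- The y-derivative is the x-derivative of the transposed series, composed with t ↦ 1 - t; the
      -- sign of the inner derivative is absorbed by the poles 1 - t, -t and s - t.
      have := hasDerivAt_gridSeries hη hε h.swap hc' hZ hX (sub_ne_zero.mpr ht1.symm)
        (by simpa using ht0) (by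
          rw [show 1 - t + s - 1 = s - t by ring]; exact sub_ne_zero.mpr hst) j i
      rw [gridSeries_swap, totSum_swap] at this
      have h2 := this.comp t ((hasDerivAt_id' t).const_sub 1)
      simp only [gridSeries_swap, Function.swap, Function.comp_def] at h2
      have e2 : colSum y η x γ (Function.swap (U s (1 - t))) i
          = rowSum x y η γ (U s (1 - t)) i := by
        simp only [colSum, rowSum, Function.swap, add_comm (y _)]
      refine h2.congr_deriv ?_
      simp only [map_smul, Pi.add_apply, Pi.smul_apply, gridRes_01, gridRes_12, gridRes_13, smul_eq_mul,
        ← hU]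
      rw [e2, show 1 - t + s - 1 = -(t - s) by ring, show 1 - t - 1 = -t by ring,
        show 1 - t = -(t - 1) by ring, inv_neg, inv_neg, inv_neg]
      ring
  · intro s hs t ht
    have hX : ‖s‖ < r := by simpa using hs
    have hZ : ‖1 - t‖ < r := by
      rw [norm_sub_rev]
      simpa [dist_eq_norm] using ht
    have e1 : (L ∘ₗ e.toLinearMap) (e.symm (U s (1 - t))) = dsum c (fun _ _ => 1) s (1 - t) := by
      rw [LinearMap.comp_apply, LinearEquiv.coe_coe, e.apply_symm_apply, hL]
      simp only [hU, gridSeries]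
      simp_rw [← dsum_sum hc (fun j => cofactor_mul_mem_polyGrowth x y _ j) w hX hZ]
      rw [← dsum_sum hc (f := fun i k l => ∑ j, w j * (cofactor x k i * cofactor y l j))
        (fun i => ?_) v hX hZ]
      · congr 1
        ext k l
        simp_rw [mul_left_comm (w _), ← Finset.mul_sum, hw, mul_one, hv]
      · convert sum_mem (S := polyGrowth) (t := Finset.univ) fun j _ =>
          mul_mem (const_mem_polyGrowth (w j)) (cofactor_mul_mem_polyGrowth x y i j) using 1
        ext k l
        simp [Finset.sum_apply]
    rw [e1]
    have := (summable_dsum hc (const_mem_polyGrowth 1) hX hZ).hasSum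
    simpa only [dsum, mul_one, ← mul_assoc] using this

end Realizes

/-! ### Rank, bookkeeping of multisets and assembly of the theorem -/

theorem Represents.finrank_eq {m n : ℕ} {S : KZ} {x ε : Fin (m + 1) → ℂ}
    {y η : Fin (n + 1) → ℂ} {γ : ℂ} (hS : Represents S x ε y η γ) :
    Module.finrank ℂ S.V = (m + 1) * (n + 1) := by
  obtain ⟨e, -⟩ := hS
  rw [e.finrank_eq, Module.finrank_pi_fintype]
  simp

theorem HasJointBasis.simEig_of_eq {V : Type} [AddCommGroup V] [Module ℂ V]
    {A B : Module.End ℂ V} {M N : Multiset (ℂ × ℂ)} (h : HasJointBasis A B M)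
    (e : M = N) : SimEig A B N :=
  e ▸ h.simEig

theorem map_swap_ev (a b : ℂ) (k : ℕ) : (ev a b k).map Prod.swap = ev b a k := by
  simp [ev]

theorem map_swap_sum {ι : Type} [Fintype ι] (f : ι → Multiset (ℂ × ℂ)) :
    (∑ i, f i).map Prod.swap = ∑ i, (f i).map Prod.swap :=
  map_sum (Multiset.mapAddMonoidHom Prod.swap) f _

end KZF2

end

theorem mainTheorem6 (m n : ℕ) (α : Fin m → ℂ) (α' : Fin (m + 1) → ℂ)
    (β : Fin n → ℂ) (β' : Fin (n + 1) → ℂ) (γ a b : ℂ)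
    (hα' : α' (Fin.last m) = 0) (hβ' : β' (Fin.last n) = 0)
    (hgen : KZF2.Generic α α' β β' γ)
    (ha : a = ∑ i, α i + ∑ i, α' i) (hb : b = ∑ j, β j + ∑ j, β' j)
    (S : KZF2.KZ) (hS : S = KZF2.kzI α α' β β' γ) :
    -- with `p = m + 1`, `q = n + 1`: a KZ-type equation of rank `p q` realizing `I_{p,q}(x, 1 - y)`
    S.IsKZType ∧ Module.finrank ℂ S.V = (m + 1) * (n + 1) ∧
    S.Realizes (KZF2.coeffI α α' β β' γ) ∧
    -- the simultaneous eigenvalues of the 15 commuting pairs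
    KZF2.SimEig (S.A 0 1) (S.A 2 3)
      (KZF2.ev (-a - b - γ) γ + KZF2.ev 0 γ (m + n)
        + ∑ i, ∑ j, KZF2.ev 0 (α i + β j)) ∧
    KZF2.SimEig (S.A 0 1) (S.A 2 4)
      (KZF2.ev (-a - b - γ) (-b - γ) + KZF2.ev 0 (-b - γ) m
        + ∑ i, KZF2.ev 0 (α' i) n) ∧
    KZF2.SimEig (S.A 0 1) (S.A 3 4)
      (KZF2.ev (-a - b - γ) (-a - γ) + ∑ j, KZF2.ev 0 (β' j) m
        + KZF2.ev 0 (-a - γ) n) ∧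
    KZF2.SimEig (S.A 0 2) (S.A 1 3)
      (∑ i, KZF2.ev 0 (α i - b - γ) + KZF2.ev 0 0 (m * n + 1)
        + ∑ j, KZF2.ev (β j - a - γ) 0) ∧
    KZF2.SimEig (S.A 0 2) (S.A 1 4)
      (∑ i, KZF2.ev 0 (α' i + γ) + ∑ j, KZF2.ev 0 (β j) m
        + ∑ j, KZF2.ev (β j - a - γ) (β j)) ∧
    KZF2.SimEig (S.A 0 2) (S.A 3 4)
      (KZF2.ev 0 (-a - γ) + ∑ j, KZF2.ev 0 (β' j) m
        + ∑ j, KZF2.ev (β j - a - γ) (-a - γ)) ∧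
    KZF2.SimEig (S.A 0 3) (S.A 1 2)
      (∑ i, ∑ j, KZF2.ev (α' i) (β' j)) ∧
    KZF2.SimEig (S.A 0 3) (S.A 1 4)
      (∑ i, KZF2.ev (α' i) (α' i + γ) + ∑ i, ∑ j, KZF2.ev (α' i) (β j)) ∧
    KZF2.SimEig (S.A 0 3) (S.A 2 4)
      (∑ i, KZF2.ev (α' i) (-b - γ) + ∑ i, KZF2.ev (α' i) (α' i) n) ∧
    KZF2.SimEig (S.A 0 4) (S.A 1 2)
      (∑ i, ∑ j, KZF2.ev (α i) (β' j) + ∑ j, KZF2.ev (β' j + γ) (β' j)) ∧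
    KZF2.SimEig (S.A 0 4) (S.A 1 3)
      (∑ i, KZF2.ev (α i) (α i - b - γ) + ∑ i, KZF2.ev (α i) 0 n
        + ∑ j, KZF2.ev (β' j + γ) 0) ∧
    KZF2.SimEig (S.A 0 4) (S.A 2 3)
      (∑ i, KZF2.ev (α i) γ + ∑ j, KZF2.ev (β' j + γ) γ
        + ∑ i, ∑ j, KZF2.ev (α i) (α i + β j)) ∧
    KZF2.SimEig (S.A 1 2) (S.A 3 4)
      (∑ j, KZF2.ev (β' j) (-a - γ) + ∑ j, KZF2.ev (β' j) (β' j) m) ∧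
    KZF2.SimEig (S.A 1 3) (S.A 2 4)
      (∑ i, KZF2.ev (α i - b - γ) (-b - γ) + KZF2.ev 0 (-b - γ)
        + ∑ i, KZF2.ev 0 (α' i) n) ∧
    KZF2.SimEig (S.A 1 4) (S.A 2 3)
      (∑ i, KZF2.ev (α' i + γ) γ + ∑ j, KZF2.ev (β j) γ
        + ∑ i, ∑ j, KZF2.ev (β j) (α i + β j)) := by
  have hR := KZF2.represents_kzI hα' hβ' hgen
  have hG := hgen.gridGeneric hα' hβ'
  rw [← hS] at hR
  have hK := hG.isKZType hR
  have hx : ∃ i, α' i = 0 := ⟨_, hα'⟩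
  have hy : ∃ j, β' j = 0 := ⟨_, hβ'⟩
  obtain ⟨r, hr, hc⟩ := KZF2.exists_geometricBound_coeffI (α := α) (β := β) (γ := γ)
    hgen.series_α hgen.series_β
  have hreal := hR.realizes hgen.inj_α' hgen.inj_β' (KZF2.isWeight_weights α α' hgen.inj_α')
    (KZF2.isWeight_weights β β' hgen.inj_β')
    (KZF2.isHypergeometric_coeffI hx hy hgen.series_α hgen.series_β) hr hc
  rw [← ha, ← hb] at hG
  refine ⟨hK, hR.finrank_eq, hreal, (hG.jointBasis_01_23 hR).simEig,
    (hG.jointBasis_01_24 hR).simEig, ?_, (hG.jointBasis_02_13 hR).simEig,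
    (hG.jointBasis_02_14 hR).simEig, ?_, (KZF2.GridGeneric.jointBasis_03_12 hR).simEig,
    (hG.jointBasis_03_14 hR).simEig, (hG.jointBasis_03_24 hR).simEig, ?_, ?_, ?_,
    (hG.jointBasis_12_34 hR).simEig, (hG.jointBasis_13_24 hR).simEig,
    (hG.jointBasis_14_23 hR).simEig⟩
  · rw [hK.symm 0 1]
    refine (hG.jointBasis_01_34 hR).simEig_of_eq ?_
    rw [show -b - a - γ = -a - b - γ by ring]
    abel
  · refine (hG.jointBasis_02_34 hR).simEig_of_eq ?_
    abel
  · refine (hG.jointBasis_12_04 hR).swap.simEig_of_eq ?_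
    simp only [Multiset.map_add, KZF2.map_swap_sum, KZF2.map_swap_ev]
    rw [add_comm, Finset.sum_comm]
  · refine (hG.jointBasis_13_04 hR).swap.simEig_of_eq ?_
    simp only [Multiset.map_add, KZF2.map_swap_sum, KZF2.map_swap_ev]
    abel
  · rw [hK.symm 2 3]
    refine (hG.jointBasis_04_32 hR).simEig_of_eq ?_
    rw [Finset.sum_comm]
    simp only [add_comm (β _) (α _)]
    abel
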